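/- **Setting.** Let $\gamma>1$ and consider states $w=(\rho,\rho u,B,E)\in\mathbb R^8$ with $u,B\in\mathbb R^3$, $\rho e=E-\tfrac12\rho|u|^2-\tfrac12|B|^2$, $p=(\gamma-1)\rho e$. A state is *admissible* if $\rho>0$ and $p>0$. Let $f_d(w)=\big(\rho u_d,\ \rho u_du-B_dB+(p+\tfrac{|B|^2}2)e_d,\ u_dB-B_du,\ (E+p+\tfrac{|B|^2}2)u_d-(u\cdot B)B_d\big)$ be the ideal MHD fluxes and $S(w)=(0,B,u,u\cdot B)$ the coefficient of the Godunov–Powell (GP) source term. *Nodes.* Let $k\ge1$, let $x_0<\dots<x_k$ be the Legendre–Gauss–Lobatto (LGL) nodes on $[-1,1]$ (the zeros of $(1-x^2)P_k'(x)$), $l_\alpha$ the nodal basis, $\omega_\alpha=\int_{-1}^1l_\alpha$, $D_{\alpha\beta}=l_\beta'(x_\alpha)$, and $(\tau_0,\dots,\tau_k)=(-1,0,\dots,0,1)$. *Fluxes.* Let $f_{d,S}(w,z)$ be a two-point flux that is symmetric and consistent ($f_{d,S}(w,w)=f_d(w)$) on admissible states. For a left and a right state $w_L,w_R$ at an interface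 with normal $e_d$ and signal speeds $S_L=S_L(w_L,w_R)$, $S_R=S_R(w_L,w_R)$ let $$\hat f_d=\frac{S_Rf_d(w_L)-S_Lf_d(w_R)+S_LS_R(w_R-w_L)}{S_R-S_L},\qquad \hat B_d=\frac{S_RB_d(w_L)-S_LB_d(w_R)}{S_R-S_L}$$ (HLL flux). Put $$\alpha^r_d(w,z)=\max\{u_d(w),\bar u_d\}+C_d(w)+\frac{|B(w)-B(z)|}{\sqrt{\rho(w)}+\sqrt{\rho(z)}},\qquad \alpha^l_d(w,z)=\min\{u_d(w),\bar u_d\}-C_d(w)-\frac{|B(w)-B(z)|}{\sqrt{\rho(w)}+\sqrt{\rho(z)}},$$ where $\bar u_d=\frac{\sqrt{\rho(w)}u_d(w)+\sqrt{\rho(z)}u_d(z)}{\sqrt{\rho(w)}+\sqrt{\rho(z)}}$ and $C_d^2=\tfrac12\Big(C_s^2+\tfrac{|B|^2}\rho+\sqrt{\big(C_s^2+\tfrac{|B|^2}\rho\big)^2-4C_s^2\tfrac{B_d^2}\rho}\Big)$, $C_s=\frac p{\rho\sqrt{2e}}$. The signal speeds are assumed to satisfy, for all admissible $w_L,w_R$: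 $S_L\le0\le S_R$, $S_L<S_R$, $S_L\le\alpha^l_d(w_L,w_R)$, $S_R\ge\alpha^r_d(w_R,w_L)$. *Scheme.* On a line of nodal values $v_0,\dots,v_k$ in direction $d$ with exterior traces $e_L,e_R$ put $$R_\alpha=\frac{\tau_\alpha}{\omega_\alpha}F^*_\alpha-2\sum_\beta D_{\alpha\beta}f_{d,S}(v_\alpha,v_\beta)-\sum_\beta D_{\alpha\beta}B_d(v_\beta)S(v_\alpha),$$ where $F^*_0=f_d(v_0)-\hat f_d(e_L,v_0)+S(v_0)\big(B_d(v_0)-\hat B_d(e_L,v_0)\big)$, $F^*_k=f_d(v_k)-\hat f_d(v_k,e_R)+S(v_k)\big(B_d(v_k)-\hat B_d(v_k,e_R)\big)$, and $F_\alpha^*=0$ otherwise; and let $$\mathcal B_d=\hat f_d(e_L,v_0)-\hat f_d(v_k,e_R)+S(v_k)\big(B_d(v_k)-\hat B_d(v_k,e_R)\big)-S(v_0)\big(B_d(v_0)-\hat B_d(e_L,v_0)\big).$$ In 1D, on uniform cells of length $h$, the semi-discrete scheme is $\frac{dw_{i\alpha}}{dt}=\frac2hR_\alpha$ with cell average $\bar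 w=\frac12\sum_\alpha\omega_\alpha w_\alpha$. In 2D, on uniform cells $I_{ij}$ of size $h_x\times h_y$, it is $\frac{dw_{ij\alpha\beta}}{dt}=(L_hw)_{ij\alpha\beta}:=\frac2{h_x}R^x_\alpha+\frac2{h_y}R^y_\beta$ (the line procedure in each direction), with $\bar w=\frac14\sum_{\alpha,\beta}\omega_\alpha\omega_\beta w_{\alpha\beta}$. Exterior traces come from the neighbouring cells; at the domain boundary they are prescribed functions of the numerical solution that are admissible whenever all nodal values are. The field is *locally divergence-free (LDF)* if the piecewise polynomial $(B_1,B_2)$ interpolating the nodal values satisfies $\partial_xB_1+\partial_yB_2=0$ in every cell (in 1D: $\partial_xB_1=0$). *CFL condition.* Let $\sigma_\alpha$ be, on a line as above, $\sigma_0=S_R-\alpha^l_d(v_0,v_k)+\frac{S_R}{S_R-S_L}\frac{|B_d(v_0)-B_d(e_L)|}{\sqrt{\rho(v_0)}}$ with $S_{L,R}=S_{L,R}(e_L,v_0)$; $\sigma_k=\alpha^r_d(v_k,v_0)-S_L+\frac{-S_L}{S_R-S_L}\frac{|B_d(e_R)-B_d(v_k)|}{\sqrt{\rho(v_k)}}$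 with $S_{L,R}=S_{L,R}(v_k,e_R)$; and $\sigma_\alpha=0$ otherwise. A step size $\Delta t\ge0$ satisfies the CFL condition at $w$ if $\Delta t\big(\frac{\sigma_{x,ij\alpha\beta}}{h_x}+\frac{\sigma_{y,ij\alpha\beta}}{h_y}\big)<\frac{\omega_0}2$ at all nodes (in 1D: $\Delta t\,\sigma_{i\alpha}/h<\omega_0/2$). *Limiting.* $P_\tau$ is the composition of the following three steps. (1) The LDF projection: in each cell the Piola image $\hat B_0=(\frac{h_y}2B_1,\frac{h_x}2B_2)$ on $K=[-1,1]^2$ is replaced by $\hat B\in Q^k(K)^2$ such that, for some $\hat p\in M=Q^{k-1,k}+Q^{k,k-1}$, $\int_K\hat B\cdot v+\int_K\hat p\,\nabla\cdot v=\int_K\hat B_0\cdot v$ for all $v\in Q^k(K)^2$ and $\int_Kq\,\nabla\cdot\hat B=0$ for all $q\in M$; the other components are kept. (2) The OEDG damping $w\mapsto\bar w+e^{-\tau\sum_{m=0}^k\delta^m}(w-\bar w)$ in each cell, with arbitrary real coefficients $\delta^m=\delta^m_{ij}(w)$. (3) The Zhang–Shu positivity-preserving (PP) limiter on the LGL nodes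 with a threshold $\varepsilon>0$: in each cell, first $\rho\mapsto\bar\rho+\theta_1(\rho-\bar\rho)$, then $w\mapsto\bar w+\theta_2(w-\bar w)$, where $\theta_1=1$ if $\min\rho\ge\varepsilon_1:=\min(\varepsilon,\bar\rho)$ and $\theta_1=\frac{\bar\rho-\varepsilon_1}{\bar\rho-\min\rho}$ otherwise, and $\theta_2$ is formed in the same way from $\rho e$ at the nodes and at the cell average (minima over the LGL nodes of the cell). **Theorem.** The entropy conservative flux of Chandrashekar, $f_{d,S}=(F^\rho,F^m,F^B,F^E)$ with $\beta=\rho/(2p)$, arithmetic means $\{\cdot\}$, logarithmic means $(\cdot)^{\ln}$ and $$F^\rho=\rho^{\ln}\{u_d\},\quad F^m=F^\rho\{u\}-\{B_d\}\{B\}+\Big(\tfrac{\{\rho\}}{2\{\beta\}}+\tfrac12\{|B|^2\}\Big)e_d,\quad F^B=\tfrac1{\{\beta\}}\big(\{\beta u_d\}\{B\}-\{B_d\}\{\beta u\}\big),$$ $$F^E=\tfrac12\Big(\tfrac1{(\gamma-1)\beta^{\ln}}-\{|u|^2\}\Big)F^\rho+\{u\}\cdot F^m+\{B\}\cdot F^B-\tfrac12\{u_d\}\{|B|^2\}+(\{u\}\cdot\{B\})\{B_d\},$$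 is symmetric and consistent on admissible states, hence a possible choice of $f_{d,S}$, and the following hold. 1. (Evolution of cell averages.) At any time at which the nodal values are admissible, the semi-discrete scheme satisfies in 1D $$h\frac{d\bar w_i}{dt}+\sum_{\alpha,\beta}\omega_\alpha D_{\alpha\beta}B_1(w_{i\beta})S(w_{i\alpha})=\mathcal B_1,$$ and in 2D $$h_xh_y\frac{d\bar w_{ij}}{dt}+\frac{h_xh_y}4\sum_{\alpha,\beta}\omega_\alpha\omega_\beta\,\mathrm{div}_{\alpha\beta}\,S(w_{ij\alpha\beta})=h_y\sum_\beta\frac{\omega_\beta}2\mathcal B_1^{(\beta)}+h_x\sum_\alpha\frac{\omega_\alpha}2\mathcal B_2^{(\alpha)},$$ $$\mathrm{div}_{\alpha\beta}=\frac2{h_x}\sum_pD_{\alpha p}B_1(w_{ijp\beta})+\frac2{h_y}\sum_qD_{\beta q}B_2(w_{ij\alpha q}).$$ 2. In 2D, $\mathrm{div}_{\alpha\beta}$ is the divergence of the polynomial $(B_1,B_2)$ at the $(\alpha,\beta)$-node of $I_{ij}$. In 1D and 2D the volume term (the second term on the left) vanishes if the field is LDF. 3. The LDF projection exists, is unique,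 produces an LDF field and keeps all cell averages. The OEDG damping and the PP limiter preserve the LDF property and all cell averages, and the PP limiter makes all nodal values admissible if all cell averages are admissible. 4. (Forward Euler.) In 1D and 2D: if all nodal values of $w$ are admissible, $w$ is LDF, and $\Delta t\ge0$ satisfies the CFL condition at $w$, then all cell averages of the forward Euler update of $w$ with step $\Delta t$ are admissible. 5. (SSP Runge–Kutta, 2D.) Consider any method whose stages are $w^{n,0}=w^n$, $w^{n,i+1}=P_{\Delta t_n}\big(\sum_{j\le i}a_{ij}(w^{n,j}+r_{ij}\Delta t_nL_h(w^{n,j}))\big)$ for $0\le i<s$, $w^{n+1}=w^{n,s}$, with $\Delta t_n>0$, $a_{ij}\ge0$, $\sum_{j\le i}a_{ij}=1$, $r_{ij}\ge0$. If $w^0$ is LDF with admissible nodal values, and $r_{ij}\Delta t_n$ satisfies the CFL condition at $w^{n,j}$ whenever $a_{ij}\ne0$, then for all $n$ the cell averages of all stages, before and after limiting, are admissible, and all limited stages are LDF with admissible nodal values. The same holds for one step, from an LDF $w^n$ with admissible nodal values, of the third order SSP method $$w^{n,1}=P_{\Delta t}(w^n+\Delta tL_h(w^n)),\quad w^{n,2}=P_{\Delta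 t}\big(\tfrac34w^n+\tfrac14(w^{n,1}+\Delta tL_h(w^{n,1}))\big),\quad w^{n+1}=P_{\Delta t}\big(\tfrac13w^n+\tfrac23(w^{n,2}+\Delta tL_h(w^{n,2}))\big)$$ if $\Delta t>0$ satisfies the CFL condition at $w^n,w^{n,1},w^{n,2}$: the cell averages of the three stages before limiting are admissible, and $w^{n+1}$ is LDF with admissible nodal values and cell averages. -/

import Mathlib

noncomputable section

namespace MHD

open Matrix

/-! ### Ideal MHD with the Godunov-Powell source term -/

/-- Conservative variables `(ρ, ρu, B, E)`. -/
abbrev State : Type := ℝ × (Fin 3 → ℝ) × (Fin 3 → ℝ) × ℝ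

def rho (w : State) : ℝ := w.1

def mom (w : State) : Fin 3 → ℝ := w.2.1

def mag (w : State) : Fin 3 → ℝ := w.2.2.1

def ener (w : State) : ℝ := w.2.2.2

def vel (w : State) : Fin 3 → ℝ := (rho w)⁻¹ • mom w

/-- Internal energy density `ρe = E - |ρu|²/(2ρ) - |B|²/2`. -/
def internal (w : State) : ℝ :=
  ener w - (mom w ⬝ᵥ mom w) / (2 * rho w) - (mag w ⬝ᵥ mag w) / 2

/-- The `γ`-law equation of state `p = (γ - 1) ρ e`. -/
def pressure (γ : ℝ) (w : State) : ℝ := (γ - 1) * internal w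

/-- Positive density and positive pressure. -/
def Admissible (γ : ℝ) (w : State) : Prop := 0 < rho w ∧ 0 < pressure γ w

/-- Total pressure `p + |B|²/2`. -/
def totalPressure (γ : ℝ) (w : State) : ℝ := pressure γ w + (mag w ⬝ᵥ mag w) / 2

/-- The physical flux `f_d` in the direction of the `d`-th coordinate. -/
def flux (γ : ℝ) (d : Fin 3) (w : State) : State :=
  (rho w * vel w d,
   (rho w * vel w d) • vel w - mag w d • mag w + totalPressure γ w • Pi.single d 1,
   vel w d • mag w - mag w d • vel w,
   (ener w + totalPressure γ w) * vel w d - (vel w ⬝ᵥ mag w) * mag w d)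

/-- The coefficient vector `S(w) = (0, B, u, u·B)` of the Godunov-Powell source term. -/
def gpS (w : State) : State := (0, mag w, vel w, vel w ⬝ᵥ mag w)

/-! ### Two-point volume fluxes -/

/-- A family of two-point fluxes that is symmetric and consistent with the physical fluxes. -/
def IsTwoPointFlux (γ : ℝ) (fS : Fin 3 → State → State → State) : Prop :=
  (∀ d w z, Admissible γ w → Admissible γ z → fS d w z = fS d z w) ∧
  ∀ d w, Admissible γ w → fS d w w = flux γ d w

/-- Logarithmic mean. -/
def logMean (a b : ℝ) : ℝ := if a = b then a else (a - b) / (Real.log a - Real.log b)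

/-- `β = ρ / (2p)`. -/
def invTemp (γ : ℝ) (w : State) : ℝ := rho w / (2 * pressure γ w)

/-- The entropy conservative flux of Chandrashekar (and Klingenberg). -/
def chandrashekar (γ : ℝ) (d : Fin 3) (w z : State) : State :=
  let u : Fin 3 → ℝ := (1 / 2 : ℝ) • (vel w + vel z)
  let b : Fin 3 → ℝ := (1 / 2 : ℝ) • (mag w + mag z)
  let r : ℝ := (rho w + rho z) / 2
  let β : ℝ := (invTemp γ w + invTemp γ z) / 2
  let βu : Fin 3 → ℝ := (1 / 2 : ℝ) • (invTemp γ w • vel w + invTemp γ z • vel z)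
  let u2 : ℝ := (vel w ⬝ᵥ vel w + vel z ⬝ᵥ vel z) / 2
  let b2 : ℝ := (mag w ⬝ᵥ mag w + mag z ⬝ᵥ mag z) / 2
  let Fρ : ℝ := logMean (rho w) (rho z) * u d
  let Fm : Fin 3 → ℝ := Fρ • u - b d • b + (r / (2 * β) + b2 / 2) • Pi.single d 1
  let FB : Fin 3 → ℝ := β⁻¹ • (βu d • b - b d • βu)
  (Fρ, Fm, FB,
   (1 / ((γ - 1) * logMean (invTemp γ w) (invTemp γ z)) - u2) / 2 * Fρ
     + u ⬝ᵥ Fm + b ⬝ᵥ FB - u d * b2 / 2 + (u ⬝ᵥ b) * b d)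

/-! ### Positivity-preserving signal speed bounds -/

/-- Fast magnetosonic-type speed `C_d(w)`, in which the speed of sound is replaced by
`C_s = p / (ρ √(2e))`, so that `C_s² = p² / (2 ρ · ρe)`. -/
def fastSpeed (γ : ℝ) (d : Fin 3) (w : State) : ℝ :=
  let cs2 : ℝ := pressure γ w ^ 2 / (2 * rho w * internal w)
  let a : ℝ := cs2 + (mag w ⬝ᵥ mag w) / rho w
  Real.sqrt ((a + Real.sqrt (a ^ 2 - 4 * cs2 * mag w d ^ 2 / rho w)) / 2)

/-- The average of the normal velocities with the weights `√ρ`. -/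
def roeVel (d : Fin 3) (w z : State) : ℝ :=
  (Real.sqrt (rho w) * vel w d + Real.sqrt (rho z) * vel z d) /
    (Real.sqrt (rho w) + Real.sqrt (rho z))

/-- `|B(w) - B(z)| / (√ρ(w) + √ρ(z))`, with the Euclidean norm. -/
def magJumpSpeed (w z : State) : ℝ :=
  Real.sqrt ((mag w - mag z) ⬝ᵥ (mag w - mag z)) / (Real.sqrt (rho w) + Real.sqrt (rho z))

/-- Upper speed bound attached to the state `w`, with partner state `z`. -/
def alphaR (γ : ℝ) (d : Fin 3) (w z : State) : ℝ :=
  max (vel w d) (roeVel d w z) + fastSpeed γ d w + magJumpSpeed w z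

/-- Lower speed bound attached to the state `w`, with partner state `z`. -/
def alphaL (γ : ℝ) (d : Fin 3) (w z : State) : ℝ :=
  min (vel w d) (roeVel d w z) - fastSpeed γ d w - magJumpSpeed w z

/-- Requirements on the signal speed estimates `S_L(w_L, w_R)`, `S_R(w_L, w_R)` of the HLL
flux in each coordinate direction. -/
def PPSpeeds (γ : ℝ) (SL SR : Fin 3 → State → State → ℝ) : Prop :=
  ∀ d wL wR, Admissible γ wL → Admissible γ wR →
    SL d wL wR ≤ 0 ∧ 0 ≤ SR d wL wR ∧ SL d wL wR < SR d wL wR ∧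
    SL d wL wR ≤ alphaL γ d wL wR ∧ alphaR γ d wR wL ≤ SR d wL wR

/-! ### Legendre-Gauss-Lobatto nodes -/

/-- The `k`-th Legendre polynomial (Rodrigues' formula). -/
def legendre (k : ℕ) : Polynomial ℝ :=
  Polynomial.C (1 / (2 ^ k * (k.factorial : ℝ))) *
    (Polynomial.derivative^[k]) ((Polynomial.X ^ 2 - 1) ^ k)

/-- The `k + 1` LGL nodes in increasing order: the zeros of `(1 - x²) P_k'(x)`. Since this
polynomial has degree `k + 1`, for `k ≥ 1` the nodes are determined by these conditions. -/
structure LGLNodes (k : ℕ) where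
  node : Fin (k + 1) → ℝ
  strictMono : StrictMono node
  root : ∀ i, (1 - node i ^ 2) * (Polynomial.derivative (legendre k)).eval (node i) = 0

namespace LGLNodes

variable {k : ℕ} (X : LGLNodes k)

/-- The nodal basis `l_i`. -/
def basis (i : Fin (k + 1)) : Polynomial ℝ := Lagrange.basis Finset.univ X.node i

/-- The quadrature weights `ω_i = ∫ l_i`. -/
def weight (i : Fin (k + 1)) : ℝ := ∫ x in (-1 : ℝ)..1, (X.basis i).eval x

/-- The differentiation matrix `D_{ij} = l_j'(x_i)`. -/
def diff (i j : Fin (k + 1)) : ℝ := (Polynomial.derivative (X.basis j)).eval (X.node i)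

end LGLNodes

/-- The diagonal `(-1, 0, …, 0, 1)`. -/
def tau {k : ℕ} (α : Fin (k + 1)) : ℝ :=
  if α = 0 then -1 else if α = Fin.last k then 1 else 0

/-! ### The nodal scheme along one line of nodes -/

/-- The data of the spatial discretization on the reference element: heat capacity ratio,
LGL nodes, two-point volume flux, and HLL signal speeds. -/
structure Disc (k : ℕ) where
  γ : ℝ
  X : LGLNodes k
  fS : Fin 3 → State → State → State
  SL : Fin 3 → State → State → ℝ
  SR : Fin 3 → State → State → ℝ

namespace Disc

variable {k : ℕ} (S : Disc k)

/-- HLL numerical flux in direction `d`. -/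
def hll (d : Fin 3) (wL wR : State) : State :=
  (S.SR d wL wR - S.SL d wL wR)⁻¹ •
    (S.SR d wL wR • flux S.γ d wL - S.SL d wL wR • flux S.γ d wR
      + (S.SL d wL wR * S.SR d wL wR) • (wR - wL))

/-- The compatible numerical value of the normal magnetic field at the interface. -/
def hllB (d : Fin 3) (wL wR : State) : ℝ :=
  (S.SR d wL wR * mag wL d - S.SL d wL wR * mag wR d) / (S.SR d wL wR - S.SL d wL wR)

/-- The star vector of a line of nodal values `u` with exterior traces `eL`, `eR`. -/
def star (d : Fin 3) (u : Fin (k + 1) → State) (eL eR : State) (α : Fin (k + 1)) : State :=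
  if α = 0 then
    flux S.γ d (u 0) - S.hll d eL (u 0) + (mag (u 0) d - S.hllB d eL (u 0)) • gpS (u 0)
  else if α = Fin.last k then
    flux S.γ d (u (Fin.last k)) - S.hll d (u (Fin.last k)) eR
      + (mag (u (Fin.last k)) d - S.hllB d (u (Fin.last k)) eR) • gpS (u (Fin.last k))
  else 0

/-- The right-hand side of the scheme along a line, before scaling by `2 / h`. -/
def lineRes (d : Fin 3) (u : Fin (k + 1) → State) (eL eR : State) (α : Fin (k + 1)) : State :=
  (tau α / S.X.weight α) • S.star d u eL eR α
    - (2 : ℝ) • ∑ β, S.X.diff α β • S.fS d (u α) (u β)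
    - ∑ β, (S.X.diff α β * mag (u β) d) • gpS (u α)

/-- The boundary terms in the evolution of the average over a line. -/
def lineBoundary (d : Fin 3) (u : Fin (k + 1) → State) (eL eR : State) : State :=
  S.hll d eL (u 0) - S.hll d (u (Fin.last k)) eR
    + (mag (u (Fin.last k)) d - S.hllB d (u (Fin.last k)) eR) • gpS (u (Fin.last k))
    - (mag (u 0) d - S.hllB d eL (u 0)) • gpS (u 0)

/-- The wave speed estimate at the node `α` of a line that enters the CFL condition. It
vanishes at nodes which do not lie on the two end points of the line. -/
def nodeSpeed (d : Fin 3) (u : Fin (k + 1) → State) (eL eR : State) (α : Fin (k + 1)) : ℝ :=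
  let P := u 0
  let Q := u (Fin.last k)
  if α = 0 then
    S.SR d eL P - alphaL S.γ d P Q
      + S.SR d eL P / (S.SR d eL P - S.SL d eL P) * (|mag P d - mag eL d| / Real.sqrt (rho P))
  else if α = Fin.last k then
    alphaR S.γ d Q P - S.SL d Q eR
      + -S.SL d Q eR / (S.SR d Q eR - S.SL d Q eR)
          * (|mag eR d - mag Q d| / Real.sqrt (rho Q))
  else 0

end Disc

/-! ### One space dimension -/

/-- `N` uniform cells on `[a, b]`. -/
structure Grid1 where
  N : ℕ
  a : ℝ
  b : ℝ
  N_pos : 0 < N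
  a_lt_b : a < b

namespace Grid1

def h (G : Grid1) : ℝ := (G.b - G.a) / G.N

/-- Center of the cell `i`. -/
def ctr (G : Grid1) (i : Fin G.N) : ℝ := G.a + ((i : ℝ) + 1 / 2) * G.h

end Grid1

/-- Nodal values of a one-dimensional numerical solution. -/
abbrev Sol1 (k : ℕ) (G : Grid1) : Type := Fin G.N → Fin (k + 1) → State

namespace Disc

variable {k : ℕ} (S : Disc k)

/-- Exterior trace at the left end of the cell `i`; the states `g.1`, `g.2` are the exterior
states prescribed at the two ends of the domain. -/
def extL1 {G : Grid1} (g : State × State) (w : Sol1 k G) (i : Fin G.N) : State :=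
  if h : 0 < i.1 then w ⟨i.1 - 1, by omega⟩ (Fin.last k) else g.1

def extR1 {G : Grid1} (g : State × State) (w : Sol1 k G) (i : Fin G.N) : State :=
  if h : i.1 + 1 < G.N then w ⟨i.1 + 1, h⟩ 0 else g.2

/-- The semi-discrete operator: the scheme is `dw/dt = L1 w`. -/
def L1 {G : Grid1} (bc : Sol1 k G → State × State) (w : Sol1 k G) : Sol1 k G := fun i α =>
  (2 / G.h) • S.lineRes 0 (w i) (extL1 (bc w) w i) (extR1 (bc w) w i) α

/-- Cell average (exact for the interpolating polynomial, because `ω_α = ∫ l_α`). -/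
def avg1 (u : Fin (k + 1) → State) : State := (1 / 2 : ℝ) • ∑ α, S.X.weight α • u α

/-- Volume term of the cell average evolution. -/
def vol1 (u : Fin (k + 1) → State) : State :=
  ∑ α, ∑ β, (S.X.weight α * S.X.diff α β * mag (u β) 0) • gpS (u α)

/-- The polynomial `B_1` on the cell `i`, as a function of the physical coordinate. -/
def magFun1 {G : Grid1} (w : Sol1 k G) (i : Fin G.N) (x : ℝ) : ℝ :=
  ∑ α, mag (w i α) 0 * (S.X.basis α).eval ((x - G.ctr i) / (G.h / 2))

/-- `∂B_1/∂x = 0` in the interior of each cell. -/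
def LDF1 {G : Grid1} (w : Sol1 k G) : Prop :=
  ∀ i, ∀ x ∈ Set.Icc (G.ctr i - G.h / 2) (G.ctr i + G.h / 2), deriv (S.magFun1 w i) x = 0

/-- CFL condition for a forward Euler step of size `t`. -/
def CFL1 {G : Grid1} (bc : Sol1 k G → State × State) (w : Sol1 k G) (t : ℝ) : Prop :=
  ∀ i α, t * (S.nodeSpeed 0 (w i) (extL1 (bc w) w i) (extR1 (bc w) w i) α / G.h)
    < S.X.weight 0 / 2

end Disc

/-! ### Two space dimensions -/

/-- `Nx × Ny` uniform cells on `[a, b] × [c, d]`. -/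
structure Grid where
  Nx : ℕ
  Ny : ℕ
  a : ℝ
  b : ℝ
  c : ℝ
  d : ℝ
  Nx_pos : 0 < Nx
  Ny_pos : 0 < Ny
  a_lt_b : a < b
  c_lt_d : c < d

namespace Grid

def hx (G : Grid) : ℝ := (G.b - G.a) / G.Nx

def hy (G : Grid) : ℝ := (G.d - G.c) / G.Ny

def xc (G : Grid) (i : Fin G.Nx) : ℝ := G.a + ((i : ℝ) + 1 / 2) * G.hx

def yc (G : Grid) (j : Fin G.Ny) : ℝ := G.c + ((j : ℝ) + 1 / 2) * G.hy

/-- The closed cell `I_{ij}`. -/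
def cell (G : Grid) (i : Fin G.Nx) (j : Fin G.Ny) : Set (ℝ × ℝ) :=
  Set.Icc (G.xc i - G.hx / 2) (G.xc i + G.hx / 2) ×ˢ
    Set.Icc (G.yc j - G.hy / 2) (G.yc j + G.hy / 2)

end Grid

/-- Nodal values on one cell; the first index belongs to `x`, the second to `y`. -/
abbrev CellSol (k : ℕ) : Type := Fin (k + 1) → Fin (k + 1) → State

/-- Nodal values of a two-dimensional numerical solution. -/
abbrev Sol (k : ℕ) (G : Grid) : Type := Fin G.Nx → Fin G.Ny → CellSol k

/-- Exterior states at the boundary nodes of the domain. -/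
structure Ghost (k : ℕ) (G : Grid) where
  left : Fin G.Ny → Fin (k + 1) → State
  right : Fin G.Ny → Fin (k + 1) → State
  bottom : Fin G.Nx → Fin (k + 1) → State
  top : Fin G.Nx → Fin (k + 1) → State

def Ghost.AllAdmissible {k : ℕ} {G : Grid} (γ : ℝ) (g : Ghost k G) : Prop :=
  (∀ j β, Admissible γ (g.left j β) ∧ Admissible γ (g.right j β)) ∧
  ∀ i α, Admissible γ (g.bottom i α) ∧ Admissible γ (g.top i α)

/-- All nodal values are admissible. -/
def NodallyAdmissible {k : ℕ} {G : Grid} (γ : ℝ) (w : Sol k G) : Prop :=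
  ∀ i j α β, Admissible γ (w i j α β)

section Traces

variable {k : ℕ} {G : Grid} (g : Ghost k G) (w : Sol k G) (i : Fin G.Nx) (j : Fin G.Ny)

/-- Exterior traces of the cell `(i, j)` at the nodes of its four edges. -/
def extLeft (β : Fin (k + 1)) : State :=
  if h : 0 < i.1 then w ⟨i.1 - 1, by omega⟩ j (Fin.last k) β else g.left j β

def extRight (β : Fin (k + 1)) : State :=
  if h : i.1 + 1 < G.Nx then w ⟨i.1 + 1, h⟩ j 0 β else g.right j β

def extBottom (α : Fin (k + 1)) : State :=
  if h : 0 < j.1 then w i ⟨j.1 - 1, by omega⟩ α (Fin.last k) else g.bottom i α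

def extTop (α : Fin (k + 1)) : State :=
  if h : j.1 + 1 < G.Ny then w i ⟨j.1 + 1, h⟩ α 0 else g.top i α

end Traces

namespace Disc

variable {k : ℕ} (S : Disc k) {G : Grid}

/-- The semi-discrete operator `L_h`: the one-dimensional scheme applied dimension by
dimension. -/
def L (bc : Sol k G → Ghost k G) (w : Sol k G) : Sol k G := fun i j α β =>
  (2 / G.hx) • S.lineRes 0 (fun p => w i j p β)
      (extLeft (bc w) w i j β) (extRight (bc w) w i j β) α
  + (2 / G.hy) • S.lineRes 1 (fun q => w i j α q)
      (extBottom (bc w) w i j α) (extTop (bc w) w i j α) β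

/-- Cell average (exact for the interpolating polynomial, because `ω_α = ∫ l_α`). -/
def avg (c : CellSol k) : State :=
  (1 / 4 : ℝ) • ∑ α, ∑ β, (S.X.weight α * S.X.weight β) • c α β

/-- The boundary terms in the evolution of the cell average. -/
def boundaryTerm (bc : Sol k G → Ghost k G) (w : Sol k G) (i : Fin G.Nx) (j : Fin G.Ny) :
    State :=
  G.hy • ∑ β, (S.X.weight β / 2) • S.lineBoundary 0 (fun p => w i j p β)
      (extLeft (bc w) w i j β) (extRight (bc w) w i j β)
  + G.hx • ∑ α, (S.X.weight α / 2) • S.lineBoundary 1 (fun q => w i j α q)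
      (extBottom (bc w) w i j α) (extTop (bc w) w i j α)

/-- The discrete divergence of `B` at a node, through the differentiation matrix. -/
def discDiv (w : Sol k G) (i : Fin G.Nx) (j : Fin G.Ny) (α β : Fin (k + 1)) : ℝ :=
  2 / G.hx * ∑ p, S.X.diff α p * mag (w i j p β) 0
    + 2 / G.hy * ∑ q, S.X.diff β q * mag (w i j α q) 1

/-- The volume source term in the evolution of the cell average. -/
def volumeTerm (w : Sol k G) (i : Fin G.Nx) (j : Fin G.Ny) : State :=
  (G.hx * G.hy / 4) •
    ∑ α, ∑ β, (S.X.weight α * S.X.weight β * S.discDiv w i j α β) • gpS (w i j α β)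

/-- The polynomial on the reference element with given nodal values. -/
def refInterp (b : Fin (k + 1) → Fin (k + 1) → ℝ) : MvPolynomial (Fin 2) ℝ :=
  ∑ α, ∑ β, MvPolynomial.C (b α β) *
    (Polynomial.aeval (MvPolynomial.X 0) (S.X.basis α) *
      Polynomial.aeval (MvPolynomial.X 1) (S.X.basis β))

/-- The polynomial `B_{d+1}` on the cell `(i, j)`, as a function of the physical
coordinates. -/
def magFun (w : Sol k G) (i : Fin G.Nx) (j : Fin G.Ny) (d : Fin 3) (x y : ℝ) : ℝ :=
  MvPolynomial.eval ![(x - G.xc i) / (G.hx / 2), (y - G.yc j) / (G.hy / 2)]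
    (S.refInterp fun α β => mag (w i j α β) d)

/-- The divergence of the piecewise polynomial magnetic field in the cell `(i, j)`. -/
def divB (w : Sol k G) (i : Fin G.Nx) (j : Fin G.Ny) (x y : ℝ) : ℝ :=
  deriv (fun x' => S.magFun w i j 0 x' y) x + deriv (fun y' => S.magFun w i j 1 x y') y

/-- The magnetic field is locally divergence-free. -/
def LDF (w : Sol k G) : Prop :=
  ∀ i j x y, (x, y) ∈ G.cell i j → S.divB w i j x y = 0

/-- CFL condition for a forward Euler step of size `t`. -/
def CFL (bc : Sol k G → Ghost k G) (w : Sol k G) (t : ℝ) : Prop :=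
  ∀ i j α β,
    t * (S.nodeSpeed 0 (fun p => w i j p β)
            (extLeft (bc w) w i j β) (extRight (bc w) w i j β) α / G.hx
        + S.nodeSpeed 1 (fun q => w i j α q)
            (extBottom (bc w) w i j α) (extTop (bc w) w i j α) β / G.hy)
      < S.X.weight 0 / 2

end Disc

/-! ### The limiting procedure -/

/-- The polynomials of degree at most `a` in the first and `b` in the second variable. -/
def QSpace (a b : ℕ) : Submodule ℝ (MvPolynomial (Fin 2) ℝ) :=
  MvPolynomial.restrictSupport ℝ {n | n 0 ≤ a ∧ n 1 ≤ b}

/-- The multiplier space `Q^{k-1,k} + Q^{k,k-1}`, used for `k ≥ 1`. -/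
def MSpace (k : ℕ) : Submodule ℝ (MvPolynomial (Fin 2) ℝ) :=
  QSpace (k - 1) k ⊔ QSpace k (k - 1)

/-- Integral over the reference element `[-1, 1]²`. -/
def refInt (P : MvPolynomial (Fin 2) ℝ) : ℝ :=
  ∫ x in (-1 : ℝ)..1, ∫ y in (-1 : ℝ)..1, MvPolynomial.eval ![x, y] P

def refDiv (v : Fin 2 → MvPolynomial (Fin 2) ℝ) : MvPolynomial (Fin 2) ℝ :=
  MvPolynomial.pderiv 0 (v 0) + MvPolynomial.pderiv 1 (v 1)

/-- `B` is the first component of a solution `(B, p)` of the saddle point problem on the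
reference element with input `B₀`. -/
def IsRefLDFProjection (k : ℕ) (B₀ B : Fin 2 → MvPolynomial (Fin 2) ℝ) : Prop :=
  (∀ m, B m ∈ QSpace k k) ∧ ∃ p ∈ MSpace k,
    (∀ v : Fin 2 → MvPolynomial (Fin 2) ℝ, (∀ m, v m ∈ QSpace k k) →
      refInt (∑ m, B m * v m) + refInt (p * refDiv v) = refInt (∑ m, B₀ m * v m)) ∧
    ∀ q ∈ MSpace k, refInt (refDiv B * q) = 0

namespace Disc

variable {k : ℕ} (S : Disc k) {G : Grid}

/-- The contravariant Piola transform of `(B_1, B_2)` on the cell `(i, j)`. -/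
def piola (w : Sol k G) (i : Fin G.Nx) (j : Fin G.Ny) : Fin 2 → MvPolynomial (Fin 2) ℝ :=
  ![S.refInterp fun α β => G.hy / 2 * mag (w i j α β) 0,
    S.refInterp fun α β => G.hx / 2 * mag (w i j α β) 1]

/-- `w'` arises from `w` by the LDF projection of `(B_1, B_2)` in every cell; all other
components are unchanged. -/
def IsLDFProjection (w w' : Sol k G) : Prop :=
  ∀ i j,
    (∀ α β, rho (w' i j α β) = rho (w i j α β) ∧ mom (w' i j α β) = mom (w i j α β) ∧
      mag (w' i j α β) 2 = mag (w i j α β) 2 ∧ ener (w' i j α β) = ener (w i j α β)) ∧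
    IsRefLDFProjection k (S.piola w i j) (S.piola w' i j)

/-- The OEDG damping with pseudo time `t` and damping coefficients `δ`. -/
def oedg (δ : Fin (k + 1) → Sol k G → Fin G.Nx → Fin G.Ny → ℝ) (t : ℝ) (w : Sol k G) :
    Sol k G := fun i j α β =>
  S.avg (w i j) + Real.exp (-t * ∑ m, δ m w i j) • (w i j α β - S.avg (w i j))

/-- Smallest nodal value of a scalar quantity in a cell. -/
def nodeMin (q : State → ℝ) (c : CellSol k) : ℝ :=
  Finset.univ.inf' Finset.univ_nonempty
    fun n : Fin (k + 1) × Fin (k + 1) => q (c n.1 n.2)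

/-- Largest scaling factor (at most `1`) of the Zhang-Shu limiter that lifts the minimum `m`
to the threshold `e`, for the mean value `a`. -/
def scale (a e m : ℝ) : ℝ := if e ≤ m then 1 else (a - e) / (a - m)

/-- First step of the PP limiter: only the density is changed. -/
def ppDensity (ε : ℝ) (c : CellSol k) : CellSol k := fun α β =>
  let r := rho (S.avg c)
  (r + scale r (min ε r) (nodeMin rho c) * (rho (c α β) - r),
    mom (c α β), mag (c α β), ener (c α β))

/-- Second step of the PP limiter: all components are scaled towards the cell average. -/
def ppEnergy (ε : ℝ) (c : CellSol k) : CellSol k := fun α β =>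
  let e := internal (S.avg c)
  S.avg c + scale e (min ε e) (nodeMin internal c) • (c α β - S.avg c)

/-- The Zhang-Shu positivity-preserving limiter on the LGL nodes, with threshold `ε`. -/
def ppLimiter (ε : ℝ) (w : Sol k G) : Sol k G := fun i j =>
  S.ppEnergy ε (S.ppDensity ε (w i j))

/-- `out = P_t(raw)`: LDF projection, then OEDG damping, then PP limiter. -/
def IsLimited (δ : Fin (k + 1) → Sol k G → Fin G.Nx → Fin G.Ny → ℝ) (ε t : ℝ)
    (raw out : Sol k G) : Prop :=
  ∃ w, S.IsLDFProjection raw w ∧ out = S.ppLimiter ε (S.oedg δ t w)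

/-- The forward Euler step of size `t`. -/
def euler (bc : Sol k G → Ghost k G) (t : ℝ) (w : Sol k G) : Sol k G := w + t • S.L bc w

/-- All cell averages are admissible. -/
def AvgAdmissible (w : Sol k G) : Prop := ∀ i j, Admissible S.γ (S.avg (w i j))

end Disc

/-! ### Time discretization -/

/-- A Runge-Kutta method of `s` stages each of which is a convex combination of forward Euler
steps from the previous stages: stage `i + 1` is the limited version of
`∑_{j ≤ i} a_{ij} (w^{(j)} + r_{ij} Δt L_h(w^{(j)}))`. -/
structure ConvexEuler where
  s : ℕ
  a : ℕ → ℕ → ℝ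
  r : ℕ → ℕ → ℝ
  a_nonneg : ∀ i < s, ∀ j ≤ i, 0 ≤ a i j
  a_sum : ∀ i < s, ∑ j ∈ Finset.range (i + 1), a i j = 1
  r_nonneg : ∀ i < s, ∀ j ≤ i, 0 ≤ r i j

/-- The value of stage `i + 1` before limiting. -/
def ConvexEuler.raw (R : ConvexEuler) {k : ℕ} (S : Disc k) {G : Grid}
    (bc : Sol k G → Ghost k G) (Δt : ℝ) (W : ℕ → Sol k G) (i : ℕ) : Sol k G :=
  ∑ j ∈ Finset.range (i + 1), R.a i j • S.euler bc (R.r i j * Δt) (W j)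

end MHD

end

open MHD

/-! A state is admissible if and only if it is positive under the density and under all functionals
`w ↦ (|v|²/2, -v, -b, 1) · w + |b|²/2` (geometric quasilinearization), so a cell average can be
tested with one such functional `φ` at a time. Summation by parts makes symmetric consistent
two-point fluxes telescope: a cell average changes only through the boundary terms of each line and
the Godunov-Powell volume term, and the latter vanishes for a divergence-free field. At a cell face,
the bounds on the HLL speeds estimate `φ` of the boundary terms from below by a negative multiple of
`φ` of the nodal values, up to a multiple of the jump of the normal magnetic field across the cell.
Summed over all lines these jumps form the net magnetic flux through the cell, which is zero, and
the CFL condition absorbs the rest. The limiters act by affine scalings towards cell averages, and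
Runge-Kutta stages are convex combinations of Euler steps, so convexity of the admissible set
carries the result to the whole scheme. -/

noncomputable section

namespace MHD

/-! ### Legendre polynomials -/

section Legendre

open Polynomial

theorem intervalIntegrable_eval (p : ℝ[X]) (a b : ℝ) :
    IntervalIntegrable (fun x => p.eval x) MeasureTheory.volume a b :=
  p.continuous.intervalIntegrable a b

theorem integral_eval_derivative (p : ℝ[X]) (a b : ℝ) :
    ∫ x in a..b, (derivative p).eval x = p.eval b - p.eval a :=
  intervalIntegral.integral_eq_sub_of_hasDerivAt (fun x _ => p.hasDerivAt x)
    (intervalIntegrable_eval _ _ _)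

theorem integral_eval_derivative_mul (p q : ℝ[X]) (a b : ℝ) :
    ∫ x in a..b, (derivative p * q).eval x
      = (p * q).eval b - (p * q).eval a - ∫ x in a..b, (p * derivative q).eval x := by
  rw [← integral_eval_derivative, ← intervalIntegral.integral_sub (intervalIntegrable_eval _ _ _)
    (intervalIntegrable_eval _ _ _)]
  simp only [derivative_mul, eval_add, add_sub_cancel_right]

theorem integral_eval_pos {p : ℝ[X]} {a b : ℝ} (hab : a < b) (hp : p ≠ 0)
    (hnonneg : ∀ x ∈ Set.Icc a b, 0 ≤ p.eval x) : 0 < ∫ x in a..b, p.eval x := by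
  refine intervalIntegral.integral_pos hab p.continuous.continuousOn
    (fun x hx => hnonneg x (Set.Ioc_subset_Icc_self hx)) ?_
  by_contra! hnonpos
  exact hp (eq_zero_of_infinite_isRoot p <| (Set.Icc_infinite hab).mono
    fun x hx => (hnonpos x hx).antisymm (hnonneg x hx))

theorem natDegree_iterate_derivative_eq (p : ℝ[X]) (m : ℕ) :
    (derivative^[m] p).natDegree = p.natDegree - m := by
  induction m with
  | zero => rfl
  | succ m ih => rw [Function.iterate_succ_apply', natDegree_derivative, ih, Nat.sub_sub]

theorem iterate_derivative_comp_neg_X {R : Type*} [CommRing R] (p : R[X]) (m : ℕ) :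
    (derivative^[m] p).comp (-X) = (-1) ^ m * derivative^[m] (p.comp (-X)) := by
  induction m generalizing p with
  | zero => simp
  | succ m ih =>
    rw [Function.iterate_succ_apply, ih, Function.iterate_succ_apply, derivative_comp,
      derivative_neg, derivative_X, neg_one_mul, iterate_derivative_neg, pow_succ]
    ring

theorem rootSet_iterate_derivative_subset {p : ℂ[X]} {s : Set ℂ} (hs : Convex ℝ s)
    (hp : p.rootSet ℂ ⊆ s) (m : ℕ) : (derivative^[m] p).rootSet ℂ ⊆ s := by
  induction m with
  | zero => exact hp
  | succ m ih =>
    rw [Function.iterate_succ_apply']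
    rcases lt_or_ge 0 (derivative^[m] p).degree with h | h
    · exact (rootSet_derivative_subset_convexHull_rootSet h).trans (convexHull_min ih hs)
    · rw [eq_C_of_degree_le_zero h, derivative_C, rootSet_zero]
      exact Set.empty_subset s

theorem mem_Icc_of_isRoot_iterate_derivative {p : ℝ[X]} {a b x : ℝ} {m : ℕ}
    (hp : (p.map (algebraMap ℝ ℂ)).rootSet ℂ ⊆ {z | z.re ∈ Set.Icc a b})
    (hne : derivative^[m] p ≠ 0) (hx : (derivative^[m] p).IsRoot x) : x ∈ Set.Icc a b := by
  have hconvex : Convex ℝ {z : ℂ | z.re ∈ Set.Icc a b} :=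
    (convex_Icc a b).is_linear_preimage Complex.reLm.isLinear
  suffices (x : ℂ) ∈ (derivative^[m] (p.map (algebraMap ℝ ℂ))).rootSet ℂ from
    rootSet_iterate_derivative_subset hconvex hp m this
  rw [iterate_derivative_map, mem_rootSet, aeval_map_algebraMap, ← Complex.coe_algebraMap,
    aeval_algebraMap_apply, coe_aeval_eq_eval, hx.eq_zero, map_zero]
  exact ⟨Polynomial.map_ne_zero hne, rfl⟩

theorem legendre_factor_ne_zero (k : ℕ) : (1 / (2 ^ k * (k.factorial : ℝ))) ≠ 0 := by
  positivity

theorem natDegree_legendre (k : ℕ) : (legendre k).natDegree = k := by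
  have hdeg : ((X ^ 2 - 1 : ℝ[X]) ^ k).natDegree = k * 2 := by
    rw [natDegree_pow, ← C_1, natDegree_X_pow_sub_C]
  rw [legendre, natDegree_C_mul (legendre_factor_ne_zero k), natDegree_iterate_derivative_eq, hdeg]
  lia

theorem derivative_legendre_ne_zero {k : ℕ} (hk : 1 ≤ k) : derivative (legendre k) ≠ 0 := by
  rw [derivative_ne_zero, natDegree_legendre]
  lia

theorem derivative_legendre_eq (k : ℕ) : derivative (legendre k) =
    C (1 / (2 ^ k * (k.factorial : ℝ))) * derivative^[k + 1] ((X ^ 2 - 1) ^ k) := by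
  rw [legendre, derivative_C_mul, Function.iterate_succ_apply']

theorem integral_iterate_derivative_X_sq_sub_one_pow_mul {k m : ℕ} (hm : m ≤ k) (q : ℝ[X]) :
    ∫ x in (-1 : ℝ)..1, (derivative^[m] ((X ^ 2 - 1 : ℝ[X]) ^ k) * q).eval x
      = (-1) ^ m * ∫ x in (-1 : ℝ)..1, ((X ^ 2 - 1 : ℝ[X]) ^ k * derivative^[m] q).eval x := by
  induction m generalizing q with
  | zero => simp
  | succ m ih =>
    obtain ⟨r, hr⟩ : (X ^ 2 - 1 : ℝ[X]) ∣ derivative^[m] ((X ^ 2 - 1) ^ k) :=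
      (dvd_pow_self _ (by lia)).trans (pow_sub_dvd_iterate_derivative_pow _ k m)
    have hends (x : ℝ) (hx : x ^ 2 = 1) :
        (derivative^[m] ((X ^ 2 - 1 : ℝ[X]) ^ k) * q).eval x = 0 := by
      simp [hr, hx]
    rw [Function.iterate_succ_apply', integral_eval_derivative_mul, hends 1 (by norm_num),
      hends (-1) (by norm_num), ih (by lia), Function.iterate_succ_apply, pow_succ]
    ring

theorem integral_legendre_mul {k : ℕ} {q : ℝ[X]} (hq : q.natDegree < k) :
    ∫ x in (-1 : ℝ)..1, (legendre k * q).eval x = 0 := by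
  simp only [legendre, mul_assoc, eval_C_mul]
  rw [intervalIntegral.integral_const_mul,
    integral_iterate_derivative_X_sq_sub_one_pow_mul le_rfl, iterate_derivative_eq_zero hq]
  simp

theorem integral_one_sub_X_sq_mul_derivative_legendre_mul {k : ℕ} {q : ℝ[X]}
    (hq : q.natDegree + 1 < k) :
    ∫ x in (-1 : ℝ)..1, ((1 - X ^ 2) * derivative (legendre k) * q).eval x = 0 := by
  have hdeg : (derivative ((1 - X ^ 2 : ℝ[X]) * q)).natDegree < k := by
    have hsq : (1 - X ^ 2 : ℝ[X]).natDegree ≤ 2 := by compute_degree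
    have hmul := natDegree_mul_le (p := (1 - X ^ 2 : ℝ[X])) (q := q)
    rw [natDegree_derivative]
    lia
  rw [mul_comm (1 - X ^ 2), mul_assoc, integral_eval_derivative_mul, integral_legendre_mul hdeg]
  simp

theorem mem_Icc_of_isRoot_derivative_legendre {k : ℕ} (hk : 1 ≤ k) {x : ℝ}
    (hx : (derivative (legendre k)).IsRoot x) : x ∈ Set.Icc (-1 : ℝ) 1 := by
  have hne := derivative_legendre_ne_zero hk
  rw [derivative_legendre_eq] at hx hne
  refine mem_Icc_of_isRoot_iterate_derivative (p := (X ^ 2 - 1) ^ k) (fun z hz => ?_)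
    (right_ne_zero_of_mul hne)
    ((root_mul.1 hx).resolve_left (by simpa using legendre_factor_ne_zero k))
  have hz : z ^ 2 = 1 := by
    simpa [sub_eq_zero, Nat.one_le_iff_ne_zero.1 hk] using (mem_rootSet.1 hz).2
  rcases sq_eq_one_iff.1 hz with rfl | rfl <;> simp

theorem legendre_comp_neg_X (k : ℕ) : (legendre k).comp (-X) = (-1) ^ k * legendre k := by
  rw [legendre, mul_comp, C_comp, iterate_derivative_comp_neg_X, pow_comp, sub_comp, pow_comp,
    X_comp, one_comp, neg_sq]
  ring

theorem eval_neg_derivative_legendre_sq (k : ℕ) (x : ℝ) :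
    (derivative (legendre k)).eval (-x) ^ 2 = (derivative (legendre k)).eval x ^ 2 := by
  have h := legendre_comp_neg_X k
  rw [show ((-1) ^ k : ℝ[X]) = C ((-1) ^ k) by simp] at h
  have hx := congrArg (fun p => (derivative p).eval x ^ 2) h
  simpa only [derivative_comp, derivative_neg, derivative_X, derivative_C_mul, eval_mul, eval_neg,
    eval_one, eval_comp, eval_X, eval_C, mul_pow, neg_sq, one_pow, one_mul, pow_right_comm _ k 2]
    using hx

end Legendre

/-! ### Legendre-Gauss-Lobatto quadrature -/

section Lobatto

open Polynomial

/-- The polynomial `(1 - x²) P_k'`, whose zeros are the LGL nodes. -/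
def lobatto (k : ℕ) : ℝ[X] := (1 - X ^ 2) * derivative (legendre k)

theorem natDegree_lobatto {k : ℕ} (hk : 1 ≤ k) : (lobatto k).natDegree = k + 1 := by
  have hsq : (1 - X ^ 2 : ℝ[X]).natDegree = 2 := by compute_degree!
  rw [lobatto, natDegree_mul (ne_zero_of_natDegree_gt (n := 0) (by lia))
    (derivative_legendre_ne_zero hk), hsq, natDegree_derivative, natDegree_legendre]
  lia

theorem lobatto_ne_zero {k : ℕ} (hk : 1 ≤ k) : lobatto k ≠ 0 :=
  ne_zero_of_natDegree_gt (n := 0) (by rw [natDegree_lobatto hk]; lia)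

theorem zero_ne_last {k : ℕ} (hk : 1 ≤ k) : (0 : Fin (k + 1)) ≠ Fin.last k :=
  Fin.ne_of_val_ne (by rw [Fin.val_zero, Fin.val_last]; lia)

namespace LGLNodes

variable {k : ℕ} (N : LGLNodes k)

theorem injOn : Set.InjOn N.node (Finset.univ : Finset (Fin (k + 1))) :=
  N.strictMono.injective.injOn

theorem eval_basis (i j : Fin (k + 1)) :
    (N.basis i).eval (N.node j) = if i = j then 1 else 0 := by
  split_ifs with h
  · exact h ▸ Lagrange.eval_basis_self N.injOn (Finset.mem_univ _)
  · exact Lagrange.eval_basis_of_ne h (Finset.mem_univ _)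

theorem natDegree_basis (i : Fin (k + 1)) : (N.basis i).natDegree = k := by
  simpa [basis] using Lagrange.natDegree_basis N.injOn (Finset.mem_univ i)

theorem sum_basis : ∑ i, N.basis i = 1 :=
  Lagrange.sum_basis N.injOn Finset.univ_nonempty

theorem eq_sum_basis {f : ℝ[X]} (hf : f.natDegree ≤ k) :
    f = ∑ i, C (f.eval (N.node i)) * N.basis i := by
  have hdeg : f.degree < (Finset.univ : Finset (Fin (k + 1))).card := by
    rw [Finset.card_fin]
    exact degree_le_natDegree.trans_lt (by exact_mod_cast Nat.lt_succ_of_le hf)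
  simpa only [Lagrange.interpolate_apply, basis] using Lagrange.eq_interpolate N.injOn hdeg

theorem eval_lobatto_node (i : Fin (k + 1)) : (lobatto k).eval (N.node i) = 0 := by
  simpa [lobatto] using N.root i

theorem lobatto_eq_nodal (hk : 1 ≤ k) :
    lobatto k = C (lobatto k).leadingCoeff * Lagrange.nodal Finset.univ N.node := by
  have hdeg : (Lagrange.nodal Finset.univ N.node).degree = (k + 1 : ℕ) := by
    rw [Lagrange.degree_nodal, Finset.card_fin]
  refine Polynomial.eq_of_degree_sub_lt_of_eval_index_eq _ N.injOn ?_ fun i _ => ?_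
  · refine (degree_sub_lt_left ?_ (lobatto_ne_zero hk) ?_).trans_eq ?_
    · rw [degree_C_mul (leadingCoeff_ne_zero.2 (lobatto_ne_zero hk)), hdeg,
        degree_eq_natDegree (lobatto_ne_zero hk), natDegree_lobatto hk]
    · rw [leadingCoeff_mul, leadingCoeff_C, Lagrange.nodal_monic.leadingCoeff, mul_one]
    · rw [degree_eq_natDegree (lobatto_ne_zero hk), natDegree_lobatto hk, Finset.card_fin]
  · rw [N.eval_lobatto_node, eval_mul, Lagrange.eval_nodal_at_node (Finset.mem_univ i), mul_zero]

theorem exists_node_eq (hk : 1 ≤ k) {x : ℝ} (hx : (lobatto k).IsRoot x) :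
    ∃ i, N.node i = x := by
  rw [N.lobatto_eq_nodal hk, IsRoot.def, eval_C_mul, Lagrange.eval_nodal, mul_eq_zero,
    leadingCoeff_eq_zero, or_iff_right (lobatto_ne_zero hk), Finset.prod_eq_zero_iff] at hx
  obtain ⟨i, -, hi⟩ := hx
  exact ⟨i, (sub_eq_zero.1 hi).symm⟩

theorem node_mem_Icc (hk : 1 ≤ k) (i : Fin (k + 1)) : N.node i ∈ Set.Icc (-1 : ℝ) 1 := by
  rcases mul_eq_zero.1 (N.root i) with h | h
  · exact abs_le.1 (abs_le_one_iff_mul_self_le_one.2 (by linarith))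
  · exact mem_Icc_of_isRoot_derivative_legendre hk h

theorem node_zero (hk : 1 ≤ k) : N.node 0 = -1 := by
  obtain ⟨i, hi⟩ := N.exists_node_eq hk (x := -1) (by simp [lobatto])
  exact (hi ▸ N.strictMono.monotone (Fin.zero_le i)).antisymm (N.node_mem_Icc hk 0).1

theorem node_last (hk : 1 ≤ k) : N.node (Fin.last k) = 1 := by
  obtain ⟨i, hi⟩ := N.exists_node_eq hk (x := 1) (by simp [lobatto])
  exact (N.node_mem_Icc hk _).2.antisymm (hi ▸ N.strictMono.monotone (Fin.le_last i))

theorem eval_derivative_legendre_node (hk : 1 ≤ k) {i : Fin (k + 1)} (h0 : i ≠ 0)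
    (hlast : i ≠ Fin.last k) : (derivative (legendre k)).eval (N.node i) = 0 := by
  have hgt : -1 < N.node i := N.node_zero hk ▸ N.strictMono (Fin.pos_of_ne_zero h0)
  have hlt : N.node i < 1 := N.node_last hk ▸ N.strictMono (Fin.lt_last_iff_ne_last.2 hlast)
  exact (mul_eq_zero.1 (N.root i)).resolve_left (by nlinarith)

theorem sum_weight_mul_eval_of_natDegree_le {f : ℝ[X]} (hf : f.natDegree ≤ k) :
    ∑ i, N.weight i * f.eval (N.node i) = ∫ x in (-1 : ℝ)..1, f.eval x := by
  conv_rhs => rw [N.eq_sum_basis hf]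
  simp only [eval_finsetSum, eval_C_mul]
  rw [intervalIntegral.integral_finsetSum
    fun i _ => (intervalIntegrable_eval (N.basis i) (-1) 1).const_mul _]
  exact Finset.sum_congr rfl fun i _ => by
    rw [intervalIntegral.integral_const_mul, weight, mul_comm]

theorem integral_nodal_mul (hk : 1 ≤ k) {q : ℝ[X]} (hq : q.natDegree + 1 < k) :
    ∫ x in (-1 : ℝ)..1, (Lagrange.nodal Finset.univ N.node * q).eval x = 0 := by
  have h := integral_one_sub_X_sq_mul_derivative_legendre_mul hq
  rw [← lobatto, N.lobatto_eq_nodal hk] at h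
  simp only [mul_assoc, eval_C_mul] at h
  rw [intervalIntegral.integral_const_mul, mul_eq_zero, leadingCoeff_eq_zero] at h
  exact h.resolve_left (lobatto_ne_zero hk)

theorem sum_weight_mul_eval {f : ℝ[X]} (hf : f.natDegree < 2 * k) :
    ∑ i, N.weight i * f.eval (N.node i) = ∫ x in (-1 : ℝ)..1, f.eval x := by
  rcases le_or_gt f.natDegree k with hle | hlt
  · exact N.sum_weight_mul_eval_of_natDegree_le hle
  set p := Lagrange.nodal Finset.univ N.node with hp
  have hmonic : p.Monic := Lagrange.nodal_monic
  have hpdeg : p.natDegree = k + 1 := by rw [hp, Lagrange.natDegree_nodal, Finset.card_fin]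
  have hrdeg : (f %ₘ p).natDegree ≤ k := by
    have := natDegree_modByMonic_lt f hmonic (by rintro h; simp [h] at hpdeg)
    lia
  have hqdeg : (f /ₘ p).natDegree + 1 < k := by
    rw [natDegree_divByMonic f hmonic]
    lia
  have hnode (i : Fin (k + 1)) : f.eval (N.node i) = (f %ₘ p).eval (N.node i) := by
    conv_lhs => rw [← modByMonic_add_div f p, eval_add, eval_mul, hp,
      Lagrange.eval_nodal_at_node (Finset.mem_univ i), zero_mul, add_zero]
  have hint : ∫ x in (-1 : ℝ)..1, f.eval x = ∫ x in (-1 : ℝ)..1, (f %ₘ p).eval x := by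
    conv_lhs => rw [← modByMonic_add_div f p]
    simp only [eval_add]
    rw [intervalIntegral.integral_add (intervalIntegrable_eval _ _ _)
      (intervalIntegrable_eval _ _ _), N.integral_nodal_mul (by lia) hqdeg, add_zero]
  simp only [hint, hnode, N.sum_weight_mul_eval_of_natDegree_le hrdeg]

theorem sum_weight : ∑ i, N.weight i = 2 := by
  have h := N.sum_weight_mul_eval_of_natDegree_le (f := 1) (by simp)
  norm_num at h
  exact h

theorem weight_mul_eval {f : ℝ[X]} (hf : f.natDegree < 2 * k) {i : Fin (k + 1)}
    (hzero : ∀ j ≠ i, f.eval (N.node j) = 0) :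
    N.weight i * f.eval (N.node i) = ∫ x in (-1 : ℝ)..1, f.eval x := by
  rw [← N.sum_weight_mul_eval hf]
  refine (Fintype.sum_eq_single (f := fun j => N.weight j * f.eval (N.node j)) i ?_).symm
  exact fun j hj => by rw [hzero j hj, mul_zero]

theorem weight_pos_of_nonneg {f : ℝ[X]} (hf : f.natDegree < 2 * k) (hne : f ≠ 0)
    (hnonneg : ∀ x ∈ Set.Icc (-1 : ℝ) 1, 0 ≤ f.eval x) {i : Fin (k + 1)}
    (hzero : ∀ j ≠ i, f.eval (N.node j) = 0) : 0 < N.weight i := by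
  refine pos_of_mul_pos_left ?_ (hnonneg _ (N.node_mem_Icc (by lia) i))
  rw [N.weight_mul_eval hf hzero]
  exact integral_eval_pos (by norm_num) hne hnonneg

theorem natDegree_linear_mul_derivative_legendre_sq_lt {l : ℝ[X]} (hl : l.natDegree ≤ 1)
    (hk : 1 ≤ k) : (l * derivative (legendre k) ^ 2).natDegree < 2 * k := by
  have h := natDegree_mul_le (p := l) (q := derivative (legendre k) ^ 2)
  rw [natDegree_pow, natDegree_derivative, natDegree_legendre] at h
  lia

theorem integral_one_sub_X_mul_derivative_legendre_sq (k : ℕ) :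
    ∫ x in (-1 : ℝ)..1, ((1 - X) * derivative (legendre k) ^ 2).eval x
      = ∫ x in (-1 : ℝ)..1, ((1 + X) * derivative (legendre k) ^ 2).eval x := by
  have h := intervalIntegral.integral_comp_neg (a := -1) (b := 1)
    fun x : ℝ => ((1 + X) * derivative (legendre k) ^ 2).eval x
  simp only [eval_mul, eval_add, eval_one, eval_X, eval_pow, eval_neg_derivative_legendre_sq,
    ← sub_eq_add_neg, neg_neg] at h
  simpa using h

theorem weight_last_mul (hk : 1 ≤ k) :
    N.weight (Fin.last k) * (2 * (derivative (legendre k)).eval 1 ^ 2)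
      = ∫ x in (-1 : ℝ)..1, ((1 + X) * derivative (legendre k) ^ 2).eval x := by
  rw [← N.weight_mul_eval (natDegree_linear_mul_derivative_legendre_sq_lt
    (by compute_degree) hk) (i := Fin.last k) fun j hj => ?_]
  · rw [N.node_last hk, eval_mul, eval_add, eval_one, eval_X, eval_pow, one_add_one_eq_two]
  · rcases eq_or_ne j 0 with rfl | h0
    · simp [N.node_zero hk]
    · simp [N.eval_derivative_legendre_node hk h0 hj]

theorem weight_zero_mul (hk : 1 ≤ k) :
    N.weight 0 * (2 * (derivative (legendre k)).eval 1 ^ 2)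
      = ∫ x in (-1 : ℝ)..1, ((1 + X) * derivative (legendre k) ^ 2).eval x := by
  rw [← integral_one_sub_X_mul_derivative_legendre_sq, ← N.weight_mul_eval
    (natDegree_linear_mul_derivative_legendre_sq_lt (by compute_degree) hk) (i := 0) fun j hj => ?_]
  · rw [N.node_zero hk, eval_mul, eval_pow, eval_neg_derivative_legendre_sq, eval_sub, eval_one,
      eval_X, sub_neg_eq_add, one_add_one_eq_two]
  · rcases eq_or_ne j (Fin.last k) with rfl | hlast
    · simp [N.node_last hk]
    · simp [N.eval_derivative_legendre_node hk hj hlast]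

theorem integral_one_add_X_mul_derivative_legendre_sq_pos (hk : 1 ≤ k) :
    0 < ∫ x in (-1 : ℝ)..1, ((1 + X) * derivative (legendre k) ^ 2).eval x := by
  refine integral_eval_pos (by norm_num) (mul_ne_zero ?_ (pow_ne_zero 2
    (derivative_legendre_ne_zero hk))) fun x hx => ?_
  · exact ne_zero_of_natDegree_gt (n := 0) (by rw [add_comm, ← C_1, natDegree_X_add_C]; simp)
  · rw [eval_mul, eval_add, eval_one, eval_X, eval_pow]
    exact mul_nonneg (by linarith [hx.1]) (sq_nonneg _)

theorem weight_last (hk : 1 ≤ k) : N.weight (Fin.last k) = N.weight 0 := by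
  have hpos := integral_one_add_X_mul_derivative_legendre_sq_pos hk
  refine mul_right_cancel₀ (b := 2 * (derivative (legendre k)).eval 1 ^ 2) ?_
    ((N.weight_last_mul hk).trans (N.weight_zero_mul hk).symm)
  exact right_ne_zero_of_mul (N.weight_last_mul hk ▸ hpos.ne')

theorem weight_zero_pos (hk : 1 ≤ k) : 0 < N.weight 0 :=
  pos_of_mul_pos_left
    (N.weight_zero_mul hk ▸ integral_one_add_X_mul_derivative_legendre_sq_pos hk) (by positivity)

theorem weight_pos_of_interior (hk : 1 ≤ k) {i : Fin (k + 1)} (h0 : i ≠ 0)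
    (hlast : i ≠ Fin.last k) : 0 < N.weight i := by
  obtain ⟨r, hr⟩ := dvd_iff_isRoot.2 (N.eval_derivative_legendre_node hk h0 hlast)
  have hr_ne : r ≠ 0 := right_ne_zero_of_mul (hr ▸ derivative_legendre_ne_zero hk)
  have hr_deg : r.natDegree + 2 = k := by
    have h := congrArg natDegree hr
    rw [natDegree_derivative, natDegree_legendre, natDegree_mul (X_sub_C_ne_zero _) hr_ne,
      natDegree_X_sub_C] at h
    lia
  have hsq : (1 - X ^ 2 : ℝ[X]).natDegree = 2 := by compute_degree!
  refine N.weight_pos_of_nonneg (f := (1 - X ^ 2) * r ^ 2) ?_ ?_ (fun x hx => ?_) fun j hj => ?_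
  · have h := natDegree_mul_le (p := (1 - X ^ 2 : ℝ[X])) (q := r ^ 2)
    rw [natDegree_pow] at h
    lia
  · exact mul_ne_zero (ne_zero_of_natDegree_gt (n := 0) (by lia)) (pow_ne_zero 2 hr_ne)
  · rw [eval_mul, eval_sub, eval_one, eval_pow, eval_X, eval_pow]
    exact mul_nonneg (by nlinarith [hx.1, hx.2]) (sq_nonneg _)
  · have hroot := N.root j
    rw [hr, eval_mul, eval_sub, eval_X, eval_C, mul_left_comm, mul_eq_zero, or_iff_right
      (sub_ne_zero.2 (N.strictMono.injective.ne hj))] at hroot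
    rw [eval_mul, eval_sub, eval_one, eval_pow, eval_X, eval_pow, sq (r.eval _), ← mul_assoc,
      hroot, zero_mul]

theorem weight_pos (hk : 1 ≤ k) (i : Fin (k + 1)) : 0 < N.weight i := by
  rcases eq_or_ne i 0 with rfl | h0
  · exact N.weight_zero_pos hk
  rcases eq_or_ne i (Fin.last k) with rfl | hlast
  · exact N.weight_last hk ▸ N.weight_zero_pos hk
  · exact N.weight_pos_of_interior hk h0 hlast

theorem eval_one_sub_eval_neg_one_basis (hk : 1 ≤ k) (j : Fin (k + 1)) :
    (N.basis j).eval 1 - (N.basis j).eval (-1) = tau j := by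
  rw [← N.node_zero hk, ← N.node_last hk, N.eval_basis, N.eval_basis, tau]
  have hne := zero_ne_last hk
  split_ifs <;> simp_all

theorem sum_weight_mul_eval_derivative (hk : 1 ≤ k) {f : ℝ[X]} (hf : f.natDegree ≤ 2 * k) :
    ∑ i, N.weight i * (derivative f).eval (N.node i) = f.eval 1 - f.eval (-1) := by
  rw [N.sum_weight_mul_eval (by rw [natDegree_derivative]; lia), integral_eval_derivative]

theorem sum_weight_diff (hk : 1 ≤ k) (j : Fin (k + 1)) :
    ∑ i, N.weight i * N.diff i j = tau j := by
  rw [← N.eval_one_sub_eval_neg_one_basis hk]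
  exact N.sum_weight_mul_eval_derivative hk (by rw [N.natDegree_basis]; lia)

theorem summation_by_parts (hk : 1 ≤ k) (i j : Fin (k + 1)) :
    N.weight i * N.diff i j + N.weight j * N.diff j i = if i = j then tau i else 0 := by
  have h := N.sum_weight_mul_eval_derivative hk (f := N.basis i * N.basis j) (by
    have hmul := natDegree_mul_le (p := N.basis i) (q := N.basis j)
    rw [N.natDegree_basis, N.natDegree_basis] at hmul
    lia)
  have hlhs : ∑ n, N.weight n * (derivative (N.basis i * N.basis j)).eval (N.node n)
      = N.weight i * N.diff i j + N.weight j * N.diff j i := by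
    simp [derivative_mul, N.eval_basis, mul_add, Finset.sum_add_distrib, diff, add_comm]
  rw [← hlhs, h, ← N.eval_one_sub_eval_neg_one_basis hk, ← N.node_zero hk,
    ← N.node_last hk]
  simp only [eval_mul, N.eval_basis]
  split_ifs <;> simp_all

end LGLNodes

end Lobatto

/-! ### Linear tests for admissibility -/

section DotProduct

open Matrix

variable {ι : Type*} [Fintype ι]

theorem dotProduct_self_nonneg (a : ι → ℝ) : 0 ≤ a ⬝ᵥ a :=
  Finset.sum_nonneg fun i _ => mul_self_nonneg (a i)

theorem sq_apply_le_dotProduct_self (a : ι → ℝ) (i : ι) : a i ^ 2 ≤ a ⬝ᵥ a := by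
  rw [sq]
  exact Finset.single_le_sum (f := fun j => a j * a j) (fun j _ => mul_self_nonneg (a j))
    (Finset.mem_univ i)

theorem abs_dotProduct_le (a b : ι → ℝ) : |a ⬝ᵥ b| ≤ √(a ⬝ᵥ a) * √(b ⬝ᵥ b) := by
  rw [← Real.sqrt_mul (dotProduct_self_nonneg a)]
  refine Real.abs_le_sqrt ?_
  simpa only [dotProduct, sq] using Finset.sum_mul_sq_le_sq_mul_sq Finset.univ a b

theorem dotProduct_self_add (a b : ι → ℝ) :
    (a + b) ⬝ᵥ (a + b) = a ⬝ᵥ a + 2 * (a ⬝ᵥ b) + b ⬝ᵥ b := by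
  rw [add_dotProduct, dotProduct_add, dotProduct_add, dotProduct_comm b a]
  ring

theorem dotProduct_self_sub (a b : ι → ℝ) :
    (a - b) ⬝ᵥ (a - b) = a ⬝ᵥ a - 2 * (a ⬝ᵥ b) + b ⬝ᵥ b := by
  rw [sub_eq_add_neg, dotProduct_self_add, dotProduct_neg, neg_dotProduct_neg]
  ring

theorem sub_dotProduct_add (a b : ι → ℝ) : (a - b) ⬝ᵥ (a + b) = a ⬝ᵥ a - b ⬝ᵥ b := by
  rw [sub_dotProduct, dotProduct_add, dotProduct_add, dotProduct_comm b a]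
  ring

theorem abs_dotProduct_mul_le {s : ℝ} (hs : 0 ≤ s) (a b : ι → ℝ) :
    |a ⬝ᵥ b| * s ≤ s ^ 2 / 2 * (a ⬝ᵥ a) + (b ⬝ᵥ b) / 2 := by
  have hadd := dotProduct_self_nonneg (s • a + b)
  have hsub := dotProduct_self_nonneg (s • a - b)
  rw [dotProduct_self_add] at hadd
  rw [dotProduct_self_sub] at hsub
  simp only [smul_dotProduct, dotProduct_smul, smul_eq_mul] at hadd hsub
  rw [← abs_of_nonneg hs, ← abs_mul, abs_of_nonneg hs, abs_le]
  constructor <;> linarith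

end DotProduct

section LinearTests

open Matrix

variable {γ : ℝ} {w z : State}

theorem mom_eq_rho_smul_vel (h : rho w ≠ 0) : mom w = rho w • vel w := by
  rw [vel, smul_smul, mul_inv_cancel₀ h, one_smul]

theorem ener_eq_internal_add (h : rho w ≠ 0) :
    ener w = internal w + rho w / 2 * (vel w ⬝ᵥ vel w) + (mag w ⬝ᵥ mag w) / 2 := by
  rw [internal, mom_eq_rho_smul_vel h, smul_dotProduct, dotProduct_smul]
  simp only [smul_eq_mul]
  field_simp
  ring

theorem admissible_iff (hγ : 1 < γ) : Admissible γ w ↔ 0 < rho w ∧ 0 < internal w := by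
  rw [Admissible, pressure, mul_pos_iff_of_pos_left (sub_pos.2 hγ)]

theorem internal_pos (hγ : 1 < γ) (h : Admissible γ w) : 0 < internal w :=
  ((admissible_iff hγ).1 h).2

/-- The density as a linear functional. -/
def rhoForm : State →ₗ[ℝ] ℝ := LinearMap.fst ℝ _ _

theorem rhoForm_apply (w : State) : rhoForm w = rho w := rfl

/-- The functional `w ↦ (|v|²/2, -v, -b, 1) · w` of the geometric quasilinearization: up to the
constant `|b|²/2` it dominates the internal energy, with equality at `v = u(w)`, `b = B(w)`. -/
def gqlForm (v b : Fin 3 → ℝ) : State →ₗ[ℝ] ℝ where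
  toFun w := (v ⬝ᵥ v) / 2 * rho w - v ⬝ᵥ mom w - b ⬝ᵥ mag w + ener w
  map_add' w z := by
    simp only [rho, mom, mag, ener, Prod.fst_add, Prod.snd_add, dotProduct_add]
    ring
  map_smul' a w := by
    simp only [rho, mom, mag, ener, Prod.smul_fst, Prod.smul_snd, dotProduct_smul, smul_eq_mul,
      RingHom.id_apply]
    ring

theorem gqlForm_apply (v b : Fin 3 → ℝ) (w : State) :
    gqlForm v b w = (v ⬝ᵥ v) / 2 * rho w - v ⬝ᵥ mom w - b ⬝ᵥ mag w + ener w := rfl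

theorem gqlForm_add_eq (h : rho w ≠ 0) (v b : Fin 3 → ℝ) :
    gqlForm v b w + (b ⬝ᵥ b) / 2 = internal w + rho w / 2 * ((vel w - v) ⬝ᵥ (vel w - v))
      + ((mag w - b) ⬝ᵥ (mag w - b)) / 2 := by
  rw [gqlForm_apply, ener_eq_internal_add h, mom_eq_rho_smul_vel h, dotProduct_self_sub,
    dotProduct_self_sub, dotProduct_smul, dotProduct_comm v (vel w), dotProduct_comm b (mag w),
    smul_eq_mul]
  ring

theorem gqlForm_vel_mag_add (h : rho w ≠ 0) :
    gqlForm (vel w) (mag w) w + (mag w ⬝ᵥ mag w) / 2 = internal w := by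
  rw [gqlForm_add_eq h]
  simp

theorem internal_le_gqlForm_add (h : 0 < rho w) (v b : Fin 3 → ℝ) :
    internal w ≤ gqlForm v b w + (b ⬝ᵥ b) / 2 := by
  rw [gqlForm_add_eq h.ne']
  have hkin := mul_nonneg (half_pos h).le (dotProduct_self_nonneg (vel w - v))
  linarith [dotProduct_self_nonneg (mag w - b)]

theorem gqlForm_gpS (w : State) (v b : Fin 3 → ℝ) :
    gqlForm v b (gpS w) + v ⬝ᵥ b = (vel w - v) ⬝ᵥ (mag w - b) := by
  rw [gqlForm_apply]
  change (v ⬝ᵥ v) / 2 * 0 - v ⬝ᵥ mag w - b ⬝ᵥ vel w + vel w ⬝ᵥ mag w + v ⬝ᵥ b = _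
  rw [sub_dotProduct, dotProduct_sub, dotProduct_sub, dotProduct_comm b]
  ring

theorem gqlForm_flux (h : rho w ≠ 0) (d : Fin 3) (v b : Fin 3 → ℝ) :
    gqlForm v b (flux γ d w)
      = vel w d * (internal w + rho w / 2 * ((vel w - v) ⬝ᵥ (vel w - v)))
        + v d * (((mag w - b) ⬝ᵥ (mag w - b)) / 2 - (b ⬝ᵥ b) / 2) + mag w d * (v ⬝ᵥ b)
        + (pressure γ w * (vel w - v) d - mag w d * ((vel w - v) ⬝ᵥ (mag w - b))
          + (mag w ⬝ᵥ (mag w - b)) * (vel w - v) d) := by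
  have hv : v ⬝ᵥ Pi.single d (1 : ℝ) = v d := by simp
  have hmom : v ⬝ᵥ mom (flux γ d w) = rho w * vel w d * (v ⬝ᵥ vel w) - mag w d * (v ⬝ᵥ mag w)
      + totalPressure γ w * v d := by
    simp only [flux, mom, dotProduct_add, dotProduct_sub, dotProduct_smul, hv, smul_eq_mul]
  have hmag : b ⬝ᵥ mag (flux γ d w) = vel w d * (b ⬝ᵥ mag w) - mag w d * (b ⬝ᵥ vel w) := by
    simp only [flux, mag, dotProduct_sub, dotProduct_smul, smul_eq_mul]
  have hrho : rho (flux γ d w) = rho w * vel w d := rfl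
  have hener : ener (flux γ d w) = (ener w + totalPressure γ w) * vel w d
      - (vel w ⬝ᵥ mag w) * mag w d := rfl
  rw [gqlForm_apply, hmom, hmag, hrho, hener, ener_eq_internal_add h, totalPressure]
  simp only [dotProduct_sub, sub_dotProduct, Pi.sub_apply,
    dotProduct_comm v (vel w), dotProduct_comm v (mag w), dotProduct_comm b (vel w),
    dotProduct_comm b (mag w)]
  ring

end LinearTests

/-! ### The fast speed bound -/

section FastSpeed

open Matrix

variable {γ : ℝ} {w : State}

theorem mul_le_half_of_sq_le {n x a m b : ℝ} (ha : 0 ≤ a) (hm : 0 ≤ m) (hb : 0 ≤ b)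
    (h : x ^ 2 ≤ a * m * b) : n * x ≤ (a * n ^ 2 + m * b) / 2 := by
  refine (le_abs_self _).trans (abs_le_of_sq_le_sq ?_ (by positivity))
  have hsq : n ^ 2 * x ^ 2 ≤ n ^ 2 * (a * m * b) := mul_le_mul_of_nonneg_left h (sq_nonneg n)
  nlinarith [sq_nonneg (a * n ^ 2 - m * b)]

-- The variables are the scaled perturbations `(√(2ρe), √ρ θ, b)`, in which the form is symmetric
-- and `C` is its largest eigenvalue.
theorem magnetosonicForm_le {C cs bd β₁ β₂ : ℝ} (hC : 0 < C) (hcs : cs ^ 2 ≤ C ^ 2)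
    (hbd : bd ^ 2 ≤ C ^ 2)
    (hroot : (C ^ 2 - cs ^ 2) * (C ^ 2 - bd ^ 2) = (β₁ ^ 2 + β₂ ^ 2) * C ^ 2)
    (y n t₁ t₂ b₁ b₂ : ℝ) :
    n * (cs * y + β₁ * b₁ + β₂ * b₂) - bd * (t₁ * b₁ + t₂ * b₂)
      ≤ C / 2 * (y ^ 2 + n ^ 2 + t₁ ^ 2 + t₂ ^ 2 + b₁ ^ 2 + b₂ ^ 2) := by
  have hx : (C * (β₁ * b₁ + β₂ * b₂)) ^ 2
      ≤ (C ^ 2 - cs ^ 2) * (C ^ 2 - bd ^ 2) * (b₁ ^ 2 + b₂ ^ 2) := by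
    rw [hroot]
    have hlagrange : 0 ≤ C ^ 2 * (β₁ * b₂ - β₂ * b₁) ^ 2 := by positivity
    nlinarith
  have hn := mul_le_half_of_sq_le (n := n) (sub_nonneg.2 hcs) (sub_nonneg.2 hbd)
    (by positivity) hx
  refine le_of_mul_le_mul_left ?_ hC
  nlinarith [sq_nonneg (C * y - cs * n), sq_nonneg (C * t₁ + bd * b₁),
    sq_nonneg (C * t₂ + bd * b₂)]

theorem larger_root_spec {c b B : ℝ} (hc : 0 ≤ c) (hb : 0 ≤ b) (hbB : b ≤ B) :
    let K := (c + B + √((c + B) ^ 2 - 4 * c * b)) / 2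
    c ≤ K ∧ b ≤ K ∧ (K - c) * (K - b) = (B - b) * K := by
  have hdisc : (c - b) ^ 2 ≤ (c + B) ^ 2 - 4 * c * b := by
    have hmul := mul_nonneg hc (sub_nonneg.2 hbB)
    have hsq := pow_le_pow_left₀ hb hbB 2
    linarith
  have habs := Real.abs_le_sqrt hdisc
  have hsq := Real.sq_sqrt ((sq_nonneg _).trans hdisc)
  refine ⟨?_, ?_, ?_⟩
  · linarith [le_abs_self (c - b)]
  · linarith [neg_abs_le (c - b)]
  · linear_combination hsq / 4

theorem fastSpeed_spec (hγ : 1 < γ) (h : Admissible γ w) (d : Fin 3) :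
    0 < fastSpeed γ d w ∧
    pressure γ w ^ 2 / (2 * rho w * internal w) ≤ fastSpeed γ d w ^ 2 ∧
    mag w d ^ 2 / rho w ≤ fastSpeed γ d w ^ 2 ∧
    (fastSpeed γ d w ^ 2 - pressure γ w ^ 2 / (2 * rho w * internal w))
        * (fastSpeed γ d w ^ 2 - mag w d ^ 2 / rho w)
      = ((mag w ⬝ᵥ mag w) / rho w - mag w d ^ 2 / rho w) * fastSpeed γ d w ^ 2 := by
  have hρ := h.1
  have hi := internal_pos hγ h
  have hp := h.2
  have hcs : 0 < pressure γ w ^ 2 / (2 * rho w * internal w) := by positivity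
  have hspec := larger_root_spec hcs.le (div_nonneg (sq_nonneg (mag w d)) hρ.le)
    (div_le_div_of_nonneg_right (sq_apply_le_dotProduct_self (mag w) d) hρ.le)
  rw [← mul_div_assoc] at hspec
  have hK := hcs.trans_le hspec.1
  have hsq := Real.sq_sqrt hK.le
  change fastSpeed γ d w ^ 2 = _ at hsq
  rw [hsq]
  exact ⟨Real.sqrt_pos.2 hK, hspec⟩

theorem le_fastSpeed_mul_of_dotProduct_eq (hγ : 1 < γ) (h : Admissible γ w) (d i j : Fin 3)
    (hdot : ∀ x y : Fin 3 → ℝ, x ⬝ᵥ y = x d * y d + x i * y i + x j * y j)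
    (θ b : Fin 3 → ℝ) :
    pressure γ w * θ d - mag w d * (θ ⬝ᵥ b) + (mag w ⬝ᵥ b) * θ d
      ≤ fastSpeed γ d w * (internal w + rho w / 2 * (θ ⬝ᵥ θ) + (b ⬝ᵥ b) / 2) := by
  obtain ⟨hC, hcs, hbd, hroot⟩ := fastSpeed_spec hγ h d
  have hρ := h.1
  have hi := internal_pos hγ h
  set C := fastSpeed γ d w
  set s := √(rho w)
  have hs : 0 < s := Real.sqrt_pos.2 hρ
  have hs_sq : rho w = s ^ 2 := (Real.sq_sqrt hρ.le).symm
  set y := √(2 * internal w) with hy_def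
  have hy : 0 < y := Real.sqrt_pos.2 (by linarith)
  have hy_sq : internal w = y ^ 2 / 2 := by rw [hy_def, Real.sq_sqrt (by linarith)]; ring
  have hcs_eq : pressure γ w ^ 2 / (2 * rho w * internal w) = (pressure γ w / (s * y)) ^ 2 := by
    rw [hs_sq, hy_sq]; field_simp
  have hbd_eq : mag w d ^ 2 / rho w = (mag w d / s) ^ 2 := by rw [hs_sq]; field_simp
  have hmag_eq : (mag w ⬝ᵥ mag w) / rho w
      = (mag w d / s) ^ 2 + (mag w i / s) ^ 2 + (mag w j / s) ^ 2 := by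
    rw [hs_sq, hdot]; field_simp
  rw [hcs_eq] at hcs
  rw [hbd_eq] at hbd
  rw [hcs_eq, hbd_eq, hmag_eq] at hroot
  have hform := magnetosonicForm_le hC hcs hbd (β₁ := mag w i / s) (β₂ := mag w j / s)
    (by rw [hroot]; ring) y (s * θ d) (s * θ i) (s * θ j) (b i) (b j)
  have hlhs : s * θ d * (pressure γ w / (s * y) * y + mag w i / s * b i + mag w j / s * b j)
      - mag w d / s * (s * θ i * b i + s * θ j * b j)
      = pressure γ w * θ d - mag w d * (θ ⬝ᵥ b) + (mag w ⬝ᵥ b) * θ d := by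
    rw [hdot, hdot]; field_simp; ring
  rw [hlhs] at hform
  refine hform.trans ?_
  rw [hdot, hdot, hs_sq, hy_sq]
  have hb := mul_nonneg hC.le (sq_nonneg (b d))
  nlinarith

theorem le_fastSpeed_mul (hγ : 1 < γ) (h : Admissible γ w) (d : Fin 3) (θ b : Fin 3 → ℝ) :
    pressure γ w * θ d - mag w d * (θ ⬝ᵥ b) + (mag w ⬝ᵥ b) * θ d
      ≤ fastSpeed γ d w * (internal w + rho w / 2 * (θ ⬝ᵥ θ) + (b ⬝ᵥ b) / 2) := by
  fin_cases d
  · exact le_fastSpeed_mul_of_dotProduct_eq hγ h 0 1 2 vec3_dotProduct θ b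
  · exact le_fastSpeed_mul_of_dotProduct_eq hγ h 1 0 2
      (fun x y => by rw [vec3_dotProduct]; ring) θ b
  · exact le_fastSpeed_mul_of_dotProduct_eq hγ h 2 0 1
      (fun x y => by rw [vec3_dotProduct]; ring) θ b

theorem neg_fastSpeed_mul_le (hγ : 1 < γ) (h : Admissible γ w) (d : Fin 3) (θ b : Fin 3 → ℝ) :
    -(fastSpeed γ d w * (internal w + rho w / 2 * (θ ⬝ᵥ θ) + (b ⬝ᵥ b) / 2))
      ≤ pressure γ w * θ d - mag w d * (θ ⬝ᵥ b) + (mag w ⬝ᵥ b) * θ d := by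
  have h := le_fastSpeed_mul hγ h d (-θ) b
  simp only [neg_dotProduct, Pi.neg_apply, dotProduct_neg, neg_neg] at h
  linarith

end FastSpeed

/-! ### The splitting inequality -/

section Splitting

open Matrix

variable {γ : ℝ} {w z : State}

/-- An affine functional `w ↦ φ w + c` that is positive on admissible states and for which the
speed bounds `alphaR`, `alphaL` give positivity of a flux splitting. The constant `κ` is the
factor with which jumps of the normal magnetic field disturb the splitting; the Godunov-Powell
term compensates them through `gp`. -/
structure IsPositivityForm (γ : ℝ) (φ : State →ₗ[ℝ] ℝ) (c κ : ℝ) : Prop where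
  pos : ∀ w, Admissible γ w → 0 < φ w + c
  gp : ∀ w, Admissible γ w → |φ (gpS w) + κ| ≤ (φ w + c) / √(rho w)
  split : ∀ d w z a b, Admissible γ w → Admissible γ z → alphaR γ d w z ≤ a →
    b ≤ alphaL γ d z w →
    0 ≤ φ (a • w - flux γ d w - b • z + flux γ d z) + (a - b) * c + (mag w d - mag z d) * κ

theorem roeVel_comm (d : Fin 3) (w z : State) : roeVel d z w = roeVel d w z := by
  rw [roeVel, roeVel, add_comm, add_comm √(rho z)]

theorem magJumpSpeed_comm (w z : State) : magJumpSpeed z w = magJumpSpeed w z := by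
  rw [magJumpSpeed, magJumpSpeed, add_comm √(rho z), ← neg_sub (mag w), neg_dotProduct_neg]

theorem magJumpSpeed_nonneg (w z : State) : 0 ≤ magJumpSpeed w z := by
  rw [magJumpSpeed]
  positivity

theorem vel_le_alphaR (hγ : 1 < γ) (h : Admissible γ w) (d : Fin 3) (z : State) :
    vel w d ≤ alphaR γ d w z := by
  rw [alphaR]
  linarith [(fastSpeed_spec hγ h d).1, le_max_left (vel w d) (roeVel d w z),
    magJumpSpeed_nonneg w z]

theorem alphaL_le_vel (hγ : 1 < γ) (h : Admissible γ w) (d : Fin 3) (z : State) :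
    alphaL γ d w z ≤ vel w d := by
  rw [alphaL]
  linarith [(fastSpeed_spec hγ h d).1, min_le_left (vel w d) (roeVel d w z),
    magJumpSpeed_nonneg w z]

theorem isPositivityForm_rhoForm (hγ : 1 < γ) : IsPositivityForm γ rhoForm 0 0 where
  pos w h := by simpa [rhoForm_apply] using h.1
  gp w h := by
    have hgp : rhoForm (gpS w) = 0 := rfl
    rw [hgp, rhoForm_apply, add_zero, add_zero, abs_zero]
    exact div_nonneg h.1.le (Real.sqrt_nonneg _)
  split d w z a b hw hz ha hb := by
    have heq : rhoForm (a • w - flux γ d w - b • z + flux γ d z)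
        = (a - vel w d) * rho w + (vel z d - b) * rho z := by
      simp only [map_add, map_sub, map_smul, rhoForm_apply, smul_eq_mul]
      change a * rho w - rho w * vel w d - b * rho z + rho z * vel z d = _
      ring
    have hw' := mul_nonneg (sub_nonneg.2 ((vel_le_alphaR hγ hw d z).trans ha)) hw.1.le
    have hz' := mul_nonneg (sub_nonneg.2 (hb.trans (alphaL_le_vel hγ hz d w))) hz.1.le
    linarith

theorem gqlForm_flux_le (hγ : 1 < γ) (h : Admissible γ w) (d : Fin 3) (v b : Fin 3 → ℝ)
    (r : ℝ) :
    gqlForm v b (flux γ d w) + v d * ((b ⬝ᵥ b) / 2) - mag w d * (v ⬝ᵥ b)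
      ≤ (max (vel w d) r + fastSpeed γ d w) * (gqlForm v b w + (b ⬝ᵥ b) / 2)
        - (r - v d) * (((mag w - b) ⬝ᵥ (mag w - b)) / 2) := by
  rw [gqlForm_flux h.1.ne', gqlForm_add_eq h.1.ne']
  have hfast := le_fastSpeed_mul hγ h d (vel w - v) (mag w - b)
  have hkin := mul_nonneg (half_pos h.1).le (dotProduct_self_nonneg (vel w - v))
  have hvel := mul_le_mul_of_nonneg_right (le_max_left (vel w d) r)
    (add_nonneg (internal_pos hγ h).le hkin)
  have hmag := mul_le_mul_of_nonneg_right (le_max_right (vel w d) r)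
    (div_nonneg (dotProduct_self_nonneg (mag w - b)) zero_le_two)
  linarith

theorem le_gqlForm_flux (hγ : 1 < γ) (h : Admissible γ w) (d : Fin 3) (v b : Fin 3 → ℝ)
    (r : ℝ) :
    (min (vel w d) r - fastSpeed γ d w) * (gqlForm v b w + (b ⬝ᵥ b) / 2)
        - (r - v d) * (((mag w - b) ⬝ᵥ (mag w - b)) / 2)
      ≤ gqlForm v b (flux γ d w) + v d * ((b ⬝ᵥ b) / 2) - mag w d * (v ⬝ᵥ b) := by
  rw [gqlForm_flux h.1.ne', gqlForm_add_eq h.1.ne']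
  have hfast := neg_fastSpeed_mul_le hγ h d (vel w - v) (mag w - b)
  have hkin := mul_nonneg (half_pos h.1).le (dotProduct_self_nonneg (vel w - v))
  have hvel := mul_le_mul_of_nonneg_right (min_le_left (vel w d) r)
    (add_nonneg (internal_pos hγ h).le hkin)
  have hmag := mul_le_mul_of_nonneg_right (min_le_right (vel w d) r)
    (div_nonneg (dotProduct_self_nonneg (mag w - b)) zero_le_two)
  linarith

theorem neg_mean_mul_jump_le {ι : Type*} [Fintype ι] {a c : ℝ} (hac : 0 < a + c) (x y : ℝ)
    (b b' : ι → ℝ) :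
    -((a * x + c * y) / (a + c) * ((b ⬝ᵥ b - b' ⬝ᵥ b') / 2)) ≤
      √((b - b') ⬝ᵥ (b - b')) / (a + c) *
        (a ^ 2 * x ^ 2 / 2 + b ⬝ᵥ b / 2 + (c ^ 2 * y ^ 2 / 2 + b' ⬝ᵥ b' / 2)) := by
  set m := a * x + c * y with hm
  set J := √((b - b') ⬝ᵥ (b - b'))
  set T := √((b + b') ⬝ᵥ (b + b'))
  have hT_sq : T ^ 2 ≤ 2 * (b ⬝ᵥ b) + 2 * (b' ⬝ᵥ b') := by
    rw [Real.sq_sqrt (dotProduct_self_nonneg _)]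
    linarith [dotProduct_self_nonneg (b - b'), dotProduct_self_add b b', dotProduct_self_sub b b']
  have hm_sq : |m| ^ 2 ≤ 2 * (a ^ 2 * x ^ 2) + 2 * (c ^ 2 * y ^ 2) := by
    rw [sq_abs, hm]
    nlinarith [sq_nonneg (a * x - c * y)]
  have hmT : |m| * T ≤ a ^ 2 * x ^ 2 + c ^ 2 * y ^ 2 + b ⬝ᵥ b + b' ⬝ᵥ b' := by
    nlinarith [sq_nonneg (|m| - T)]
  have hjump : -(m * (b ⬝ᵥ b - b' ⬝ᵥ b'))
      ≤ J * (a ^ 2 * x ^ 2 + c ^ 2 * y ^ 2 + b ⬝ᵥ b + b' ⬝ᵥ b') :=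
    calc -(m * (b ⬝ᵥ b - b' ⬝ᵥ b')) ≤ |m * (b ⬝ᵥ b - b' ⬝ᵥ b')| := neg_le_abs _
      _ = |m| * |(b - b') ⬝ᵥ (b + b')| := by rw [abs_mul, sub_dotProduct_add]
      _ ≤ |m| * (J * T) := mul_le_mul_of_nonneg_left (abs_dotProduct_le _ _) (abs_nonneg _)
      _ = J * (|m| * T) := by ring
      _ ≤ _ := mul_le_mul_of_nonneg_left hmT (Real.sqrt_nonneg _)
  calc -(m / (a + c) * ((b ⬝ᵥ b - b' ⬝ᵥ b') / 2))
      = -(m * (b ⬝ᵥ b - b' ⬝ᵥ b')) / (2 * (a + c)) := by field_simp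
    _ ≤ J * (a ^ 2 * x ^ 2 + c ^ 2 * y ^ 2 + b ⬝ᵥ b + b' ⬝ᵥ b') / (2 * (a + c)) :=
        div_le_div_of_nonneg_right hjump (by linarith)
    _ = _ := by field_simp; ring

theorem rho_mul_sq_add_le_gqlForm (hγ : 1 < γ) (h : Admissible γ w) (d : Fin 3)
    (v b : Fin 3 → ℝ) :
    rho w * (vel w d - v d) ^ 2 / 2 + ((mag w - b) ⬝ᵥ (mag w - b)) / 2
      ≤ gqlForm v b w + (b ⬝ᵥ b) / 2 := by
  rw [gqlForm_add_eq h.1.ne']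
  have hd := mul_le_mul_of_nonneg_left (sq_apply_le_dotProduct_self (vel w - v) d)
    (half_pos h.1).le
  rw [Pi.sub_apply] at hd
  linarith [internal_pos hγ h]

theorem neg_roeVel_sub_mul_le (hγ : 1 < γ) (hw : Admissible γ w) (hz : Admissible γ z)
    (d : Fin 3) (v b : Fin 3 → ℝ) :
    -((roeVel d w z - v d)
        * (((mag w - b) ⬝ᵥ (mag w - b) - (mag z - b) ⬝ᵥ (mag z - b)) / 2))
      ≤ magJumpSpeed w z
        * ((gqlForm v b w + (b ⬝ᵥ b) / 2) + (gqlForm v b z + (b ⬝ᵥ b) / 2)) := by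
  have hsw := Real.sqrt_pos.2 hw.1
  have hsz := Real.sqrt_pos.2 hz.1
  have hroe : roeVel d w z - v d = (√(rho w) * (vel w d - v d) + √(rho z) * (vel z d - v d))
      / (√(rho w) + √(rho z)) := by
    rw [roeVel]; field_simp; ring
  have hjump := neg_mean_mul_jump_le (add_pos hsw hsz) (vel w d - v d) (vel z d - v d)
    (mag w - b) (mag z - b)
  rw [Real.sq_sqrt hw.1.le, Real.sq_sqrt hz.1.le, sub_sub_sub_cancel_right, ← hroe] at hjump
  exact hjump.trans (mul_le_mul_of_nonneg_left
    (add_le_add (rho_mul_sq_add_le_gqlForm hγ hw d v b) (rho_mul_sq_add_le_gqlForm hγ hz d v b))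
    (magJumpSpeed_nonneg w z))

theorem isPositivityForm_gqlForm (hγ : 1 < γ) (v b : Fin 3 → ℝ) :
    IsPositivityForm γ (gqlForm v b) ((b ⬝ᵥ b) / 2) (v ⬝ᵥ b) where
  pos w h := (internal_pos hγ h).trans_le (internal_le_gqlForm_add h.1 v b)
  gp w h := by
    have hs : 0 < √(rho w) := Real.sqrt_pos.2 h.1
    have hyoung := abs_dotProduct_mul_le hs.le (vel w - v) (mag w - b)
    rw [Real.sq_sqrt h.1.le] at hyoung
    rw [gqlForm_gpS, le_div_iff₀ hs, gqlForm_add_eq h.1.ne']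
    linarith [internal_pos hγ h]
  split d w z a a' hw hz ha ha' := by
    have hYw := (internal_pos hγ hw).le.trans (internal_le_gqlForm_add hw.1 v b)
    have hYz := (internal_pos hγ hz).le.trans (internal_le_gqlForm_add hz.1 v b)
    rw [alphaR] at ha
    rw [alphaL, roeVel_comm, magJumpSpeed_comm] at ha'
    have hw_flux := gqlForm_flux_le hγ hw d v b (roeVel d w z)
    have hz_flux := le_gqlForm_flux hγ hz d v b (roeVel d w z)
    have hjump := neg_roeVel_sub_mul_le hγ hw hz d v b
    have hwa := mul_le_mul_of_nonneg_right ha hYw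
    have hza := mul_le_mul_of_nonneg_right ha' hYz
    simp only [map_add, map_sub, map_smul, smul_eq_mul]
    linarith

theorem admissible_of_forall_isPositivityForm (hγ : 1 < γ)
    (h : ∀ φ c κ, IsPositivityForm γ φ c κ → 0 < φ w + c) : Admissible γ w := by
  have hρ : 0 < rho w := by
    simpa [rhoForm_apply] using h _ _ _ (isPositivityForm_rhoForm hγ)
  rw [admissible_iff hγ, ← gqlForm_vel_mag_add hρ.ne']
  exact ⟨hρ, h _ _ _ (isPositivityForm_gqlForm hγ (vel w) (mag w))⟩

end Splitting

/-! ### The Chandrashekar flux -/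

section Chandrashekar

open Matrix

theorem logMean_self (a : ℝ) : logMean a a = a := if_pos rfl

theorem logMean_comm (a b : ℝ) : logMean a b = logMean b a := by
  by_cases h : a = b
  · rw [h]
  · rw [logMean, logMean, if_neg h, if_neg (Ne.symm h), ← neg_sub b a,
      ← neg_sub (Real.log b), neg_div_neg_eq]

theorem chandrashekar_comm (γ : ℝ) (d : Fin 3) (w z : State) :
    chandrashekar γ d w z = chandrashekar γ d z w := by
  simp only [chandrashekar, logMean_comm (rho w), logMean_comm (invTemp γ w),
    add_comm (vel w), add_comm (mag w), add_comm (rho w), add_comm (invTemp γ w),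
    add_comm (invTemp γ w • vel w), add_comm (vel w ⬝ᵥ vel w), add_comm (mag w ⬝ᵥ mag w)]

theorem chandrashekar_self {γ : ℝ} (hγ : 1 < γ) (d : Fin 3) {w : State} (h : Admissible γ w) :
    chandrashekar γ d w w = flux γ d w := by
  have hρ := h.1.ne'
  have hp := h.2.ne'
  have hγ_sub : γ - 1 ≠ 0 := (sub_pos.2 hγ).ne'
  have hmean_vec (x : Fin 3 → ℝ) : (1 / 2 : ℝ) • (x + x) = x := by
    rw [← two_smul ℝ x, smul_smul]; norm_num
  have hmean (x : ℝ) : (x + x) / 2 = x := by ring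
  have hβ : invTemp γ w ≠ 0 := div_ne_zero hρ (mul_ne_zero two_ne_zero hp)
  have hpressure : rho w / (2 * invTemp γ w) = pressure γ w := by
    rw [invTemp]; field_simp
  have henergy : 1 / ((γ - 1) * invTemp γ w) = 2 * internal w / rho w := by
    have hi : internal w = pressure γ w / (γ - 1) := by rw [pressure]; field_simp
    rw [hi, invTemp]; field_simp
  have hFB : (invTemp γ w)⁻¹ • ((invTemp γ w • vel w) d • mag w - mag w d • invTemp γ w • vel w)
      = vel w d • mag w - mag w d • vel w := by
    ext i
    simp only [Pi.smul_apply, Pi.sub_apply, smul_eq_mul]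
    field_simp
  have hd : vel w ⬝ᵥ Pi.single d (1 : ℝ) = vel w d := by simp
  simp only [chandrashekar, hmean_vec, hmean, logMean_self, hpressure, henergy, hFB]
  refine Prod.ext rfl (Prod.ext rfl (Prod.ext rfl ?_))
  simp only [flux, ener_eq_internal_add hρ, totalPressure, dotProduct_add, dotProduct_sub,
    dotProduct_smul, hd, smul_eq_mul, dotProduct_comm (mag w) (vel w)]
  field_simp
  ring

theorem isTwoPointFlux_chandrashekar {γ : ℝ} (hγ : 1 < γ) :
    IsTwoPointFlux γ (chandrashekar γ) :=
  ⟨fun d w z _ _ => chandrashekar_comm γ d w z, fun d _ h => chandrashekar_self hγ d h⟩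

end Chandrashekar

/-! ### Boundary terms of a line of nodes -/

section Line

theorem sum_eq_zero_add_last {M : Type*} [AddCommMonoid M] {k : ℕ} (hk : 1 ≤ k)
    {g : Fin (k + 1) → M} (hg : ∀ i, i ≠ 0 → i ≠ Fin.last k → g i = 0) :
    ∑ i, g i = g 0 + g (Fin.last k) := by
  rw [← Finset.sum_pair (zero_ne_last hk)]
  refine (Finset.sum_subset (Finset.subset_univ _) fun i _ hi => ?_).symm
  simp only [Finset.mem_insert, Finset.mem_singleton, not_or] at hi
  exact hg i hi.1 hi.2

theorem sum_tau_smul {k : ℕ} (hk : 1 ≤ k) {M : Type*} [AddCommGroup M] [Module ℝ M]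
    (g : Fin (k + 1) → M) : ∑ α, tau α • g α = g (Fin.last k) - g 0 := by
  rw [sum_eq_zero_add_last hk fun i h0 hlast => by simp [tau, h0, hlast]]
  simp only [tau, if_true, if_neg (zero_ne_last hk).symm, neg_smul, one_smul]
  abel

theorem mul_le_of_abs_le {r x g Y s : ℝ} (hr : 0 ≤ r) (h : |g| ≤ Y / s) :
    r * x * g ≤ r * (|x| / s) * Y := by
  calc r * x * g ≤ |r * x * g| := le_abs_self _
    _ = r * |x| * |g| := by rw [abs_mul, abs_mul, abs_of_nonneg hr]
    _ ≤ r * |x| * (Y / s) := mul_le_mul_of_nonneg_left h (by positivity)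
    _ = _ := by ring

namespace Disc

variable {k : ℕ} (S : Disc k)

theorem sum_weight_volumeFlux (hk : 1 ≤ k) (hfS : IsTwoPointFlux S.γ S.fS) (d : Fin 3)
    (u : Fin (k + 1) → State) (hu : ∀ α, Admissible S.γ (u α)) :
    ∑ α, S.X.weight α • ((2 : ℝ) • ∑ β, S.X.diff α β • S.fS d (u α) (u β))
      = flux S.γ d (u (Fin.last k)) - flux S.γ d (u 0) := by
  have hsymm : ∑ α, ∑ β, (S.X.weight α * S.X.diff α β) • S.fS d (u α) (u β)
      = ∑ α, ∑ β, (S.X.weight β * S.X.diff β α) • S.fS d (u α) (u β) := by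
    rw [Finset.sum_comm]
    refine Finset.sum_congr rfl fun α _ => Finset.sum_congr rfl fun β _ => ?_
    rw [hfS.1 d _ _ (hu β) (hu α)]
  calc ∑ α, S.X.weight α • ((2 : ℝ) • ∑ β, S.X.diff α β • S.fS d (u α) (u β))
      = ∑ α, ∑ β, (S.X.weight α * S.X.diff α β) • S.fS d (u α) (u β)
        + ∑ α, ∑ β, (S.X.weight α * S.X.diff α β) • S.fS d (u α) (u β) := by
        rw [← Finset.sum_add_distrib]
        refine Finset.sum_congr rfl fun α _ => ?_
        rw [smul_comm, two_smul]
        simp only [Finset.smul_sum, smul_smul]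
    _ = ∑ α, ∑ β, (if α = β then tau α else 0) • S.fS d (u α) (u β) := by
        nth_rewrite 2 [hsymm]
        simp only [← Finset.sum_add_distrib, ← add_smul, S.X.summation_by_parts hk]
    _ = ∑ α, tau α • flux S.γ d (u α) := by
        refine Finset.sum_congr rfl fun α _ => ?_
        simp [ite_smul, hfS.2 d _ (hu α)]
    _ = _ := sum_tau_smul hk _

theorem sum_weight_lineRes (hk : 1 ≤ k) (hfS : IsTwoPointFlux S.γ S.fS) (d : Fin 3)
    (u : Fin (k + 1) → State) (hu : ∀ α, Admissible S.γ (u α)) (eL eR : State) :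
    ∑ α, S.X.weight α • S.lineRes d u eL eR α
      = S.lineBoundary d u eL eR
        - ∑ α, (S.X.weight α * ∑ β, S.X.diff α β * mag (u β) d) • gpS (u α) := by
  have hstar : ∑ α, S.X.weight α • ((tau α / S.X.weight α) • S.star d u eL eR α)
      = S.star d u eL eR (Fin.last k) - S.star d u eL eR 0 := by
    rw [← sum_tau_smul hk]
    refine Finset.sum_congr rfl fun α _ => ?_
    rw [smul_smul, mul_div_cancel₀ _ (S.X.weight_pos hk α).ne']
  have hsource (α : Fin (k + 1)) :
      S.X.weight α • ∑ β, (S.X.diff α β * mag (u β) d) • gpS (u α)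
        = (S.X.weight α * ∑ β, S.X.diff α β * mag (u β) d) • gpS (u α) := by
    rw [← Finset.sum_smul, smul_smul]
  simp only [lineRes, smul_sub, Finset.sum_sub_distrib, hstar, hsource,
    S.sum_weight_volumeFlux hk hfS d u hu]
  simp only [star, if_neg (zero_ne_last hk).symm, if_true, lineBoundary]
  abel

section Interface

variable {d : Fin 3} {wL wR : State}

theorem hll_eq_flux_right (h : S.SL d wL wR < S.SR d wL wR) (φ : State →ₗ[ℝ] ℝ) :
    φ (S.hll d wL wR) = φ (flux S.γ d wR) - S.SR d wL wR * φ wR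
      + S.SR d wL wR / (S.SR d wL wR - S.SL d wL wR)
        * φ (S.SR d wL wR • wR - flux S.γ d wR - S.SL d wL wR • wL + flux S.γ d wL) := by
  have hne : S.SR d wL wR - S.SL d wL wR ≠ 0 := (sub_pos.2 h).ne'
  simp only [hll, map_add, map_sub, map_smul, smul_eq_mul]
  field_simp
  ring

theorem hll_eq_flux_left (h : S.SL d wL wR < S.SR d wL wR) (φ : State →ₗ[ℝ] ℝ) :
    φ (S.hll d wL wR) = φ (flux S.γ d wL) - S.SL d wL wR * φ wL
      - -S.SL d wL wR / (S.SR d wL wR - S.SL d wL wR)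
        * φ (S.SR d wL wR • wR - flux S.γ d wR - S.SL d wL wR • wL + flux S.γ d wL) := by
  have hne : S.SR d wL wR - S.SL d wL wR ≠ 0 := (sub_pos.2 h).ne'
  simp only [hll, map_add, map_sub, map_smul, smul_eq_mul]
  field_simp
  ring

theorem mag_right_sub_hllB (h : S.SL d wL wR < S.SR d wL wR) :
    mag wR d - S.hllB d wL wR
      = S.SR d wL wR / (S.SR d wL wR - S.SL d wL wR) * (mag wR d - mag wL d) := by
  have hne : S.SR d wL wR - S.SL d wL wR ≠ 0 := (sub_pos.2 h).ne'
  rw [hllB]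
  field_simp
  ring

theorem mag_left_sub_hllB (h : S.SL d wL wR < S.SR d wL wR) :
    mag wL d - S.hllB d wL wR
      = -(-S.SL d wL wR / (S.SR d wL wR - S.SL d wL wR) * (mag wR d - mag wL d)) := by
  have hne : S.SR d wL wR - S.SL d wL wR ≠ 0 := (sub_pos.2 h).ne'
  rw [hllB]
  field_simp
  ring

variable {φ : State →ₗ[ℝ] ℝ} {c κ : ℝ}

theorem le_hll_sub_gp_right (hsp : PPSpeeds S.γ S.SL S.SR) (hφ : IsPositivityForm S.γ φ c κ)
    (hL : Admissible S.γ wL) (hR : Admissible S.γ wR) :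
    φ (flux S.γ d wR) - (S.SR d wL wR + S.SR d wL wR / (S.SR d wL wR - S.SL d wL wR)
        * (|mag wR d - mag wL d| / √(rho wR))) * (φ wR + c)
      ≤ φ (S.hll d wL wR) - (mag wR d - S.hllB d wL wR) * φ (gpS wR) := by
  obtain ⟨-, hSR, hlt, hSL_le, hle_SR⟩ := hsp d wL wR hL hR
  rw [S.hll_eq_flux_right hlt, S.mag_right_sub_hllB hlt]
  have hpos : 0 < S.SR d wL wR - S.SL d wL wR := sub_pos.2 hlt
  set r := S.SR d wL wR / (S.SR d wL wR - S.SL d wL wR) with hr_def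
  have hr : 0 ≤ r := div_nonneg hSR hpos.le
  have hrc : r * ((S.SR d wL wR - S.SL d wL wR) * c) = S.SR d wL wR * c := by
    rw [hr_def]; field_simp
  have hsplit := mul_nonneg hr (hφ.split d wR wL _ _ hR hL hle_SR hSL_le)
  have hgp := mul_le_of_abs_le (x := mag wR d - mag wL d) hr (hφ.gp wR hR)
  linarith

theorem le_neg_hll_add_gp_left (hsp : PPSpeeds S.γ S.SL S.SR) (hφ : IsPositivityForm S.γ φ c κ)
    (hL : Admissible S.γ wL) (hR : Admissible S.γ wR) :
    -φ (flux S.γ d wL) - (-S.SL d wL wR + -S.SL d wL wR / (S.SR d wL wR - S.SL d wL wR)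
        * (|mag wR d - mag wL d| / √(rho wL))) * (φ wL + c)
      ≤ -φ (S.hll d wL wR) + (mag wL d - S.hllB d wL wR) * φ (gpS wL) := by
  obtain ⟨hSL, -, hlt, hSL_le, hle_SR⟩ := hsp d wL wR hL hR
  rw [S.hll_eq_flux_left hlt, S.mag_left_sub_hllB hlt]
  have hpos : 0 < S.SR d wL wR - S.SL d wL wR := sub_pos.2 hlt
  set r := -S.SL d wL wR / (S.SR d wL wR - S.SL d wL wR) with hr_def
  have hr : 0 ≤ r := div_nonneg (neg_nonneg.2 hSL) hpos.le
  have hrc : r * ((S.SR d wL wR - S.SL d wL wR) * c) = -S.SL d wL wR * c := by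
    rw [hr_def]; field_simp
  have hsplit := mul_nonneg hr (hφ.split d wR wL _ _ hR hL hle_SR hSL_le)
  have hgp := mul_le_of_abs_le (x := mag wR d - mag wL d) hr (hφ.gp wL hL)
  linarith

end Interface

-- The interface terms leave `φ (f (v₀)) - φ (f (v_k))`, which is bounded by the splitting of the
-- pair `(v_k, v₀)`.
theorem le_lineBoundary (hk : 1 ≤ k) (hsp : PPSpeeds S.γ S.SL S.SR) {φ : State →ₗ[ℝ] ℝ}
    {c κ : ℝ} (hφ : IsPositivityForm S.γ φ c κ) (d : Fin 3) {u : Fin (k + 1) → State}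
    (hu : ∀ α, Admissible S.γ (u α)) {eL eR : State} (hL : Admissible S.γ eL)
    (hR : Admissible S.γ eR) :
    -(∑ α, S.nodeSpeed d u eL eR α * (φ (u α) + c))
        - (mag (u (Fin.last k)) d - mag (u 0) d) * κ
      ≤ φ (S.lineBoundary d u eL eR) := by
  rw [sum_eq_zero_add_last hk fun i h0 hlast => by simp [nodeSpeed, h0, hlast]]
  simp only [nodeSpeed, if_true, if_neg (zero_ne_last hk).symm, lineBoundary]
  have hleft := S.le_hll_sub_gp_right (d := d) hsp hφ hL (hu 0)
  have hright := S.le_neg_hll_add_gp_left (d := d) hsp hφ (hu (Fin.last k)) hR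
  have hsplit := hφ.split d (u (Fin.last k)) (u 0) _ _ (hu _) (hu 0) le_rfl le_rfl
  simp only [map_add, map_sub, map_smul, smul_eq_mul] at hsplit ⊢
  linarith

end Disc

end Line

/-! ### Evolution of the cell averages -/

theorem Grid1.h_pos (G : Grid1) : 0 < G.h :=
  div_pos (sub_pos.2 G.a_lt_b) (Nat.cast_pos.2 G.N_pos)

theorem Grid.hx_pos (G : Grid) : 0 < G.hx :=
  div_pos (sub_pos.2 G.a_lt_b) (Nat.cast_pos.2 G.Nx_pos)

theorem Grid.hy_pos (G : Grid) : 0 < G.hy :=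
  div_pos (sub_pos.2 G.c_lt_d) (Nat.cast_pos.2 G.Ny_pos)

theorem smul_sum_sum_eq_sum_lines {ι M : Type*} [Fintype ι] [AddCommGroup M] [Module ℝ M]
    (ω : ι → ℝ) {hx hy : ℝ} (hhx : hx ≠ 0) (hhy : hy ≠ 0) (F H : ι → ι → M) :
    (hx * hy / 4) • ∑ α, ∑ β, (ω α * ω β) • ((2 / hx) • F α β + (2 / hy) • H α β)
      = hy • ∑ β, (ω β / 2) • ∑ α, ω α • F α β
        + hx • ∑ α, (ω α / 2) • ∑ β, ω β • H α β := by
  simp only [Finset.smul_sum, smul_smul]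
  rw [Finset.sum_comm (γ := ι) (f := fun β α => _ • F α β)]
  simp only [← Finset.sum_add_distrib, smul_add, smul_smul]
  refine Finset.sum_congr rfl fun α _ => Finset.sum_congr rfl fun β _ => ?_
  congr 2 <;> field_simp <;> ring

namespace Disc

variable {k : ℕ} (S : Disc k)

section OneDimensional

variable {G : Grid1}

theorem vol1_eq (u : Fin (k + 1) → State) :
    S.vol1 u = ∑ α, (S.X.weight α * ∑ β, S.X.diff α β * mag (u β) 0) • gpS (u α) := by
  refine Finset.sum_congr rfl fun α _ => ?_
  rw [← Finset.sum_smul, Finset.mul_sum]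
  simp only [mul_assoc]

theorem h_smul_avg1_L1 (hk : 1 ≤ k) (hfS : IsTwoPointFlux S.γ S.fS)
    (bc : Sol1 k G → State × State) {w : Sol1 k G} (hw : ∀ i α, Admissible S.γ (w i α))
    (i : Fin G.N) :
    G.h • S.avg1 (S.L1 bc w i)
      = S.lineBoundary 0 (w i) (extL1 (bc w) w i) (extR1 (bc w) w i) - S.vol1 (w i) := by
  rw [vol1_eq, ← S.sum_weight_lineRes hk hfS 0 (w i) (hw i), avg1, smul_smul, Finset.smul_sum]
  refine Finset.sum_congr rfl fun α _ => ?_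
  have hh := G.h_pos.ne'
  rw [L1, smul_smul, smul_smul]
  congr 1
  field_simp

theorem hasDerivAt_avg1 {u : ℝ → Fin (k + 1) → State} {u' : Fin (k + 1) → State} {t : ℝ}
    (h : ∀ α, HasDerivAt (fun s => u s α) (u' α) t) :
    HasDerivAt (fun s => S.avg1 (u s)) (S.avg1 u') t :=
  (HasDerivAt.fun_sum fun α _ => (h α).const_smul (S.X.weight α)).const_smul (1 / 2 : ℝ)

theorem avg1_evolution (hk : 1 ≤ k) (hfS : IsTwoPointFlux S.γ S.fS)
    (bc : Sol1 k G → State × State) (w : ℝ → Sol1 k G) (t : ℝ)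
    (hw : ∀ i α, Admissible S.γ (w t i α))
    (hderiv : ∀ i α, HasDerivAt (fun s => w s i α) (S.L1 bc (w t) i α) t) (i : Fin G.N) :
    ∃ d, HasDerivAt (fun s => S.avg1 (w s i)) d t ∧ G.h • d + S.vol1 (w t i)
      = S.lineBoundary 0 (w t i) (extL1 (bc (w t)) (w t) i) (extR1 (bc (w t)) (w t) i) :=
  ⟨_, S.hasDerivAt_avg1 (hderiv i), by rw [S.h_smul_avg1_L1 hk hfS bc hw, sub_add_cancel]⟩

end OneDimensional

section TwoDimensional

variable {G : Grid}

theorem volumeTerm_eq_sum_lines (w : Sol k G) (i : Fin G.Nx) (j : Fin G.Ny) :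
    S.volumeTerm w i j
      = G.hy • ∑ β, (S.X.weight β / 2) • ∑ α,
          (S.X.weight α * ∑ p, S.X.diff α p * mag (w i j p β) 0) • gpS (w i j α β)
        + G.hx • ∑ α, (S.X.weight α / 2) • ∑ β,
          (S.X.weight β * ∑ q, S.X.diff β q * mag (w i j α q) 1) • gpS (w i j α β) := by
  have h := smul_sum_sum_eq_sum_lines S.X.weight G.hx_pos.ne' G.hy_pos.ne'
    (fun α β => (∑ p, S.X.diff α p * mag (w i j p β) 0) • gpS (w i j α β))
    (fun α β => (∑ q, S.X.diff β q * mag (w i j α q) 1) • gpS (w i j α β))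
  simpa only [volumeTerm, discDiv, smul_smul, ← add_smul] using h

theorem h_smul_avg_L (hk : 1 ≤ k) (hfS : IsTwoPointFlux S.γ S.fS) (bc : Sol k G → Ghost k G)
    {w : Sol k G} (hw : NodallyAdmissible S.γ w) (i : Fin G.Nx) (j : Fin G.Ny) :
    (G.hx * G.hy) • S.avg (S.L bc w i j) = S.boundaryTerm bc w i j - S.volumeTerm w i j := by
  have hx_lines (β : Fin (k + 1)) := S.sum_weight_lineRes hk hfS 0 (fun p => w i j p β)
    (fun p => hw i j p β) (extLeft (bc w) w i j β) (extRight (bc w) w i j β)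
  have hy_lines (α : Fin (k + 1)) := S.sum_weight_lineRes hk hfS 1 (fun q => w i j α q)
    (fun q => hw i j α q) (extBottom (bc w) w i j α) (extTop (bc w) w i j α)
  have hsum := smul_sum_sum_eq_sum_lines S.X.weight G.hx_pos.ne' G.hy_pos.ne'
    (fun α β => S.lineRes 0 (fun p => w i j p β) (extLeft (bc w) w i j β)
      (extRight (bc w) w i j β) α)
    (fun α β => S.lineRes 1 (fun q => w i j α q) (extBottom (bc w) w i j α)
      (extTop (bc w) w i j α) β)
  simp only [hx_lines, hy_lines] at hsum
  rw [avg, smul_smul, mul_one_div]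
  refine hsum.trans ?_
  simp only [S.volumeTerm_eq_sum_lines, boundaryTerm, smul_sub, Finset.sum_sub_distrib]
  abel

theorem hasDerivAt_avg {c : ℝ → CellSol k} {c' : CellSol k} {t : ℝ}
    (h : ∀ α β, HasDerivAt (fun s => c s α β) (c' α β) t) :
    HasDerivAt (fun s => S.avg (c s)) (S.avg c') t :=
  (HasDerivAt.fun_sum fun α _ => HasDerivAt.fun_sum fun β _ =>
    (h α β).const_smul (S.X.weight α * S.X.weight β)).const_smul (1 / 4 : ℝ)

theorem avg_evolution (hk : 1 ≤ k) (hfS : IsTwoPointFlux S.γ S.fS)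
    (bc : Sol k G → Ghost k G) (w : ℝ → Sol k G) (t : ℝ) (hw : NodallyAdmissible S.γ (w t))
    (hderiv : ∀ i j α β, HasDerivAt (fun s => w s i j α β) (S.L bc (w t) i j α β) t)
    (i : Fin G.Nx) (j : Fin G.Ny) :
    ∃ d, HasDerivAt (fun s => S.avg (w s i j)) d t ∧
      (G.hx * G.hy) • d + S.volumeTerm (w t) i j = S.boundaryTerm bc (w t) i j :=
  ⟨_, S.hasDerivAt_avg (hderiv i j), by rw [S.h_smul_avg_L hk hfS bc hw, sub_add_cancel]⟩

end TwoDimensional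

end Disc

/-! ### The divergence of the interpolated magnetic field -/

theorem add_half_mul_sub_div_half {h : ℝ} (hh : h ≠ 0) (c ξ : ℝ) :
    (c + h / 2 * ξ - c) / (h / 2) = ξ := by
  rw [add_sub_cancel_left, mul_div_cancel_left₀ _ (div_ne_zero hh two_ne_zero)]

theorem add_half_mul_mem_Icc {h ξ : ℝ} (hh : 0 ≤ h) (hξ : ξ ∈ Set.Icc (-1) 1) (c : ℝ) :
    c + h / 2 * ξ ∈ Set.Icc (c - h / 2) (c + h / 2) := by
  constructor <;> nlinarith [hξ.1, hξ.2]

theorem hasDerivAt_eval_sub_div_half (p : Polynomial ℝ) (c h x : ℝ) :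
    HasDerivAt (fun x => p.eval ((x - c) / (h / 2)))
      (2 / h * (Polynomial.derivative p).eval ((x - c) / (h / 2))) x := by
  refine (HasDerivAt.comp x (p.hasDerivAt _)
    (((hasDerivAt_id x).sub_const c).div_const (h / 2))).congr_deriv ?_
  rw [one_div_div, mul_comm, id]

theorem eval_aeval_X {σ R : Type*} [CommSemiring R] (i : σ) (p : Polynomial R) (z : σ → R) :
    MvPolynomial.eval z (Polynomial.aeval (MvPolynomial.X i : MvPolynomial σ R) p)
      = p.eval (z i) := by
  rw [← MvPolynomial.coe_aeval_eq_eval, RingHom.coe_coe, ← Polynomial.aeval_algHom_apply,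
    MvPolynomial.aeval_X, Polynomial.coe_aeval_eq_eval]

namespace Disc

variable {k : ℕ} (S : Disc k)

section OneDimensional

variable {G : Grid1} {w : Sol1 k G}

theorem deriv_magFun1_node (w : Sol1 k G) (i : Fin G.N) (α : Fin (k + 1)) :
    deriv (S.magFun1 w i) (G.ctr i + G.h / 2 * S.X.node α)
      = 2 / G.h * ∑ β, S.X.diff α β * mag (w i β) 0 := by
  have hderiv : HasDerivAt (S.magFun1 w i) _ (G.ctr i + G.h / 2 * S.X.node α) :=
    HasDerivAt.fun_sum fun β _ =>
      (hasDerivAt_eval_sub_div_half (S.X.basis β) (G.ctr i) G.h _).const_mul (mag (w i β) 0)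
  rw [hderiv.deriv, add_half_mul_sub_div_half G.h_pos.ne', Finset.mul_sum]
  refine Finset.sum_congr rfl fun β _ => ?_
  rw [LGLNodes.diff]
  ring

theorem sum_diff_mag_eq_zero (hk : 1 ≤ k) (h : S.LDF1 w) (i : Fin G.N) (α : Fin (k + 1)) :
    ∑ β, S.X.diff α β * mag (w i β) 0 = 0 := by
  have hderiv := h i _ (add_half_mul_mem_Icc G.h_pos.le (S.X.node_mem_Icc hk α) (G.ctr i))
  rw [deriv_magFun1_node] at hderiv
  exact (mul_eq_zero.1 hderiv).resolve_left (div_pos two_pos G.h_pos).ne'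

theorem vol1_eq_zero (hk : 1 ≤ k) (h : S.LDF1 w) (i : Fin G.N) : S.vol1 (w i) = 0 := by
  simp [vol1_eq, S.sum_diff_mag_eq_zero hk h]

end OneDimensional

theorem sum_weight_mul_sum_diff (hk : 1 ≤ k) (f : Fin (k + 1) → ℝ) :
    ∑ α, S.X.weight α * ∑ p, S.X.diff α p * f p = f (Fin.last k) - f 0 := by
  simp only [← sum_tau_smul hk, Finset.mul_sum, smul_eq_mul]
  rw [Finset.sum_comm]
  refine Finset.sum_congr rfl fun p _ => ?_
  rw [← S.X.sum_weight_diff hk p, Finset.sum_mul]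
  simp only [mul_assoc]

/-- The interpolation operator `refInterp` as a linear map. -/
def refInterpLin : (Fin (k + 1) → Fin (k + 1) → ℝ) →ₗ[ℝ] MvPolynomial (Fin 2) ℝ where
  toFun := S.refInterp
  map_add' b b' := by simp [refInterp, add_mul, Finset.sum_add_distrib]
  map_smul' c b := by simp [refInterp, MvPolynomial.smul_eq_C_mul, Finset.mul_sum, mul_assoc]

theorem refInterp_const_mul (c : ℝ) (b : Fin (k + 1) → Fin (k + 1) → ℝ) :
    S.refInterp (fun α β => c * b α β) = c • S.refInterp b :=
  S.refInterpLin.map_smul c b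

theorem refInterp_const (c : ℝ) : S.refInterp (fun _ _ => c) = MvPolynomial.C c := by
  simp [refInterp, ← Finset.mul_sum, ← map_sum, S.X.sum_basis]

theorem refInterp_lineMap (c θ : ℝ) (b : Fin (k + 1) → Fin (k + 1) → ℝ) :
    S.refInterp (fun α β => c + θ * (b α β - c))
      = MvPolynomial.C c + θ • (S.refInterp b - MvPolynomial.C c) := by
  rw [← S.refInterp_const c]
  exact (S.refInterpLin.map_add _ _).trans (congrArg _ ((S.refInterpLin.map_smul θ _).trans
    (congrArg _ (S.refInterpLin.map_sub b _))))

section Eval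

variable (b : Fin (k + 1) → Fin (k + 1) → ℝ) (x y : ℝ)

theorem eval_refInterp :
    MvPolynomial.eval ![x, y] (S.refInterp b)
      = ∑ α, ∑ β, b α β * ((S.X.basis α).eval x * (S.X.basis β).eval y) := by
  simp [refInterp, eval_aeval_X]

theorem eval_refInterp_node (α β : Fin (k + 1)) :
    MvPolynomial.eval ![S.X.node α, S.X.node β] (S.refInterp b) = b α β := by
  simp [eval_refInterp, S.X.eval_basis]

theorem eval_pderiv_zero_refInterp :
    MvPolynomial.eval ![x, y] (MvPolynomial.pderiv 0 (S.refInterp b))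
      = ∑ α, ∑ β, b α β *
        ((Polynomial.derivative (S.X.basis α)).eval x * (S.X.basis β).eval y) := by
  simp [refInterp, Derivation.map_aeval, eval_aeval_X, MvPolynomial.pderiv_X, mul_comm]

theorem eval_pderiv_one_refInterp :
    MvPolynomial.eval ![x, y] (MvPolynomial.pderiv 1 (S.refInterp b))
      = ∑ α, ∑ β, b α β *
        ((S.X.basis α).eval x * (Polynomial.derivative (S.X.basis β)).eval y) := by
  simp [refInterp, Derivation.map_aeval, eval_aeval_X, MvPolynomial.pderiv_X]

end Eval

section TwoDimensional

variable {G : Grid}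

theorem divB_eq_eval_pderiv (w : Sol k G) (i : Fin G.Nx) (j : Fin G.Ny) (x y : ℝ) :
    S.divB w i j x y =
      2 / G.hx * MvPolynomial.eval ![(x - G.xc i) / (G.hx / 2), (y - G.yc j) / (G.hy / 2)]
          (MvPolynomial.pderiv 0 (S.refInterp fun α β => mag (w i j α β) 0))
        + 2 / G.hy * MvPolynomial.eval ![(x - G.xc i) / (G.hx / 2), (y - G.yc j) / (G.hy / 2)]
          (MvPolynomial.pderiv 1 (S.refInterp fun α β => mag (w i j α β) 1)) := by
  have hderiv_x := HasDerivAt.fun_sum (u := Finset.univ) fun α _ =>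
    HasDerivAt.fun_sum (u := Finset.univ) fun β _ =>
      ((hasDerivAt_eval_sub_div_half (S.X.basis α) (G.xc i) G.hx x).mul_const
        ((S.X.basis β).eval ((y - G.yc j) / (G.hy / 2)))).const_mul (mag (w i j α β) 0)
  have hderiv_y := HasDerivAt.fun_sum (u := Finset.univ) fun α _ =>
    HasDerivAt.fun_sum (u := Finset.univ) fun β _ =>
      ((hasDerivAt_eval_sub_div_half (S.X.basis β) (G.yc j) G.hy y).const_mul
        ((S.X.basis α).eval ((x - G.xc i) / (G.hx / 2)))).const_mul (mag (w i j α β) 1)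
  simp only [divB, magFun, eval_refInterp, hderiv_x.deriv, hderiv_y.deriv,
    eval_pderiv_zero_refInterp, eval_pderiv_one_refInterp, Finset.mul_sum]
  congr 1 <;> exact Finset.sum_congr rfl fun α _ => Finset.sum_congr rfl fun β _ => by ring

theorem divB_eq_refDiv (w : Sol k G) (i : Fin G.Nx) (j : Fin G.Ny) (x y : ℝ) :
    S.divB w i j x y = 4 / (G.hx * G.hy) *
      MvPolynomial.eval ![(x - G.xc i) / (G.hx / 2), (y - G.yc j) / (G.hy / 2)]
        (refDiv (S.piola w i j)) := by
  have hx := G.hx_pos.ne'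
  have hy := G.hy_pos.ne'
  simp only [divB_eq_eval_pderiv, refDiv, piola, Matrix.cons_val_zero, Matrix.cons_val_one,
    refInterp_const_mul, map_add, Derivation.map_smul, MvPolynomial.smul_eval]
  field_simp
  ring

theorem discDiv_eq_divB (w : Sol k G) (i : Fin G.Nx) (j : Fin G.Ny) (α β : Fin (k + 1)) :
    S.discDiv w i j α β =
      S.divB w i j (G.xc i + G.hx / 2 * S.X.node α) (G.yc j + G.hy / 2 * S.X.node β) := by
  rw [divB_eq_eval_pderiv, add_half_mul_sub_div_half G.hx_pos.ne',
    add_half_mul_sub_div_half G.hy_pos.ne', eval_pderiv_zero_refInterp, eval_pderiv_one_refInterp]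
  simp [discDiv, S.X.eval_basis, LGLNodes.diff, mul_comm (mag _ _)]

theorem discDiv_eq_zero (hk : 1 ≤ k) {w : Sol k G} (h : S.LDF w) (i : Fin G.Nx) (j : Fin G.Ny)
    (α β : Fin (k + 1)) : S.discDiv w i j α β = 0 := by
  rw [discDiv_eq_divB]
  exact h i j _ _ ⟨add_half_mul_mem_Icc G.hx_pos.le (S.X.node_mem_Icc hk α) _,
    add_half_mul_mem_Icc G.hy_pos.le (S.X.node_mem_Icc hk β) _⟩

theorem volumeTerm_eq_zero (hk : 1 ≤ k) {w : Sol k G} (h : S.LDF w) (i : Fin G.Nx)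
    (j : Fin G.Ny) : S.volumeTerm w i j = 0 := by
  simp [volumeTerm, S.discDiv_eq_zero hk h]

theorem net_magnetic_flux_eq_zero (hk : 1 ≤ k) {w : Sol k G} (h : S.LDF w) (i : Fin G.Nx)
    (j : Fin G.Ny) :
    G.hy * ∑ β, S.X.weight β / 2 * (mag (w i j (Fin.last k) β) 0 - mag (w i j 0 β) 0)
      + G.hx * ∑ α, S.X.weight α / 2 * (mag (w i j α (Fin.last k)) 1 - mag (w i j α 0) 1)
      = 0 := by
  have hsum := smul_sum_sum_eq_sum_lines S.X.weight G.hx_pos.ne' G.hy_pos.ne'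
    (fun α β => ∑ p, S.X.diff α p * mag (w i j p β) 0)
    (fun α β => ∑ q, S.X.diff β q * mag (w i j α q) 1)
  have hx_lines (β : Fin (k + 1)) := S.sum_weight_mul_sum_diff hk fun p => mag (w i j p β) 0
  have hy_lines (α : Fin (k + 1)) := S.sum_weight_mul_sum_diff hk fun q => mag (w i j α q) 1
  have hdiv := S.discDiv_eq_zero hk h i j
  simp only [discDiv] at hdiv
  simpa [hx_lines, hy_lines, hdiv] using hsum.symm

theorem divB_of_scaled {w w' : Sol k G} {i : Fin G.Nx} {j : Fin G.Ny} {θ : ℝ}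
    (c : Fin 3 → ℝ) (h : ∀ α β, mag (w' i j α β) = c + θ • (mag (w i j α β) - c)) (x y : ℝ) :
    S.divB w' i j x y = θ * S.divB w i j x y := by
  simp only [divB_eq_eval_pderiv, h, Pi.add_apply, Pi.smul_apply, Pi.sub_apply, smul_eq_mul,
    refInterp_lineMap, map_add, Derivation.map_smul, map_sub, MvPolynomial.pderiv_C, sub_zero,
    zero_add, MvPolynomial.smul_eval]
  ring

theorem LDF_of_scaled {w w' : Sol k G} (hw : S.LDF w) (θ : Fin G.Nx → Fin G.Ny → ℝ)
    (c : Fin G.Nx → Fin G.Ny → Fin 3 → ℝ)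
    (h : ∀ i j α β, mag (w' i j α β) = c i j + θ i j • (mag (w i j α β) - c i j)) :
    S.LDF w' := by
  intro i j x y hxy
  rw [S.divB_of_scaled (c i j) (h i j), hw i j x y hxy, mul_zero]

end TwoDimensional

end Disc

/-! ### Polynomial spaces on the reference element -/

section PolynomialSpaces

open MvPolynomial

variable {a b k : ℕ}

theorem X_pow_mul_X_pow_mem_QSpace {m n : ℕ} (hm : m ≤ a) (hn : n ≤ b) :
    (X 0 ^ m * X 1 ^ n : MvPolynomial (Fin 2) ℝ) ∈ QSpace a b := by
  rw [X_pow_eq_monomial, X_pow_eq_monomial, monomial_mul, QSpace, monomial_mem_restrictSupport]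
  exact Or.inl (by simpa using ⟨hm, hn⟩)

theorem aeval_mul_aeval_mem_QSpace {p q : Polynomial ℝ} (hp : p.natDegree ≤ a)
    (hq : q.natDegree ≤ b) :
    (Polynomial.aeval (X 0) p * Polynomial.aeval (X 1) q : MvPolynomial (Fin 2) ℝ)
      ∈ QSpace a b := by
  rw [Polynomial.aeval_eq_sum_range, Polynomial.aeval_eq_sum_range, Finset.sum_mul_sum]
  refine Submodule.sum_mem _ fun m hm => Submodule.sum_mem _ fun n hn => ?_
  rw [smul_mul_smul_comm]
  exact Submodule.smul_mem _ _ (X_pow_mul_X_pow_mem_QSpace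
    ((Finset.mem_range_succ_iff.1 hm).trans hp) ((Finset.mem_range_succ_iff.1 hn).trans hq))

theorem QSpace_mono {a' b' : ℕ} (ha : a ≤ a') (hb : b ≤ b') : QSpace a b ≤ QSpace a' b' :=
  restrictSupport_mono _ fun _ h => ⟨h.1.trans ha, h.2.trans hb⟩

theorem MSpace_le_QSpace (k : ℕ) : MSpace k ≤ QSpace k k :=
  sup_le (QSpace_mono (Nat.sub_le _ _) le_rfl) (QSpace_mono le_rfl (Nat.sub_le _ _))

instance finiteDimensional_QSpace : FiniteDimensional ℝ (QSpace a b) := by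
  have hfin : {n : Fin 2 →₀ ℕ | n 0 ≤ a ∧ n 1 ≤ b}.Finite := by
    refine (Set.finite_Iic (Finsupp.equivFunOnFinite.symm ![a, b])).subset fun n hn i => ?_
    fin_cases i
    exacts [hn.1, hn.2]
  have := hfin.to_subtype
  exact Module.Finite.of_basis (basisRestrictSupport ℝ _)

instance finiteDimensional_MSpace : FiniteDimensional ℝ (MSpace k) :=
  Submodule.finiteDimensional_of_le (MSpace_le_QSpace k)

theorem pderiv_mem_restrictSupport {σ R : Type*} [CommSemiring R] {s t : Set (σ →₀ ℕ)} {i : σ}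
    (h : ∀ n ∈ s, n i ≠ 0 → n - Finsupp.single i 1 ∈ t) {P : MvPolynomial σ R}
    (hP : P ∈ restrictSupport R s) : pderiv i P ∈ restrictSupport R t := by
  rw [P.as_sum, map_sum]
  refine Submodule.sum_mem _ fun n hn => ?_
  rw [pderiv_monomial, monomial_mem_restrictSupport]
  by_cases hni : n i = 0
  · simp [hni]
  · exact Or.inl (h n (hP hn) hni)

theorem refDiv_mem_MSpace {v : Fin 2 → MvPolynomial (Fin 2) ℝ} (hv : ∀ m, v m ∈ QSpace k k) :
    refDiv v ∈ MSpace k := by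
  refine Submodule.add_mem_sup (pderiv_mem_restrictSupport (fun n hn _ => ?_) (hv 0))
    (pderiv_mem_restrictSupport (fun n hn _ => ?_) (hv 1))
  · exact ⟨by simpa using Nat.sub_le_sub_right hn.1 1, by simpa using hn.2⟩
  · exact ⟨by simpa using hn.1, by simpa using Nat.sub_le_sub_right hn.2 1⟩

end PolynomialSpaces

section ReferenceIntegral

open MvPolynomial

variable (P Q : MvPolynomial (Fin 2) ℝ)

theorem continuous_eval_prod : Continuous fun z : ℝ × ℝ => eval ![z.1, z.2] P :=
  (continuous_eval P).comp (by fun_prop)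

theorem continuous_eval_right (x : ℝ) : Continuous fun y : ℝ => eval ![x, y] P :=
  (continuous_eval P).comp (by fun_prop : Continuous fun y : ℝ => ![x, y])

theorem continuous_integral_eval_right :
    Continuous fun x : ℝ => ∫ y in (-1 : ℝ)..1, eval ![x, y] P :=
  intervalIntegral.continuous_parametric_intervalIntegral_of_continuous'
    (continuous_eval_prod P) (-1) 1

theorem refInt_add : refInt (P + Q) = refInt P + refInt Q := by
  simp only [refInt, map_add]
  rw [← intervalIntegral.integral_add
    ((continuous_integral_eval_right P).intervalIntegrable _ _)
    ((continuous_integral_eval_right Q).intervalIntegrable _ _)]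
  exact intervalIntegral.integral_congr fun x _ => intervalIntegral.integral_add
    ((continuous_eval_right P x).intervalIntegrable _ _)
    ((continuous_eval_right Q x).intervalIntegrable _ _)

theorem refInt_smul (c : ℝ) : refInt (c • P) = c * refInt P := by
  simp only [refInt, smul_eval, intervalIntegral.integral_const_mul]

/-- The integral `refInt` over the reference element as a linear map. -/
def refIntLin : MvPolynomial (Fin 2) ℝ →ₗ[ℝ] ℝ where
  toFun := refInt
  map_add' := refInt_add
  map_smul' c P := refInt_smul P c

theorem refIntLin_apply : refIntLin P = refInt P := rfl

theorem refInt_aeval_mul_aeval (p q : Polynomial ℝ) :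
    refInt (Polynomial.aeval (X 0) p * Polynomial.aeval (X 1) q)
      = (∫ x in (-1 : ℝ)..1, p.eval x) * ∫ y in (-1 : ℝ)..1, q.eval y := by
  simp only [refInt, map_mul, eval_aeval_X, Matrix.cons_val_zero, Matrix.cons_val_one,
    intervalIntegral.integral_const_mul, intervalIntegral.integral_mul_const]

theorem refInt_mul_self_nonneg : 0 ≤ refInt (P * P) :=
  intervalIntegral.integral_nonneg (by norm_num) fun x _ =>
    intervalIntegral.integral_nonneg (by norm_num) fun y _ => by
      rw [map_mul]
      exact mul_self_nonneg _

variable {P}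

theorem refInt_mul_self_pos {x y : ℝ} (hx : x ∈ Set.Icc (-1 : ℝ) 1)
    (hy : y ∈ Set.Icc (-1 : ℝ) 1) (h : eval ![x, y] P ≠ 0) : 0 < refInt (P * P) := by
  have hnonneg (x y : ℝ) : 0 ≤ eval ![x, y] (P * P) := by
    rw [map_mul]
    exact mul_self_nonneg _
  refine intervalIntegral.integral_pos (by norm_num)
    (continuous_integral_eval_right (P * P)).continuousOn
    (fun x _ => intervalIntegral.integral_nonneg (by norm_num) fun y _ => hnonneg x y)
    ⟨x, hx, ?_⟩
  refine intervalIntegral.integral_pos (by norm_num)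
    (continuous_eval_right (P * P) x).continuousOn (fun y _ => hnonneg x y) ⟨y, hy, ?_⟩
  rw [map_mul]
  exact mul_self_pos.2 h

theorem eq_zero_of_refInt_mul_self (h : refInt (P * P) = 0) : P = 0 := by
  refine funext_set (fun _ => Set.Icc (-1) 1) (fun _ => Set.Icc_infinite (by norm_num))
    fun z hz => ?_
  by_contra hne
  have hz_eq : z = ![z 0, z 1] := by
    ext i
    fin_cases i <;> rfl
  rw [map_zero, hz_eq] at hne
  exact (refInt_mul_self_pos (hz 0 trivial) (hz 1 trivial) hne).ne' h

theorem eq_zero_of_refInt_sum_mul_self {v : Fin 2 → MvPolynomial (Fin 2) ℝ}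
    (h : refInt (∑ m, v m * v m) = 0) : v = 0 := by
  rw [← refIntLin_apply, map_sum] at h
  have hzero := (Finset.sum_eq_zero_iff_of_nonneg fun m _ => refInt_mul_self_nonneg (v m)).1 h
  exact funext fun m => eq_zero_of_refInt_mul_self (hzero m (Finset.mem_univ m))

end ReferenceIntegral

/-! ### Saddle point problems -/

section SaddlePoint

variable {K U V : Type*} [Field K] [AddCommGroup U] [Module K U] [FiniteDimensional K U]
  [AddCommGroup V] [Module K V] [FiniteDimensional K V]

theorem surjective_of_anisotropic {a : U →ₗ[K] U →ₗ[K] K} (ha : ∀ u, a u u = 0 → u = 0) :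
    Function.Surjective a := by
  refine (LinearMap.injective_iff_surjective_of_finrank_eq_finrank
    (Subspace.dual_finrank_eq (K := K) (V := U)).symm).1 ?_
  refine (injective_iff_map_eq_zero a).2 fun u hu => ha u ?_
  rw [hu, LinearMap.zero_apply]

theorem exists_saddle_point {a : U →ₗ[K] U →ₗ[K] K} {c : V →ₗ[K] V →ₗ[K] K}
    (ha : ∀ u, a u u = 0 → u = 0) (hc : ∀ p, c p p = 0 → p = 0) (D : U →ₗ[K] V)
    (l : U →ₗ[K] K) : ∃ u p, D u = 0 ∧ ∀ v, a u v + c p (D v) = l v := by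
  obtain ⟨u, hu⟩ := surjective_of_anisotropic
    (a := a.compl₁₂ (LinearMap.ker D).subtype (LinearMap.ker D).subtype)
    (fun u hu => Subtype.ext (ha u hu)) (l ∘ₗ (LinearMap.ker D).subtype)
  have hresidual : l - a u ∈ (LinearMap.ker D).dualAnnihilator := by
    rw [Submodule.mem_dualAnnihilator]
    exact fun v hv => sub_eq_zero.2 (LinearMap.congr_fun hu ⟨v, hv⟩).symm
  rw [← LinearMap.range_dualMap_eq_dualAnnihilator_ker] at hresidual
  obtain ⟨ψ, hψ⟩ := hresidual
  obtain ⟨p, rfl⟩ := surjective_of_anisotropic hc ψ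
  exact ⟨u, p, u.2, fun v => add_comm (a u v) _ ▸ eq_sub_iff_add_eq.1 (LinearMap.congr_fun hψ v)⟩

end SaddlePoint

/-! ### The projection onto divergence-free fields on the reference element -/

section ReferenceProjection

open MvPolynomial

/-- The `L²` inner product of polynomials over the reference element. -/
def refForm : MvPolynomial (Fin 2) ℝ →ₗ[ℝ] MvPolynomial (Fin 2) ℝ →ₗ[ℝ] ℝ :=
  (LinearMap.mul ℝ (MvPolynomial (Fin 2) ℝ)).compr₂ refIntLin

theorem refForm_apply (P Q : MvPolynomial (Fin 2) ℝ) : refForm P Q = refInt (P * Q) := rfl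

/-- The `L²` inner product of vector fields in `Q^k(K)²`. -/
def fieldForm (k : ℕ) : (Fin 2 → QSpace k k) →ₗ[ℝ] (Fin 2 → QSpace k k) →ₗ[ℝ] ℝ :=
  ∑ m, refForm.compl₁₂ ((QSpace k k).subtype ∘ₗ LinearMap.proj m)
    ((QSpace k k).subtype ∘ₗ LinearMap.proj m)

theorem fieldForm_apply {k : ℕ} (u v : Fin 2 → QSpace k k) :
    fieldForm k u v = refInt (∑ m, (u m : MvPolynomial (Fin 2) ℝ) * v m) := by
  rw [← refIntLin_apply, map_sum]
  simp only [fieldForm, LinearMap.sum_apply]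
  rfl

/-- The divergence as a map from `Q^k(K)²` to the multiplier space. -/
def divLin (k : ℕ) : (Fin 2 → QSpace k k) →ₗ[ℝ] MSpace k :=
  LinearMap.codRestrict (MSpace k)
    ((pderiv 0).toLinearMap ∘ₗ (QSpace k k).subtype ∘ₗ LinearMap.proj 0
      + (pderiv 1).toLinearMap ∘ₗ (QSpace k k).subtype ∘ₗ LinearMap.proj 1)
    fun v => refDiv_mem_MSpace fun m => (v m).2

theorem coe_divLin {k : ℕ} (v : Fin 2 → QSpace k k) :
    (divLin k v : MvPolynomial (Fin 2) ℝ) = refDiv fun m => v m := rfl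

variable {k : ℕ} {B₀ B B' : Fin 2 → MvPolynomial (Fin 2) ℝ}

theorem exists_isRefLDFProjection (hB₀ : ∀ m, B₀ m ∈ QSpace k k) :
    ∃ B, IsRefLDFProjection k B₀ B := by
  obtain ⟨B, p, hdiv, hB⟩ := exists_saddle_point (a := fieldForm k)
    (c := refForm.compl₁₂ (MSpace k).subtype (MSpace k).subtype)
    (fun u hu => funext fun m => Subtype.ext (congrFun (eq_zero_of_refInt_sum_mul_self
      ((fieldForm_apply u u).symm.trans hu)) m))
    (fun p hp => Subtype.ext (eq_zero_of_refInt_mul_self hp))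
    (divLin k) (fieldForm k fun m => ⟨B₀ m, hB₀ m⟩)
  refine ⟨fun m => B m, fun m => (B m).2, p, p.2, fun v hv => ?_, fun q _ => ?_⟩
  · simpa only [fieldForm_apply, LinearMap.compl₁₂_apply, Submodule.subtype_apply, refForm_apply,
      coe_divLin] using hB fun m => ⟨v m, hv m⟩
  · rw [← coe_divLin, hdiv, Submodule.coe_zero, zero_mul, ← refIntLin_apply, map_zero]

theorem refDiv_eq_zero_of_isRefLDFProjection (h : IsRefLDFProjection k B₀ B) : refDiv B = 0 := by
  obtain ⟨hB, _, _, _, hdiv⟩ := h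
  exact eq_zero_of_refInt_mul_self (hdiv _ (refDiv_mem_MSpace hB))

theorem refInt_sum_mul_of_isRefLDFProjection (h : IsRefLDFProjection k B₀ B)
    {v : Fin 2 → MvPolynomial (Fin 2) ℝ} (hv : ∀ m, v m ∈ QSpace k k) (hdiv : refDiv v = 0) :
    refInt (∑ m, B m * v m) = refInt (∑ m, B₀ m * v m) := by
  obtain ⟨-, p, -, hB, -⟩ := h
  rw [← hB v hv, hdiv, mul_zero, ← refIntLin_apply 0, map_zero, add_zero]

theorem eq_of_isRefLDFProjection (h : IsRefLDFProjection k B₀ B)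
    (h' : IsRefLDFProjection k B₀ B') : B = B' := by
  have hsub : ∀ m, (B - B') m ∈ QSpace k k := fun m => Submodule.sub_mem _ (h.1 m) (h'.1 m)
  have hdiv : refDiv (B - B') = 0 := by
    have hlin : refDiv (B - B') = refDiv B - refDiv B' := by
      simp only [refDiv, Pi.sub_apply, map_sub]
      abel
    rw [hlin, refDiv_eq_zero_of_isRefLDFProjection h, refDiv_eq_zero_of_isRefLDFProjection h',
      sub_zero]
  refine sub_eq_zero.1 (eq_zero_of_refInt_sum_mul_self ?_)
  have hexpand : ∑ m, (B - B') m * (B - B') m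
      = ∑ m, B m * (B - B') m - ∑ m, B' m * (B - B') m := by
    simp only [← Finset.sum_sub_distrib, ← sub_mul, Pi.sub_apply]
  rw [hexpand, ← refIntLin_apply, map_sub, sub_eq_zero]
  exact (refInt_sum_mul_of_isRefLDFProjection h hsub hdiv).trans
    (refInt_sum_mul_of_isRefLDFProjection h' hsub hdiv).symm

theorem refInt_eq_of_isRefLDFProjection (h : IsRefLDFProjection k B₀ B) (m : Fin 2) :
    refInt (B m) = refInt (B₀ m) := by
  have hone : (1 : MvPolynomial (Fin 2) ℝ) ∈ QSpace k k := by
    simpa using X_pow_mul_X_pow_mem_QSpace (Nat.zero_le k) (Nat.zero_le k)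
  have hmem (n : Fin 2) : (Pi.single m 1 : Fin 2 → MvPolynomial (Fin 2) ℝ) n ∈ QSpace k k := by
    rw [Pi.single_apply]
    split_ifs
    exacts [hone, Submodule.zero_mem _]
  have hdiv : refDiv (Pi.single m 1 : Fin 2 → MvPolynomial (Fin 2) ℝ) = 0 := by
    fin_cases m <;> simp [refDiv]
  simpa [Pi.single_apply] using refInt_sum_mul_of_isRefLDFProjection h hmem hdiv

end ReferenceProjection

/-! ### The projection onto locally divergence-free fields -/

theorem state_ext {w z : State} (hrho : rho w = rho z) (hmom : mom w = mom z)
    (hmag : ∀ m, mag w m = mag z m) (hener : ener w = ener z) : w = z :=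
  Prod.ext hrho (Prod.ext hmom (Prod.ext (funext hmag) hener))

namespace Disc

section Interpolation

open MvPolynomial

variable {k : ℕ} (S : Disc k) (b : Fin (k + 1) → Fin (k + 1) → ℝ)

theorem refInterp_mem : S.refInterp b ∈ QSpace k k := by
  refine Submodule.sum_mem _ fun α _ => Submodule.sum_mem _ fun β _ => ?_
  rw [← smul_eq_C_mul]
  exact Submodule.smul_mem _ _ (aeval_mul_aeval_mem_QSpace (S.X.natDegree_basis α).le
    (S.X.natDegree_basis β).le)

theorem refInt_refInterp :
    refInt (S.refInterp b) = ∑ α, ∑ β, S.X.weight α * S.X.weight β * b α β := by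
  simp only [← refIntLin_apply, refInterp, map_sum, ← smul_eq_C_mul, map_smul, smul_eq_mul]
  simp only [refIntLin_apply, refInt_aeval_mul_aeval, mul_comm (b _ _)]
  rfl

theorem refInterp_eval_mul_eval {p q : Polynomial ℝ} (hp : p.natDegree ≤ k)
    (hq : q.natDegree ≤ k) :
    S.refInterp (fun α β => p.eval (S.X.node α) * q.eval (S.X.node β))
      = Polynomial.aeval (MvPolynomial.X 0) p * Polynomial.aeval (MvPolynomial.X 1) q := by
  conv_rhs => rw [S.X.eq_sum_basis hp, S.X.eq_sum_basis hq]
  simp only [refInterp, map_sum, map_mul, Polynomial.aeval_C, algebraMap_eq, Finset.sum_mul_sum]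
  exact Finset.sum_congr rfl fun α _ => Finset.sum_congr rfl fun β _ => mul_mul_mul_comm _ _ _ _

theorem refInterp_eval {P : MvPolynomial (Fin 2) ℝ} (hP : P ∈ QSpace k k) :
    S.refInterp (fun α β => eval ![S.X.node α, S.X.node β] P) = P := by
  let evalNodes : MvPolynomial (Fin 2) ℝ →ₗ[ℝ] Fin (k + 1) → Fin (k + 1) → ℝ :=
    LinearMap.pi fun α => LinearMap.pi fun β => (aeval ![S.X.node α, S.X.node β]).toLinearMap
  rw [QSpace, restrictSupport_eq_span] at hP
  refine LinearMap.eqOn_span (f := S.refInterpLin ∘ₗ evalNodes) (g := LinearMap.id) ?_ hP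
  rintro _ ⟨n, ⟨hn0, hn1⟩, rfl⟩
  have hmonomial : monomial n (1 : ℝ) = MvPolynomial.X 0 ^ n 0 * MvPolynomial.X 1 ^ n 1 := by
    rw [monomial_eq, Finsupp.prod_fintype _ _ (by simp), Fin.prod_univ_two, C_1, one_mul]
  have hprod := S.refInterp_eval_mul_eval (p := Polynomial.X ^ n 0) (q := Polynomial.X ^ n 1)
    (by simpa using hn0) (by simpa using hn1)
  change S.refInterp (fun α β => eval ![S.X.node α, S.X.node β] (monomial n 1)) = monomial n 1
  simpa [hmonomial] using hprod

end Interpolation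

section Projection

variable {k : ℕ} (S : Disc k) {G : Grid}

/-- The cell average as a linear map. -/
def avgLin : CellSol k →ₗ[ℝ] State where
  toFun := S.avg
  map_add' c c' := by simp only [avg, Pi.add_apply, smul_add, Finset.sum_add_distrib]
  map_smul' r c := by
    simp only [avg, Pi.smul_apply, Finset.smul_sum, smul_comm _ r, RingHom.id_apply]

theorem avgLin_apply (c : CellSol k) : S.avgLin c = S.avg c := rfl

theorem map_avg {E : Type*} [AddCommGroup E] [Module ℝ E] (φ : State →ₗ[ℝ] E) (c : CellSol k) :
    φ (S.avg c) = (1 / 4 : ℝ) • ∑ α, ∑ β, (S.X.weight α * S.X.weight β) • φ (c α β) := by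
  simp only [avg, map_smul, map_sum]

theorem map_avg_congr {E : Type*} [AddCommGroup E] [Module ℝ E] (φ : State →ₗ[ℝ] E)
    {c c' : CellSol k} (h : ∀ α β, φ (c α β) = φ (c' α β)) : φ (S.avg c) = φ (S.avg c') := by
  simp only [map_avg, h]

/-- The `m`-th component of the magnetic field as a linear form. -/
def magForm (m : Fin 3) : State →ₗ[ℝ] ℝ :=
  LinearMap.proj m ∘ₗ LinearMap.fst ℝ _ _ ∘ₗ LinearMap.snd ℝ _ _ ∘ₗ LinearMap.snd ℝ _ _

theorem magForm_apply (m : Fin 3) (w : State) : magForm m w = mag w m := rfl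

theorem refInt_refInterp_mag (c : ℝ) (u : CellSol k) (m : Fin 3) :
    refInt (S.refInterp fun α β => c * mag (u α β) m) = 4 * c * mag (S.avg u) m := by
  rw [refInterp_const_mul, refInt_smul, refInt_refInterp, ← magForm_apply, map_avg]
  simp only [magForm_apply, smul_eq_mul]
  ring

theorem piola_mem (w : Sol k G) (i : Fin G.Nx) (j : Fin G.Ny) (m : Fin 2) :
    S.piola w i j m ∈ QSpace k k := by
  fin_cases m <;> exact S.refInterp_mem _

/-- The numerical solution in which the Piola transform of `(B_1, B_2)` is replaced by `B`. -/
def ofPiola (w : Sol k G) (B : Fin G.Nx → Fin G.Ny → Fin 2 → MvPolynomial (Fin 2) ℝ) :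
    Sol k G := fun i j α β =>
  (rho (w i j α β), mom (w i j α β),
    ![2 / G.hy * MvPolynomial.eval ![S.X.node α, S.X.node β] (B i j 0),
      2 / G.hx * MvPolynomial.eval ![S.X.node α, S.X.node β] (B i j 1), mag (w i j α β) 2],
    ener (w i j α β))

theorem piola_ofPiola (w : Sol k G)
    {B : Fin G.Nx → Fin G.Ny → Fin 2 → MvPolynomial (Fin 2) ℝ} {i : Fin G.Nx} {j : Fin G.Ny}
    (hB : ∀ m, B i j m ∈ QSpace k k) : S.piola (S.ofPiola w B) i j = B i j := by
  have hx := G.hx_pos.ne'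
  have hy := G.hy_pos.ne'
  funext m
  rw [← S.refInterp_eval (hB m)]
  fin_cases m <;> refine congrArg S.refInterp (funext₂ fun α β => ?_) <;>
    simp only [ofPiola, mag, Matrix.cons_val_zero, Matrix.cons_val_one, Fin.zero_eta,
      Fin.mk_one] <;> field_simp

variable {w w' : Sol k G}

theorem ofPiola_piola_of_isLDFProjection (h : S.IsLDFProjection w w') :
    S.ofPiola w (S.piola w') = w' := by
  have hx := G.hx_pos.ne'
  have hy := G.hy_pos.ne'
  funext i j α β
  obtain ⟨hrho, hmom, hmag, hener⟩ := (h i j).1 α β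
  refine state_ext hrho.symm hmom.symm (fun m => ?_) hener.symm
  fin_cases m
  · simp only [ofPiola, mag, piola, Matrix.cons_val_zero, Fin.zero_eta, eval_refInterp_node]
    field_simp
  · simp only [ofPiola, mag, piola, Matrix.cons_val_one, Matrix.cons_val_zero, Fin.mk_one,
      eval_refInterp_node]
    field_simp
  · exact hmag.symm

theorem existsUnique_isLDFProjection (w : Sol k G) : ∃! w', S.IsLDFProjection w w' := by
  choose B hB using fun i j => exists_isRefLDFProjection (S.piola_mem w i j)
  refine ⟨S.ofPiola w B, fun i j => ⟨fun α β => ⟨rfl, rfl, rfl, rfl⟩, ?_⟩, fun w' hw' => ?_⟩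
  · rw [S.piola_ofPiola w (hB i j).1]
    exact hB i j
  · rw [← S.ofPiola_piola_of_isLDFProjection hw',
      funext₂ fun i j => eq_of_isRefLDFProjection (hw' i j).2 (hB i j)]

theorem LDF_of_isLDFProjection (h : S.IsLDFProjection w w') : S.LDF w' := by
  intro i j x y _
  rw [divB_eq_refDiv, refDiv_eq_zero_of_isRefLDFProjection (h i j).2, map_zero, mul_zero]

theorem avg_of_isLDFProjection (h : S.IsLDFProjection w w') (i : Fin G.Nx) (j : Fin G.Ny) :
    S.avg (w' i j) = S.avg (w i j) := by
  obtain ⟨hcomp, hproj⟩ := h i j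
  have hmag₀ := (S.refInt_refInterp_mag (G.hy / 2) (w' i j) 0).symm.trans
    ((refInt_eq_of_isRefLDFProjection hproj 0).trans (S.refInt_refInterp_mag _ (w i j) 0))
  have hmag₁ := (S.refInt_refInterp_mag (G.hx / 2) (w' i j) 1).symm.trans
    ((refInt_eq_of_isRefLDFProjection hproj 1).trans (S.refInt_refInterp_mag _ (w i j) 1))
  refine state_ext (S.map_avg_congr (LinearMap.fst ℝ _ _) fun α β => (hcomp α β).1)
    (S.map_avg_congr (LinearMap.fst ℝ _ _ ∘ₗ LinearMap.snd ℝ _ _) fun α β => (hcomp α β).2.1)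
    (fun m => ?_)
    (S.map_avg_congr (LinearMap.snd ℝ _ _ ∘ₗ LinearMap.snd ℝ _ _ ∘ₗ LinearMap.snd ℝ _ _)
      fun α β => (hcomp α β).2.2.2)
  fin_cases m
  · exact mul_left_cancel₀ (by have := G.hy_pos; positivity) hmag₀
  · exact mul_left_cancel₀ (by have := G.hx_pos; positivity) hmag₁
  · exact S.map_avg_congr (magForm 2) fun α β => (hcomp α β).2.2.1

end Projection

end Disc

/-! ### Limiting -/

section Convexity

open Matrix

variable {γ : ℝ}

theorem convex_admissible (hγ : 1 < γ) : Convex ℝ {w | Admissible γ w} := by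
  intro w hw z hz a b ha hb hab
  refine admissible_of_forall_isPositivityForm hγ fun φ c κ hφ => ?_
  have hcomb := Convex.min_le_combo (φ w + c) (φ z + c) ha hb hab
  rw [map_add, map_smul, map_smul]
  simp only [smul_eq_mul] at hcomb ⊢
  have hpos := lt_min (hφ.pos w hw) (hφ.pos z hz)
  linear_combination hpos + hcomb + c * hab

theorem concaveOn_internal : ConcaveOn ℝ {w | 0 < rho w} internal := by
  have hconv : Convex ℝ {w : State | 0 < rho w} := convex_halfSpace_gt rhoForm.isLinear 0
  refine ⟨hconv, fun w hw z hz a b ha hb hab => ?_⟩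
  set s := a • w + b • z with hs
  have hsum : gqlForm (vel s) (mag s) s
      = a * gqlForm (vel s) (mag s) w + b * gqlForm (vel s) (mag s) z := by
    conv_lhs => arg 2; rw [hs]
    rw [map_add, map_smul, map_smul, smul_eq_mul, smul_eq_mul]
  rw [← gqlForm_vel_mag_add (hconv hw hz ha hb hab).ne', hsum]
  have hw_le := mul_le_mul_of_nonneg_left (internal_le_gqlForm_add hw (vel s) (mag s)) ha
  have hz_le := mul_le_mul_of_nonneg_left (internal_le_gqlForm_add hz (vel s) (mag s)) hb
  simp only [smul_eq_mul]
  linear_combination hw_le + hz_le + (mag s ⬝ᵥ mag s) / 2 * hab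

end Convexity

theorem sum_smul_mem_of_ne_zero {E ι : Type*} [AddCommGroup E] [Module ℝ E] {C : Set E}
    (hC : Convex ℝ C) {s : Finset ι} {a : ι → ℝ} {z : ι → E} (ha : ∀ i ∈ s, 0 ≤ a i)
    (hsum : ∑ i ∈ s, a i = 1) (hz : ∀ i ∈ s, a i ≠ 0 → z i ∈ C) :
    ∑ i ∈ s, a i • z i ∈ C := by
  classical
  have hfilter : ∑ i ∈ s with a i ≠ 0, a i • z i = ∑ i ∈ s, a i • z i :=
    Finset.sum_filter_of_ne fun i _ hi => left_ne_zero_of_smul hi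
  rw [← hfilter]
  refine hC.sum_mem (fun i hi => ha i (Finset.mem_of_mem_filter i hi)) ?_ fun i hi => ?_
  · rw [Finset.sum_filter_ne_zero, hsum]
  · exact hz i (Finset.mem_filter.1 hi).1 (Finset.mem_filter.1 hi).2

namespace Disc

section Scale

variable {a e m : ℝ}

theorem scale_nonneg (h : e ≤ a) : 0 ≤ scale a e m := by
  rw [scale]
  split_ifs with hm
  · exact zero_le_one
  · exact div_nonneg (sub_nonneg.2 h) (by linarith)

theorem scale_le_one (h : e ≤ a) : scale a e m ≤ 1 := by
  rw [scale]
  split_ifs with hm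
  · exact le_rfl
  · exact (div_le_one (by linarith)).2 (by linarith)

theorem le_add_scale_mul_sub {x : ℝ} (h : e ≤ a) (hx : m ≤ x) :
    e ≤ a + scale a e m * (x - a) := by
  have hmin : e ≤ a + scale a e m * (m - a) := by
    rw [scale]
    split_ifs with hm
    · linarith
    · have : a - m ≠ 0 := by linarith
      refine le_of_eq ?_
      field_simp
      ring
  have := mul_le_mul_of_nonneg_left (sub_le_sub_right hx a) (scale_nonneg (m := m) h)
  linarith

end Scale

variable {k : ℕ}

theorem nodeMin_le (q : State → ℝ) (c : CellSol k) (α β : Fin (k + 1)) :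
    nodeMin q c ≤ q (c α β) :=
  Finset.inf'_le (fun n : Fin (k + 1) × Fin (k + 1) => q (c n.1 n.2)) (Finset.mem_univ (α, β))

variable (S : Disc k)

theorem sum_weight_mul_weight : ∑ α, ∑ β, S.X.weight α * S.X.weight β = 4 := by
  rw [← Finset.sum_mul_sum, S.X.sum_weight]
  norm_num

theorem avg_const (z : State) : S.avg (fun _ _ => z) = z := by
  simp only [avg, ← Finset.sum_smul, sum_weight_mul_weight, smul_smul]
  norm_num

theorem avg_add_smul (c c' : CellSol k) (θ : ℝ) : S.avg (c + θ • c') = S.avg c + θ • S.avg c' := by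
  simp only [← avgLin_apply, map_add, map_smul]

theorem avg_scaled (θ : ℝ) (c : CellSol k) :
    S.avg (fun α β => S.avg c + θ • (c α β - S.avg c)) = S.avg c := by
  set m : CellSol k := fun _ _ => S.avg c
  have havg : S.avg m = S.avg c := S.avg_const _
  change S.avg (m + θ • (c - m)) = _
  rw [avg_add_smul, havg, ← avgLin_apply (c := c - m), map_sub, avgLin_apply, avgLin_apply, havg,
    sub_self, smul_zero, add_zero]

theorem avg_mem (hk : 1 ≤ k) {C : Set State} (hC : Convex ℝ C) {c : CellSol k}
    (hc : ∀ α β, c α β ∈ C) : S.avg c ∈ C := by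
  have hweights : ∑ n : Fin (k + 1) × Fin (k + 1), 1 / 4 * (S.X.weight n.1 * S.X.weight n.2)
      = 1 := by
    rw [← Finset.mul_sum, Fintype.sum_prod_type, sum_weight_mul_weight]
    norm_num
  have hnonneg (n : Fin (k + 1) × Fin (k + 1)) :
      0 ≤ 1 / 4 * (S.X.weight n.1 * S.X.weight n.2) :=
    mul_nonneg (by norm_num) (mul_pos (S.X.weight_pos hk n.1) (S.X.weight_pos hk n.2)).le
  have hmem := hC.sum_mem (fun n _ => hnonneg n) hweights fun n _ => hc n.1 n.2
  rw [Fintype.sum_prod_type] at hmem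
  simpa only [avg, Finset.smul_sum, smul_smul] using hmem

theorem avg_ppDensity (ε : ℝ) (c : CellSol k) : S.avg (S.ppDensity ε c) = S.avg c := by
  refine Prod.ext ?_ (S.map_avg_congr (LinearMap.snd ℝ _ _) fun _ _ => rfl)
  set θ := scale (rho (S.avg c)) (min ε (rho (S.avg c))) (nodeMin rho c)
  calc rhoForm (S.avg (S.ppDensity ε c))
      = rhoForm (S.avg fun α β => S.avg c + θ • (c α β - S.avg c)) :=
        S.map_avg_congr rhoForm fun _ _ => rfl
    _ = rhoForm (S.avg c) := by rw [avg_scaled]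

theorem rho_ppDensity_pos {ε : ℝ} (hε : 0 < ε) {c : CellSol k} (h : 0 < rho (S.avg c))
    (α β : Fin (k + 1)) : 0 < rho (S.ppDensity ε c α β) :=
  (lt_min hε h).trans_le (le_add_scale_mul_sub (min_le_right _ _) (nodeMin_le rho c α β))

theorem admissible_ppEnergy (hγ : 1 < S.γ) {ε : ℝ} (hε : 0 < ε) {c : CellSol k}
    (h : Admissible S.γ (S.avg c)) (hc : ∀ α β, 0 < rho (c α β)) (α β : Fin (k + 1)) :
    Admissible S.γ (S.ppEnergy ε c α β) := by
  rw [admissible_iff hγ] at h ⊢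
  have hle : min ε (internal (S.avg c)) ≤ internal (S.avg c) := min_le_right _ _
  set θ := scale (internal (S.avg c)) (min ε (internal (S.avg c))) (nodeMin internal c)
  have hcomb : S.ppEnergy ε c α β = (1 - θ) • S.avg c + θ • c α β := by
    change S.avg c + θ • (c α β - S.avg c) = _
    module
  have hθ₀ : 0 ≤ θ := scale_nonneg hle
  have hθ₁ : 0 ≤ 1 - θ := sub_nonneg.2 (scale_le_one hle)
  rw [hcomb]
  refine ⟨concaveOn_internal.1 h.1 (hc α β) hθ₁ hθ₀ (sub_add_cancel 1 θ), ?_⟩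
  calc 0 < min ε (internal (S.avg c)) := lt_min hε h.2
    _ ≤ internal (S.avg c) + θ * (internal (c α β) - internal (S.avg c)) :=
      le_add_scale_mul_sub hle (nodeMin_le internal c α β)
    _ = (1 - θ) • internal (S.avg c) + θ • internal (c α β) := by
      rw [smul_eq_mul, smul_eq_mul]
      ring
    _ ≤ internal ((1 - θ) • S.avg c + θ • c α β) :=
      concaveOn_internal.2 h.1 (hc α β) hθ₁ hθ₀ (sub_add_cancel 1 θ)

section TwoDimensional

variable {G : Grid} (δ : Fin (k + 1) → Sol k G → Fin G.Nx → Fin G.Ny → ℝ) (ε t : ℝ)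
  {w : Sol k G}

theorem avgAdmissible_of_nodallyAdmissible (hk : 1 ≤ k) (hγ : 1 < S.γ)
    (hw : NodallyAdmissible S.γ w) : S.AvgAdmissible w :=
  fun i j => S.avg_mem hk (convex_admissible hγ) (hw i j)

theorem LDF_oedg (h : S.LDF w) : S.LDF (S.oedg δ t w) :=
  S.LDF_of_scaled h (fun i j => Real.exp (-t * ∑ m, δ m w i j)) (fun i j => mag (S.avg (w i j)))
    fun _ _ _ _ => rfl

theorem avg_oedg (w : Sol k G) (i : Fin G.Nx) (j : Fin G.Ny) :
    S.avg (S.oedg δ t w i j) = S.avg (w i j) :=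
  S.avg_scaled _ _

theorem avg_ppLimiter (w : Sol k G) (i : Fin G.Nx) (j : Fin G.Ny) :
    S.avg (S.ppLimiter ε w i j) = S.avg (w i j) :=
  (S.avg_scaled _ _).trans (S.avg_ppDensity ε _)

theorem LDF_ppLimiter (h : S.LDF w) : S.LDF (S.ppLimiter ε w) :=
  S.LDF_of_scaled h
    (fun i j => scale (internal (S.avg (S.ppDensity ε (w i j))))
      (min ε (internal (S.avg (S.ppDensity ε (w i j)))))
      (nodeMin internal (S.ppDensity ε (w i j))))
    (fun i j => mag (S.avg (S.ppDensity ε (w i j)))) fun _ _ _ _ => rfl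

variable {δ ε t}

theorem nodallyAdmissible_ppLimiter (hγ : 1 < S.γ) (hε : 0 < ε) (h : S.AvgAdmissible w) :
    NodallyAdmissible S.γ (S.ppLimiter ε w) := by
  intro i j α β
  refine S.admissible_ppEnergy hγ hε ?_ (S.rho_ppDensity_pos hε (h i j).1) α β
  rw [avg_ppDensity]
  exact h i j

theorem nodallyAdmissible_of_isLimited (hγ : 1 < S.γ) (hε : 0 < ε) {raw out : Sol k G}
    (h : S.IsLimited δ ε t raw out) (hraw : S.AvgAdmissible raw) :
    NodallyAdmissible S.γ out := by
  obtain ⟨w, hw, rfl⟩ := h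
  refine S.nodallyAdmissible_ppLimiter hγ hε fun i j => ?_
  rw [avg_oedg, S.avg_of_isLDFProjection hw]
  exact hraw i j

theorem LDF_of_isLimited {raw out : Sol k G} (h : S.IsLimited δ ε t raw out) : S.LDF out := by
  obtain ⟨w, hw, rfl⟩ := h
  exact S.LDF_ppLimiter ε (S.LDF_oedg δ t (S.LDF_of_isLDFProjection hw))

end TwoDimensional

end Disc

/-! ### Forward Euler steps -/

namespace Disc

variable {k : ℕ} (S : Disc k)

-- Only the two end points of a line, whose weights are both `ω_0`, have a nonzero speed.
theorem weight_mul_nodeSpeed_div (hk : 1 ≤ k) (d : Fin 3) (u : Fin (k + 1) → State)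
    (eL eR : State) (α : Fin (k + 1)) :
    S.X.weight α * (S.nodeSpeed d u eL eR α / S.X.weight 0) = S.nodeSpeed d u eL eR α := by
  have hω := (S.X.weight_zero_pos hk).ne'
  by_cases h₀ : α = 0
  · rw [h₀, mul_div_cancel₀ _ hω]
  by_cases h₁ : α = Fin.last k
  · rw [h₁, S.X.weight_last hk, mul_div_cancel₀ _ hω]
  · simp [nodeSpeed, h₀, h₁]

theorem neg_sum_weight_mul_le_lineBoundary (hk : 1 ≤ k) (hsp : PPSpeeds S.γ S.SL S.SR)
    {φ : State →ₗ[ℝ] ℝ} {c κ : ℝ} (hφ : IsPositivityForm S.γ φ c κ) (d : Fin 3)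
    {u : Fin (k + 1) → State} {eL eR : State}
    (hu : ∀ α, Admissible S.γ (u α)) (hL : Admissible S.γ eL) (hR : Admissible S.γ eR) :
    (∑ α, S.X.weight α * (-(S.nodeSpeed d u eL eR α / S.X.weight 0) * (φ (u α) + c)))
        - (mag (u (Fin.last k)) d - mag (u 0) d) * κ
      ≤ φ (S.lineBoundary d u eL eR) := by
  simpa only [← mul_assoc, mul_neg, S.weight_mul_nodeSpeed_div hk, neg_mul,
    Finset.sum_neg_distrib] using S.le_lineBoundary hk hsp hφ d hu hL hR

theorem one_sub_mul_div_pos {τ ω r : ℝ} (hω : 0 < ω) (h : τ * r < ω / 2) :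
    0 < 1 - 2 * τ * (r / ω) := by
  have : 2 * τ * (r / ω) = 2 * (τ * r) / ω := by ring
  rw [this, sub_pos, div_lt_one hω]
  linarith

section OneDimensional

variable {G : Grid1} {bc : Sol1 k G → State × State} {w : Sol1 k G}

theorem map_avg1_add_const (φ : State →ₗ[ℝ] ℝ) (u : Fin (k + 1) → State) (c : ℝ) :
    φ (S.avg1 u) + c = 1 / 2 * ∑ α, S.X.weight α * (φ (u α) + c) := by
  simp only [avg1, map_smul, map_sum, smul_eq_mul, mul_add, Finset.sum_add_distrib,
    ← Finset.sum_mul, S.X.sum_weight]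
  ring

theorem admissible_extL1 {γ : ℝ} {g : State × State} (hw : ∀ i α, Admissible γ (w i α))
    (hg : Admissible γ g.1) (i : Fin G.N) : Admissible γ (extL1 g w i) := by
  rw [extL1]
  split_ifs
  exacts [hw _ _, hg]

theorem admissible_extR1 {γ : ℝ} {g : State × State} (hw : ∀ i α, Admissible γ (w i α))
    (hg : Admissible γ g.2) (i : Fin G.N) : Admissible γ (extR1 g w i) := by
  rw [extR1]
  split_ifs
  exacts [hw _ _, hg]

theorem mag_last_sub_mag_zero_eq_zero (hk : 1 ≤ k) (h : S.LDF1 w) (i : Fin G.N) :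
    mag (w i (Fin.last k)) 0 - mag (w i 0) 0 = 0 := by
  rw [← S.sum_weight_mul_sum_diff hk fun p => mag (w i p) 0]
  simp [S.sum_diff_mag_eq_zero hk h]

theorem avg1_euler (hk : 1 ≤ k) (hfS : IsTwoPointFlux S.γ S.fS)
    (hw : ∀ i α, Admissible S.γ (w i α)) (hldf : S.LDF1 w) (τ : ℝ) (i : Fin G.N) :
    S.avg1 ((w + τ • S.L1 bc w) i) = S.avg1 (w i) + (τ / G.h) •
      S.lineBoundary 0 (w i) (extL1 (bc w) w i) (extR1 (bc w) w i) := by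
  have hevol := S.h_smul_avg1_L1 hk hfS bc hw i
  rw [S.vol1_eq_zero hk hldf, sub_zero] at hevol
  rw [← hevol, smul_smul, div_mul_cancel₀ _ G.h_pos.ne']
  simp only [avg1, Pi.add_apply, Pi.smul_apply, smul_add, Finset.sum_add_distrib,
    Finset.smul_sum, smul_comm _ τ]

theorem admissible_avg1_euler (hk : 1 ≤ k) (hγ : 1 < S.γ) (hfS : IsTwoPointFlux S.γ S.fS)
    (hsp : PPSpeeds S.γ S.SL S.SR) (hw : ∀ i α, Admissible S.γ (w i α))
    (hbc : Admissible S.γ (bc w).1 ∧ Admissible S.γ (bc w).2) (hldf : S.LDF1 w) {τ : ℝ}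
    (hτ : 0 ≤ τ) (hcfl : S.CFL1 bc w τ) (i : Fin G.N) :
    Admissible S.γ (S.avg1 ((w + τ • S.L1 bc w) i)) := by
  refine admissible_of_forall_isPositivityForm hγ fun φ c κ hφ => ?_
  set σ := S.nodeSpeed 0 (w i) (extL1 (bc w) w i) (extR1 (bc w) w i)
  have hline := S.neg_sum_weight_mul_le_lineBoundary hk hsp hφ 0 (hw i)
    (admissible_extL1 hw hbc.1 i) (admissible_extR1 hw hbc.2 i)
  rw [S.mag_last_sub_mag_zero_eq_zero hk hldf, zero_mul, sub_zero] at hline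
  have hpos : 0 < ∑ α, S.X.weight α *
      ((1 - 2 * τ * (σ α / G.h / S.X.weight 0)) * (φ (w i α) + c)) :=
    Finset.sum_pos (fun α _ => mul_pos (S.X.weight_pos hk α) (mul_pos
      (one_sub_mul_div_pos (S.X.weight_zero_pos hk) (hcfl i α)) (hφ.pos _ (hw i α))))
      Finset.univ_nonempty
  calc 0 < 1 / 2 * ∑ α, S.X.weight α *
          ((1 - 2 * τ * (σ α / G.h / S.X.weight 0)) * (φ (w i α) + c)) := by positivity
    _ = 1 / 2 * ∑ α, S.X.weight α * (φ (w i α) + c) + τ / G.h *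
          ∑ α, S.X.weight α * (-(σ α / S.X.weight 0) * (φ (w i α) + c)) := by
      simp only [Finset.mul_sum, ← Finset.sum_add_distrib]
      exact Finset.sum_congr rfl fun α _ => by ring
    _ ≤ 1 / 2 * ∑ α, S.X.weight α * (φ (w i α) + c) + τ / G.h *
          φ (S.lineBoundary 0 (w i) (extL1 (bc w) w i) (extR1 (bc w) w i)) := by
      have := G.h_pos
      gcongr
    _ = φ (S.avg1 ((w + τ • S.L1 bc w) i)) + c := by
      rw [S.avg1_euler hk hfS hw hldf, map_add, map_smul, smul_eq_mul, add_right_comm,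
        map_avg1_add_const]

end OneDimensional

section TwoDimensional

variable {G : Grid} {bc : Sol k G → Ghost k G} {w : Sol k G}

theorem map_avg_add_const (φ : State →ₗ[ℝ] ℝ) (u : CellSol k) (c : ℝ) :
    φ (S.avg u) + c = 1 / 4 * ∑ α, ∑ β, S.X.weight α * S.X.weight β * (φ (u α β) + c) := by
  simp only [map_avg, smul_eq_mul, mul_add, Finset.sum_add_distrib, ← Finset.sum_mul,
    sum_weight_mul_weight]
  ring

section Traces

variable {γ : ℝ} {g : Ghost k G}

theorem admissible_extLeft (hw : NodallyAdmissible γ w) (hg : g.AllAdmissible γ) (i : Fin G.Nx)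
    (j : Fin G.Ny) (α : Fin (k + 1)) : Admissible γ (extLeft g w i j α) := by
  rw [extLeft]
  split_ifs
  exacts [hw _ _ _ _, (hg.1 _ _).1]

theorem admissible_extRight (hw : NodallyAdmissible γ w) (hg : g.AllAdmissible γ) (i : Fin G.Nx)
    (j : Fin G.Ny) (α : Fin (k + 1)) : Admissible γ (extRight g w i j α) := by
  rw [extRight]
  split_ifs
  exacts [hw _ _ _ _, (hg.1 _ _).2]

theorem admissible_extBottom (hw : NodallyAdmissible γ w) (hg : g.AllAdmissible γ) (i : Fin G.Nx)
    (j : Fin G.Ny) (α : Fin (k + 1)) : Admissible γ (extBottom g w i j α) := by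
  rw [extBottom]
  split_ifs
  exacts [hw _ _ _ _, (hg.2 _ _).1]

theorem admissible_extTop (hw : NodallyAdmissible γ w) (hg : g.AllAdmissible γ) (i : Fin G.Nx)
    (j : Fin G.Ny) (α : Fin (k + 1)) : Admissible γ (extTop g w i j α) := by
  rw [extTop]
  split_ifs
  exacts [hw _ _ _ _, (hg.2 _ _).2]

end Traces

theorem avg_euler (hk : 1 ≤ k) (hfS : IsTwoPointFlux S.γ S.fS) (hw : NodallyAdmissible S.γ w)
    (hldf : S.LDF w) (τ : ℝ) (i : Fin G.Nx) (j : Fin G.Ny) :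
    S.avg (S.euler bc τ w i j)
      = S.avg (w i j) + (τ / (G.hx * G.hy)) • S.boundaryTerm bc w i j := by
  have hevol := S.h_smul_avg_L hk hfS bc hw i j
  rw [S.volumeTerm_eq_zero hk hldf, sub_zero] at hevol
  rw [← hevol, smul_smul, div_mul_cancel₀ _ (mul_pos G.hx_pos G.hy_pos).ne']
  exact S.avg_add_smul _ _ τ

/-- The wave speed estimate `σ_x` at a node of the cell `(i, j)`. -/
def nodeSpeedX (bc : Sol k G → Ghost k G) (w : Sol k G) (i : Fin G.Nx) (j : Fin G.Ny)
    (α β : Fin (k + 1)) : ℝ :=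
  S.nodeSpeed 0 (fun p => w i j p β) (extLeft (bc w) w i j β) (extRight (bc w) w i j β) α

/-- The wave speed estimate `σ_y` at a node of the cell `(i, j)`. -/
def nodeSpeedY (bc : Sol k G → Ghost k G) (w : Sol k G) (i : Fin G.Nx) (j : Fin G.Ny)
    (α β : Fin (k + 1)) : ℝ :=
  S.nodeSpeed 1 (fun q => w i j α q) (extBottom (bc w) w i j α) (extTop (bc w) w i j α) β

/-- The quantity `σ_x / h_x + σ_y / h_y` at a node, whose product with the step size is bounded by
the CFL condition. -/
def nodeRate (bc : Sol k G → Ghost k G) (w : Sol k G) (i : Fin G.Nx) (j : Fin G.Ny)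
    (α β : Fin (k + 1)) : ℝ :=
  S.nodeSpeedX bc w i j α β / G.hx + S.nodeSpeedY bc w i j α β / G.hy

theorem neg_sum_nodeRate_mul_eq_sum_lines (bc : Sol k G → Ghost k G) (w : Sol k G) (i : Fin G.Nx)
    (j : Fin G.Ny) (Y : Fin (k + 1) → Fin (k + 1) → ℝ) :
    -(G.hx * G.hy / 2 * ∑ α, ∑ β, S.X.weight α * S.X.weight β *
        (S.nodeRate bc w i j α β / S.X.weight 0 * Y α β))
      = G.hy * ∑ β, S.X.weight β / 2 * ∑ α, S.X.weight α *
            (-(S.nodeSpeedX bc w i j α β / S.X.weight 0) * Y α β)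
          + G.hx * ∑ α, S.X.weight α / 2 * ∑ β, S.X.weight β *
            (-(S.nodeSpeedY bc w i j α β / S.X.weight 0) * Y α β) := by
  refine Eq.trans ?_ (smul_sum_sum_eq_sum_lines S.X.weight G.hx_pos.ne' G.hy_pos.ne'
    (fun α β => -(S.nodeSpeedX bc w i j α β / S.X.weight 0) * Y α β)
    (fun α β => -(S.nodeSpeedY bc w i j α β / S.X.weight 0) * Y α β))
  simp only [nodeRate, smul_eq_mul, Finset.mul_sum, ← Finset.sum_neg_distrib]
  exact Finset.sum_congr rfl fun α _ => Finset.sum_congr rfl fun β _ => by ring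

-- The linewise bounds involve the jump of the normal magnetic field along the line; summed over
-- the lines of both directions, these jumps cancel because the field is divergence-free.
theorem neg_sum_nodeRate_mul_le_boundaryTerm (hk : 1 ≤ k) (hsp : PPSpeeds S.γ S.SL S.SR)
    {φ : State →ₗ[ℝ] ℝ} {c κ : ℝ} (hφ : IsPositivityForm S.γ φ c κ)
    (hw : NodallyAdmissible S.γ w) (hbc : (bc w).AllAdmissible S.γ) (hldf : S.LDF w)
    (i : Fin G.Nx) (j : Fin G.Ny) :
    -(G.hx * G.hy / 2 * ∑ α, ∑ β, S.X.weight α * S.X.weight β *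
        (S.nodeRate bc w i j α β / S.X.weight 0 * (φ (w i j α β) + c)))
      ≤ φ (S.boundaryTerm bc w i j) := by
  set jx := fun β => mag (w i j (Fin.last k) β) 0 - mag (w i j 0 β) 0
  set jy := fun α => mag (w i j α (Fin.last k)) 1 - mag (w i j α 0) 1
  set X := fun β => ∑ α, S.X.weight α *
    (-(S.nodeSpeedX bc w i j α β / S.X.weight 0) * (φ (w i j α β) + c))
  set Y := fun α => ∑ β, S.X.weight β *
    (-(S.nodeSpeedY bc w i j α β / S.X.weight 0) * (φ (w i j α β) + c))
  have hnet : G.hy * ∑ β, S.X.weight β / 2 * jx β + G.hx * ∑ α, S.X.weight α / 2 * jy α = 0 :=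
    S.net_magnetic_flux_eq_zero hk hldf i j
  have hx_line (β : Fin (k + 1)) := S.neg_sum_weight_mul_le_lineBoundary hk hsp hφ 0
    (fun p => hw i j p β) (admissible_extLeft hw hbc i j β) (admissible_extRight hw hbc i j β)
  have hy_line (α : Fin (k + 1)) := S.neg_sum_weight_mul_le_lineBoundary hk hsp hφ 1
    (fun q => hw i j α q) (admissible_extBottom hw hbc i j α) (admissible_extTop hw hbc i j α)
  have hω (α : Fin (k + 1)) : 0 ≤ S.X.weight α / 2 := (half_pos (S.X.weight_pos hk α)).le
  have hx := G.hx_pos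
  have hy := G.hy_pos
  rw [neg_sum_nodeRate_mul_eq_sum_lines]
  calc G.hy * ∑ β, S.X.weight β / 2 * X β + G.hx * ∑ α, S.X.weight α / 2 * Y α
      = G.hy * ∑ β, S.X.weight β / 2 * (X β - jx β * κ)
          + G.hx * ∑ α, S.X.weight α / 2 * (Y α - jy α * κ) := by
        simp only [mul_sub, Finset.sum_sub_distrib, ← mul_assoc, ← Finset.sum_mul] at hnet ⊢
        linear_combination κ * hnet
    _ ≤ G.hy * ∑ β, S.X.weight β / 2 * φ (S.lineBoundary 0 (fun p => w i j p β)
            (extLeft (bc w) w i j β) (extRight (bc w) w i j β))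
          + G.hx * ∑ α, S.X.weight α / 2 * φ (S.lineBoundary 1 (fun q => w i j α q)
            (extBottom (bc w) w i j α) (extTop (bc w) w i j α)) := by
        gcongr with β _ α _
        exacts [hω β, hx_line β, hω α, hy_line α]
    _ = φ (S.boundaryTerm bc w i j) := by
        simp only [boundaryTerm, map_add, map_smul, map_sum, smul_eq_mul]

theorem avgAdmissible_euler (hk : 1 ≤ k) (hγ : 1 < S.γ) (hfS : IsTwoPointFlux S.γ S.fS)
    (hsp : PPSpeeds S.γ S.SL S.SR) (hw : NodallyAdmissible S.γ w)
    (hbc : (bc w).AllAdmissible S.γ) (hldf : S.LDF w) {τ : ℝ} (hτ : 0 ≤ τ)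
    (hcfl : S.CFL bc w τ) : S.AvgAdmissible (S.euler bc τ w) := by
  intro i j
  refine admissible_of_forall_isPositivityForm hγ fun φ c κ hφ => ?_
  set r := S.nodeRate bc w i j
  have hpos : 0 < ∑ α, ∑ β, S.X.weight α * S.X.weight β *
      ((1 - 2 * τ * (r α β / S.X.weight 0)) * (φ (w i j α β) + c)) :=
    Finset.sum_pos (fun α _ => Finset.sum_pos (fun β _ =>
      mul_pos (mul_pos (S.X.weight_pos hk α) (S.X.weight_pos hk β)) (mul_pos
        (one_sub_mul_div_pos (S.X.weight_zero_pos hk) (hcfl i j α β)) (hφ.pos _ (hw i j α β))))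
      Finset.univ_nonempty) Finset.univ_nonempty
  have hx := G.hx_pos
  have hy := G.hy_pos
  calc 0 < 1 / 4 * ∑ α, ∑ β, S.X.weight α * S.X.weight β *
          ((1 - 2 * τ * (r α β / S.X.weight 0)) * (φ (w i j α β) + c)) := by positivity
    _ = 1 / 4 * ∑ α, ∑ β, S.X.weight α * S.X.weight β * (φ (w i j α β) + c)
          + τ / (G.hx * G.hy) * -(G.hx * G.hy / 2 * ∑ α, ∑ β, S.X.weight α * S.X.weight β *
            (r α β / S.X.weight 0 * (φ (w i j α β) + c))) := by
      have hcancel : τ / (G.hx * G.hy) * (G.hx * G.hy / 2) = τ / 2 := by field_simp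
      rw [mul_neg, ← mul_assoc, hcancel, ← sub_eq_add_neg]
      simp only [Finset.mul_sum, ← Finset.sum_sub_distrib]
      exact Finset.sum_congr rfl fun α _ => Finset.sum_congr rfl fun β _ => by ring
    _ ≤ 1 / 4 * ∑ α, ∑ β, S.X.weight α * S.X.weight β * (φ (w i j α β) + c)
          + τ / (G.hx * G.hy) * φ (S.boundaryTerm bc w i j) := by
      gcongr
      exact S.neg_sum_nodeRate_mul_le_boundaryTerm hk hsp hφ hw hbc hldf i j
    _ = φ (S.avg (S.euler bc τ w i j)) + c := by
      rw [S.avg_euler hk hfS hw hldf, map_add, map_smul, smul_eq_mul, add_right_comm,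
        map_avg_add_const]

end TwoDimensional

end Disc

/-! ### Runge-Kutta methods -/

namespace Disc

variable {k : ℕ} (S : Disc k) {G : Grid} {bc : Sol k G → Ghost k G}

theorem avgAdmissible_raw (hk : 1 ≤ k) (hγ : 1 < S.γ) (hfS : IsTwoPointFlux S.γ S.fS)
    (hsp : PPSpeeds S.γ S.SL S.SR)
    (hbc : ∀ w, NodallyAdmissible S.γ w → (bc w).AllAdmissible S.γ)
    (R : ConvexEuler) {Δt : ℝ} (hΔt : 0 ≤ Δt) {W : ℕ → Sol k G} {i : ℕ} (hi : i < R.s)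
    (hW : ∀ j ≤ i, NodallyAdmissible S.γ (W j) ∧ S.LDF (W j))
    (hcfl : ∀ j ≤ i, R.a i j ≠ 0 → S.CFL bc (W j) (R.r i j * Δt)) :
    S.AvgAdmissible (R.raw S bc Δt W i) := by
  intro m n
  have hle (j : ℕ) (hj : j ∈ Finset.range (i + 1)) : j ≤ i := Finset.mem_range_succ_iff.1 hj
  have havg : S.avg (R.raw S bc Δt W i m n)
      = ∑ j ∈ Finset.range (i + 1), R.a i j • S.avg (S.euler bc (R.r i j * Δt) (W j) m n) := by
    simp only [ConvexEuler.raw, Finset.sum_apply, Pi.smul_apply, ← avgLin_apply, map_sum, map_smul]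
  rw [havg]
  refine sum_smul_mem_of_ne_zero (convex_admissible hγ)
    (fun j hj => R.a_nonneg i hi j (hle j hj)) (R.a_sum i hi) fun j hj ha => ?_
  obtain ⟨hadm, hldf⟩ := hW j (hle j hj)
  exact S.avgAdmissible_euler hk hγ hfS hsp hadm (hbc _ hadm) hldf
    (mul_nonneg (R.r_nonneg i hi j (hle j hj)) hΔt) (hcfl j (hle j hj) ha) m n

theorem avgAdmissible_smul_add_smul_euler (hk : 1 ≤ k) (hγ : 1 < S.γ)
    (hfS : IsTwoPointFlux S.γ S.fS) (hsp : PPSpeeds S.γ S.SL S.SR) {w z : Sol k G}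
    (hw : S.AvgAdmissible w) (hz : NodallyAdmissible S.γ z) (hbc : (bc z).AllAdmissible S.γ)
    (hldf : S.LDF z) {τ : ℝ} (hτ : 0 ≤ τ) (hcfl : S.CFL bc z τ) {a b : ℝ} (ha : 0 ≤ a)
    (hb : 0 ≤ b) (hab : a + b = 1) : S.AvgAdmissible (a • w + b • S.euler bc τ z) := by
  intro i j
  have havg : S.avg ((a • w + b • S.euler bc τ z) i j)
      = a • S.avg (w i j) + b • S.avg (S.euler bc τ z i j) := by
    simp only [Pi.add_apply, Pi.smul_apply, ← avgLin_apply, map_add, map_smul]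
  rw [havg]
  exact convex_admissible hγ (hw i j)
    (S.avgAdmissible_euler hk hγ hfS hsp hz hbc hldf hτ hcfl i j) ha hb hab

section Stages

variable {δ : Fin (k + 1) → Sol k G → Fin G.Nx → Fin G.Ny → ℝ} {ε : ℝ}

theorem admissible_and_LDF_stage (hk : 1 ≤ k) (hγ : 1 < S.γ) (hfS : IsTwoPointFlux S.γ S.fS)
    (hsp : PPSpeeds S.γ S.SL S.SR)
    (hbc : ∀ w, NodallyAdmissible S.γ w → (bc w).AllAdmissible S.γ) (hε : 0 < ε)
    (R : ConvexEuler) {Δt : ℝ} (hΔt : 0 ≤ Δt) {W : ℕ → Sol k G}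
    (h₀ : NodallyAdmissible S.γ (W 0) ∧ S.LDF (W 0))
    (hlim : ∀ i < R.s, S.IsLimited δ ε Δt (R.raw S bc Δt W i) (W (i + 1)))
    (hcfl : ∀ i < R.s, ∀ j ≤ i, R.a i j ≠ 0 → S.CFL bc (W j) (R.r i j * Δt)) (i : ℕ)
    (hi : i ≤ R.s) : NodallyAdmissible S.γ (W i) ∧ S.LDF (W i) := by
  induction i using Nat.strong_induction_on with
  | _ i ih =>
    rcases i with _ | i
    · exact h₀
    · have hraw := S.avgAdmissible_raw hk hγ hfS hsp hbc R hΔt hi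
        (fun j hj => ih j (Nat.lt_succ_of_le hj) (hj.trans (Nat.le_of_succ_le hi))) (hcfl i hi)
      exact ⟨S.nodallyAdmissible_of_isLimited hγ hε (hlim i hi) hraw,
        S.LDF_of_isLimited (hlim i hi)⟩

theorem admissible_and_LDF_of_convexEuler (hk : 1 ≤ k) (hγ : 1 < S.γ)
    (hfS : IsTwoPointFlux S.γ S.fS) (hsp : PPSpeeds S.γ S.SL S.SR)
    (hbc : ∀ w, NodallyAdmissible S.γ w → (bc w).AllAdmissible S.γ) (hε : 0 < ε)
    (R : ConvexEuler) {Δt : ℕ → ℝ} {w : ℕ → Sol k G} {W : ℕ → ℕ → Sol k G}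
    (hΔt : ∀ n, 0 ≤ Δt n) (hw₀ : NodallyAdmissible S.γ (w 0)) (hldf₀ : S.LDF (w 0))
    (hW : ∀ n, W n 0 = w n ∧ w (n + 1) = W n R.s)
    (hlim : ∀ n, ∀ i < R.s,
      S.IsLimited δ ε (Δt n) (R.raw S bc (Δt n) (W n) i) (W n (i + 1)))
    (hcfl : ∀ n, ∀ i < R.s, ∀ j ≤ i, R.a i j ≠ 0 → S.CFL bc (W n j) (R.r i j * Δt n)) (n : ℕ) :
    (∀ i < R.s, S.AvgAdmissible (R.raw S bc (Δt n) (W n) i)) ∧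
      ∀ i ≤ R.s, NodallyAdmissible S.γ (W n i) ∧ S.LDF (W n i) ∧ S.AvgAdmissible (W n i) := by
  have hstages (n : ℕ) (h : NodallyAdmissible S.γ (w n) ∧ S.LDF (w n)) :=
    S.admissible_and_LDF_stage hk hγ hfS hsp hbc hε R (hΔt n) ((hW n).1 ▸ h) (hlim n) (hcfl n)
  have hsteps (n : ℕ) : NodallyAdmissible S.γ (w n) ∧ S.LDF (w n) := by
    induction n with
    | zero => exact ⟨hw₀, hldf₀⟩
    | succ n ih => exact (hW n).2 ▸ hstages n ih R.s le_rfl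
  have hn := hstages n (hsteps n)
  refine ⟨fun i hi => S.avgAdmissible_raw hk hγ hfS hsp hbc R (hΔt n) hi
    (fun j hj => hn j (hj.trans hi.le)) (hcfl n i hi), fun i hi => ?_⟩
  obtain ⟨hadm, hldf⟩ := hn i hi
  exact ⟨hadm, hldf, S.avgAdmissible_of_nodallyAdmissible hk hγ hadm⟩

theorem admissible_and_LDF_of_ssp3 (hk : 1 ≤ k) (hγ : 1 < S.γ) (hfS : IsTwoPointFlux S.γ S.fS)
    (hsp : PPSpeeds S.γ S.SL S.SR)
    (hbc : ∀ w, NodallyAdmissible S.γ w → (bc w).AllAdmissible S.γ) (hε : 0 < ε) {Δt : ℝ}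
    {w w₁ w₂ w₃ : Sol k G} (hΔt : 0 ≤ Δt) (hw : NodallyAdmissible S.γ w) (hldf : S.LDF w)
    (h₁ : S.IsLimited δ ε Δt (S.euler bc Δt w) w₁)
    (h₂ : S.IsLimited δ ε Δt ((3 / 4 : ℝ) • w + (1 / 4 : ℝ) • S.euler bc Δt w₁) w₂)
    (h₃ : S.IsLimited δ ε Δt ((1 / 3 : ℝ) • w + (2 / 3 : ℝ) • S.euler bc Δt w₂) w₃)
    (hcfl : S.CFL bc w Δt) (hcfl₁ : S.CFL bc w₁ Δt) (hcfl₂ : S.CFL bc w₂ Δt) :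
    S.AvgAdmissible (S.euler bc Δt w) ∧
      S.AvgAdmissible ((3 / 4 : ℝ) • w + (1 / 4 : ℝ) • S.euler bc Δt w₁) ∧
      S.AvgAdmissible ((1 / 3 : ℝ) • w + (2 / 3 : ℝ) • S.euler bc Δt w₂) ∧
      S.AvgAdmissible w₃ ∧ NodallyAdmissible S.γ w₃ ∧ S.LDF w₃ := by
  have havg := S.avgAdmissible_of_nodallyAdmissible hk hγ hw
  have hraw₁ := S.avgAdmissible_euler hk hγ hfS hsp hw (hbc w hw) hldf hΔt hcfl
  have hw₁ := S.nodallyAdmissible_of_isLimited hγ hε h₁ hraw₁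
  have hraw₂ : S.AvgAdmissible ((3 / 4 : ℝ) • w + (1 / 4 : ℝ) • S.euler bc Δt w₁) :=
    S.avgAdmissible_smul_add_smul_euler hk hγ hfS hsp havg hw₁ (hbc w₁ hw₁)
      (S.LDF_of_isLimited h₁) hΔt hcfl₁ (by norm_num) (by norm_num) (by norm_num)
  have hw₂ := S.nodallyAdmissible_of_isLimited hγ hε h₂ hraw₂
  have hraw₃ : S.AvgAdmissible ((1 / 3 : ℝ) • w + (2 / 3 : ℝ) • S.euler bc Δt w₂) :=
    S.avgAdmissible_smul_add_smul_euler hk hγ hfS hsp havg hw₂ (hbc w₂ hw₂)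
      (S.LDF_of_isLimited h₂) hΔt hcfl₂ (by norm_num) (by norm_num) (by norm_num)
  have hw₃ := S.nodallyAdmissible_of_isLimited hγ hε h₃ hraw₃
  exact ⟨hraw₁, hraw₂, hraw₃, S.avgAdmissible_of_nodallyAdmissible hk hγ hw₃, hw₃,
    S.LDF_of_isLimited h₃⟩

end Stages

end Disc

end MHD

end

theorem mainTheorem4 {k : ℕ} (hk : 1 ≤ k) (S : Disc k) (hγ : 1 < S.γ)
    (hfS : IsTwoPointFlux S.γ S.fS) (hsp : PPSpeeds S.γ S.SL S.SR) :
    -- the Chandrashekar flux is an instance of the volume flux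
    IsTwoPointFlux S.γ (chandrashekar S.γ) ∧
    -- one space dimension
    (∀ (G : Grid1) (bc : Sol1 k G → State × State),
      (∀ w, (∀ i α, Admissible S.γ (w i α)) →
        Admissible S.γ (bc w).1 ∧ Admissible S.γ (bc w).2) →
      -- evolution of the cell averages
      (∀ (w : ℝ → Sol1 k G) (t : ℝ), (∀ i α, Admissible S.γ (w t i α)) →
        (∀ i α, HasDerivAt (fun s => w s i α) (S.L1 bc (w t) i α) t) →
        ∀ i, ∃ d, HasDerivAt (fun s => S.avg1 (w s i)) d t ∧
          G.h • d + S.vol1 (w t i) =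
            S.lineBoundary 0 (w t i) (Disc.extL1 (bc (w t)) (w t) i)
              (Disc.extR1 (bc (w t)) (w t) i)) ∧
      -- the volume term vanishes and the forward Euler step has admissible averages
      (∀ w : Sol1 k G, S.LDF1 w → ∀ i, S.vol1 (w i) = 0) ∧
      (∀ (w : Sol1 k G) (τ : ℝ), (∀ i α, Admissible S.γ (w i α)) → S.LDF1 w →
        0 ≤ τ → S.CFL1 bc w τ →
        ∀ i, Admissible S.γ (S.avg1 ((w + τ • S.L1 bc w) i)))) ∧
    -- two space dimensions
    (∀ (G : Grid) (bc : Sol k G → Ghost k G),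
      (∀ w, NodallyAdmissible S.γ w → (bc w).AllAdmissible S.γ) →
      -- evolution of the cell averages
      (∀ (w : ℝ → Sol k G) (t : ℝ), NodallyAdmissible S.γ (w t) →
        (∀ i j α β, HasDerivAt (fun s => w s i j α β) (S.L bc (w t) i j α β) t) →
        ∀ i j, ∃ d, HasDerivAt (fun s => S.avg (w s i j)) d t ∧
          (G.hx * G.hy) • d + S.volumeTerm (w t) i j = S.boundaryTerm bc (w t) i j) ∧
      -- the discrete divergence is the divergence at the LGL nodes
      (∀ (w : Sol k G) i j α β, S.discDiv w i j α β =
        S.divB w i j (G.xc i + G.hx / 2 * S.X.node α) (G.yc j + G.hy / 2 * S.X.node β)) ∧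
      -- hence the volume term vanishes for a locally divergence-free field
      (∀ w : Sol k G, S.LDF w → ∀ i j, S.volumeTerm w i j = 0) ∧
      -- the LDF projection is well defined, yields such a field and keeps the cell averages
      (∀ w : Sol k G, ∃! w', S.IsLDFProjection w w') ∧
      (∀ w w' : Sol k G, S.IsLDFProjection w w' →
        S.LDF w' ∧ ∀ i j, S.avg (w' i j) = S.avg (w i j)) ∧
      -- forward Euler
      (∀ (w : Sol k G) (τ : ℝ), NodallyAdmissible S.γ w → S.LDF w →
        0 ≤ τ → S.CFL bc w τ → S.AvgAdmissible (S.euler bc τ w)) ∧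
      -- damping and limiting, Runge-Kutta methods
      (∀ (δ : Fin (k + 1) → Sol k G → Fin G.Nx → Fin G.Ny → ℝ) (ε : ℝ), 0 < ε →
        (∀ (w : Sol k G) (τ : ℝ), (S.LDF w → S.LDF (S.oedg δ τ w)) ∧
          ∀ i j, S.avg (S.oedg δ τ w i j) = S.avg (w i j)) ∧
        (∀ w : Sol k G, (S.LDF w → S.LDF (S.ppLimiter ε w)) ∧
          (∀ i j, S.avg (S.ppLimiter ε w i j) = S.avg (w i j)) ∧
          (S.AvgAdmissible w → NodallyAdmissible S.γ (S.ppLimiter ε w))) ∧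
        -- `n` time steps of a method made of convex combinations of forward Euler steps
        (∀ (R : ConvexEuler) (Δt : ℕ → ℝ) (w : ℕ → Sol k G) (W : ℕ → ℕ → Sol k G),
          (∀ n, 0 < Δt n) →
          NodallyAdmissible S.γ (w 0) → S.LDF (w 0) →
          (∀ n, W n 0 = w n ∧ w (n + 1) = W n R.s) →
          (∀ n, ∀ i < R.s, S.IsLimited δ ε (Δt n) (R.raw S bc (Δt n) (W n) i) (W n (i + 1))) →
          (∀ n, ∀ i < R.s, ∀ j ≤ i, R.a i j ≠ 0 → S.CFL bc (W n j) (R.r i j * Δt n)) →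
          ∀ n, (∀ i < R.s, S.AvgAdmissible (R.raw S bc (Δt n) (W n) i)) ∧
            (∀ i ≤ R.s, NodallyAdmissible S.γ (W n i) ∧ S.LDF (W n i) ∧
              S.AvgAdmissible (W n i))) ∧
        -- the third order SSP Runge-Kutta method
        (∀ (Δt : ℝ) (w w₁ w₂ w₃ : Sol k G), 0 < Δt →
          NodallyAdmissible S.γ w → S.LDF w →
          S.IsLimited δ ε Δt (w + Δt • S.L bc w) w₁ →
          S.IsLimited δ ε Δt
            ((3 / 4 : ℝ) • w + (1 / 4 : ℝ) • (w₁ + Δt • S.L bc w₁)) w₂ →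
          S.IsLimited δ ε Δt
            ((1 / 3 : ℝ) • w + (2 / 3 : ℝ) • (w₂ + Δt • S.L bc w₂)) w₃ →
          S.CFL bc w Δt → S.CFL bc w₁ Δt → S.CFL bc w₂ Δt →
          S.AvgAdmissible (w + Δt • S.L bc w) ∧
          S.AvgAdmissible ((3 / 4 : ℝ) • w + (1 / 4 : ℝ) • (w₁ + Δt • S.L bc w₁)) ∧
          S.AvgAdmissible ((1 / 3 : ℝ) • w + (2 / 3 : ℝ) • (w₂ + Δt • S.L bc w₂)) ∧
          S.AvgAdmissible w₃ ∧ NodallyAdmissible S.γ w₃ ∧ S.LDF w₃))) := by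
  refine ⟨isTwoPointFlux_chandrashekar hγ, fun G bc hbc => ⟨?_, ?_, ?_⟩,
    fun G bc hbc => ⟨?_, S.discDiv_eq_divB, ?_, S.existsUnique_isLDFProjection, ?_, ?_, ?_⟩⟩
  · exact fun w t hw hderiv => S.avg1_evolution hk hfS bc w t hw hderiv
  · exact fun w hldf => S.vol1_eq_zero hk hldf
  · exact fun w τ hw hldf hτ hcfl =>
      S.admissible_avg1_euler hk hγ hfS hsp hw (hbc w hw) hldf hτ hcfl
  · exact fun w t hw hderiv => S.avg_evolution hk hfS bc w t hw hderiv
  · exact fun w hldf => S.volumeTerm_eq_zero hk hldf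
  · exact fun w w' h => ⟨S.LDF_of_isLDFProjection h, S.avg_of_isLDFProjection h⟩
  · exact fun w τ hw hldf hτ hcfl =>
      S.avgAdmissible_euler hk hγ hfS hsp hw (hbc w hw) hldf hτ hcfl
  · refine fun δ ε hε => ⟨fun w τ => ⟨S.LDF_oedg δ τ, S.avg_oedg δ τ w⟩, fun w =>
      ⟨S.LDF_ppLimiter ε, S.avg_ppLimiter ε w, S.nodallyAdmissible_ppLimiter hγ hε⟩, ?_, ?_⟩
    · exact fun R Δt w W hΔt hw₀ hldf₀ hW hlim hcfl => S.admissible_and_LDF_of_convexEuler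
        hk hγ hfS hsp hbc hε R (fun n => (hΔt n).le) hw₀ hldf₀ hW hlim hcfl
    · exact fun Δt w w₁ w₂ w₃ hΔt hw hldf h₁ h₂ h₃ hcfl hcfl₁ hcfl₂ =>
        S.admissible_and_LDF_of_ssp3 hk hγ hfS hsp hbc hε hΔt.le hw hldf h₁ h₂ h₃ hcfl hcfl₁ hcfl₂
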